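/- Let $M$ be a transitive model (set or proper class) of ZFC in the universe $V$. Definitions. Let $M\models\langle X,\tau\rangle$ be a topological space; all spaces are $T_0$. A preinterpretation of $X$ over $M$ is a topological space $\langle\hat X,\hat\tau\rangle$ in $V$ with maps $\pi\colon X\to\hat X$ and $\pi\colon\tau\to\hat\tau$ such that $x\in O\Leftrightarrow\pi(x)\in\pi(O)$ for $x\in X$, $O\in\tau$; $\pi$ commutes with finite intersections and with those unions of families of open sets which belong to $M$; $\pi(\emptyset)=\emptyset$ and $\pi(X)=\hat X$; and $\{\pi(O):O\in\tau\}$ is a basis of $\hat\tau$. A reduction of a preinterpretation $\pi_0\colon X\to\hat X_0$ to $\pi_1\colon X\to\hat X_1$ is a map $h\colon\hat X_0\to\hat X_1$ with $\pi_1=h\circ\pi_0$ on $X$ and $h^{-1}(\pi_1(O))=\pi_0(O)$ for all $O\in\tau$. An interpretation of $X$ is a preinterpretation to which every preinterpretation of $X$ reduces; a map defined on the points of $X$ is called an interpretation if it extends to one. If $\pi\colon X\to\hat X$ and $\chi\colon Y\to\hat Y$ are interpretations and $M\models f\colon X\to Y$ is continuous, the interpretation of $f$ is the continuous $\hat f\colon\hat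 X\to\hat Y$ with $\hat f\circ\pi=\chi\circ f$. The reals $\mathbb{R}^M$ of $M$ are interpreted by the inclusion $\mathbb{R}^M\subseteq\mathbb{R}$, and products by products of interpretations (that these maps are interpretations of the spaces below is part of the claim). Theorem. Suppose that $M\models$ "$X$ is a real Banach space with norm $\phi$", let $X^*$ and $\phi^*$ be the dual of $X$ and the dual norm, computed in $M$, and let $\pi\colon X\to\hat X$ be an interpretation of $X$ with its norm topology. Then the interpretations of addition, of multiplication by scalars and of $\phi$ turn $\hat X$ into a real Banach space with norm $\pi(\phi)$, which induces the topology of $\hat X$. Let $(\hat X)^*$ be its normed dual, with norm $\pi(\phi)^*$. For $x^*\in X^*$ let $\pi(x^*)\colon\hat X\to\mathbb{R}$ be the interpretation of the function $x^*$. Then: 1. there is a closed linear subspace $C$ of $(\hat X)^*$ such that $x^*\mapsto\pi(x^*)$ maps $X^*$ into $C$ and is an interpretation $X^*\to C$ of $X^*$ with its dual norm topology; 2. with respect to it, the norm $\phi^*$ is interpreted as the restriction of $\pi(\phi)^*$ to $C$; 3. the evaluation bracket $X\times X^*\to\mathbb{R}^M$, $(x,x^*)\mapsto x^*(x)$, is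 interpreted as the restriction to $\hat X\times C$ of the evaluation bracket $\hat X\times(\hat X)^*\to\mathbb{R}$; 4. if $M\models$ "$X$ is uniformly convex", then $C=(\hat X)^*$. -/

import Mathlib

universe u v w w'

/-! ### Transitive models of ZFC

The universe `V` is `ZFSet.{u}`; a set of `V` is, up to bijection, a type in `Type u`.
A class `M` is a `Set ZFSet.{u}`; it may be a set or a proper class. -/

/-- The only relation symbol of the language of set theory. -/
inductive MemSymbol : ℕ → Type
  | mem : MemSymbol 2

/-- The first-order language of set theory. -/
def setLang : FirstOrder.Language.{0, 0} := ⟨fun _ => Empty, MemSymbol⟩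

/-- A class of sets is a structure `(M, ∈)` for the language of set theory. -/
instance memStructure (M : Set ZFSet.{u}) : setLang.Structure M where
  funMap := fun {_} f => nomatch f
  RelMap := fun {_} r => match r with
    | MemSymbol.mem => fun a => (a 0 : ZFSet.{u}) ∈ (a 1 : ZFSet.{u})

/-- `M` is a transitive model of ZFC. Each axiom is the usual one with its quantifiers restricted
to `M`; the two schemes range over all relations that are first-order definable over `(M, ∈)` with
parameters from `M`. Extensionality and foundation hold in every transitive class. -/
structure IsTransitiveModelZFC (M : Set ZFSet.{u}) : Prop where
  transitive : ∀ x ∈ M, ∀ y ∈ x, y ∈ M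
  pairing : ∀ x ∈ M, ∀ y ∈ M, ∃ z ∈ M, ∀ t ∈ M, t ∈ z ↔ t = x ∨ t = y
  union : ∀ x ∈ M, ∃ z ∈ M, ∀ t ∈ M, t ∈ z ↔ ∃ y ∈ M, y ∈ x ∧ t ∈ y
  powerset : ∀ x ∈ M, ∃ z ∈ M, ∀ t ∈ M, t ∈ z ↔ ∀ y ∈ M, y ∈ t → y ∈ x
  infinity : ∃ z ∈ M, (∃ e ∈ M, (∀ t ∈ M, t ∉ e) ∧ e ∈ z) ∧
    ∀ n ∈ M, n ∈ z → ∃ s ∈ M, s ∈ z ∧ ∀ t ∈ M, t ∈ s ↔ t ∈ n ∨ t = n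
  separation : ∀ S : Set M, (Set.univ : Set M).Definable₁ setLang S →
    ∀ x : M, ∃ z : M, ∀ t : M, t.1 ∈ z.1 ↔ t.1 ∈ x.1 ∧ t ∈ S
  replacement : ∀ R : Set (M × M), (Set.univ : Set M).Definable₂ setLang R →
    ∀ x : M, (∀ a : M, a.1 ∈ x.1 → ∃! b : M, (a, b) ∈ R) →
      ∃ z : M, ∀ b : M, b.1 ∈ z.1 ↔ ∃ a : M, a.1 ∈ x.1 ∧ (a, b) ∈ R
  choice : ∀ x ∈ M, (∀ a ∈ M, a ∈ x → ∃ t ∈ M, t ∈ a) →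
    (∀ a ∈ M, a ∈ x → ∀ b ∈ M, b ∈ x → (∃ t ∈ M, t ∈ a ∧ t ∈ b) → a = b) →
    ∃ c ∈ M, ∀ a ∈ M, a ∈ x → ∃! t, t ∈ M ∧ t ∈ a ∧ t ∈ c

/-- The collection `S` of sets is (the extension of) an element of `M`. -/
def InModel (M : Set ZFSet.{u}) (S : Set ZFSet.{u}) : Prop :=
  ∃ z ∈ M, (z : Set ZFSet.{u}) = S

/-- The von Neumann natural number `n`. -/
def natCode : ℕ → ZFSet.{u}
  | 0 => ∅
  | n + 1 => insert (natCode n) (natCode n)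

/-- The real number `r` as a set: its (strict, lower) Dedekind cut, where the rational
`(m - n) / (k + 1)` is given by each of the triples `(m, n, k)` of natural numbers. -/
noncomputable def realCode (r : ℝ) : ZFSet.{u} :=
  ZFSet.range fun p : {p : ℕ × ℕ × ℕ // ((p.1 : ℝ) - p.2.1) / (p.2.2 + 1) < r} =>
    ZFSet.pair (natCode p.1.1) (ZFSet.pair (natCode p.1.2.1) (natCode p.1.2.2))

/-- The set `ℝ^M` of real numbers of `M`. -/
def MReal (M : Set ZFSet.{u}) : Type := {r : ℝ // realCode.{u} r ∈ M}

/-- The inclusion of `ℝ^M` in `ℝ`. -/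
def MReal.val {M : Set ZFSet.{u}} (r : MReal M) : ℝ := Subtype.val r

/-! ### Topological spaces in a model and their interpretations -/

/-- A topological space as seen by a model: the points (each one coded by a set) and the open sets
which belong to the model. -/
structure MSpace : Type (max (u + 1) (w + 1)) where
  Pt : Type w
  code : Pt → ZFSet.{u}
  opens : Set (Set Pt)

/-- A topological space in `V`, with its topology as a plain field. -/
structure VSpace : Type (u + 1) where
  Pt : Type u
  top : TopologicalSpace Pt

/-- The real line of `M`. -/
noncomputable def realSpace (M : Set ZFSet.{u}) : MSpace.{u, 0} where
  Pt := MReal M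
  code := fun r => realCode r.val
  opens := {O | InModel M ((fun r : MReal M => realCode r.val) '' O) ∧
    ∀ r ∈ O, ∃ ε > 0, ∀ s : MReal M, |s.val - r.val| < ε → s ∈ O}

/-- The product of two spaces, computed in `M`. -/
def MSpace.prod (M : Set ZFSet.{u}) (S : MSpace.{u, w}) (T : MSpace.{u, w'}) :
    MSpace.{u, max w w'} where
  Pt := S.Pt × T.Pt
  code := fun p => ZFSet.pair (S.code p.1) (T.code p.2)
  opens := {O | InModel M ((fun p : S.Pt × T.Pt => ZFSet.pair (S.code p.1) (T.code p.2)) '' O) ∧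
    ∀ p ∈ O, ∃ U ∈ S.opens, ∃ W ∈ T.opens, p.1 ∈ U ∧ p.2 ∈ W ∧ U ×ˢ W ⊆ O}

/-- A collection of open sets of `S` is an element of `M`. -/
def MSpace.FamilyIn (M : Set ZFSet.{u}) (S : MSpace.{u, w}) (F : Set (Set S.Pt)) : Prop :=
  F ⊆ S.opens ∧ InModel M {z | ∃ O ∈ F, (z : Set ZFSet.{u}) = S.code '' O}

/-- The maps `pt` on points and `op` on open sets form a topological preinterpretation of `S`
over `M` into the (`T₀`) space `Y`. -/
structure IsPreinterpretation (M : Set ZFSet.{u}) (S : MSpace.{u, w}) {Y : Type v}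
    (top : TopologicalSpace Y) (pt : S.Pt → Y) (op : Set S.Pt → Set Y) : Prop where
  t0 : T0Space Y
  isOpen : ∀ O ∈ S.opens, IsOpen (op O)
  mem_iff : ∀ x, ∀ O ∈ S.opens, x ∈ O ↔ pt x ∈ op O
  inter : ∀ O ∈ S.opens, ∀ P ∈ S.opens, op (O ∩ P) = op O ∩ op P
  sUnion : ∀ F : Set (Set S.Pt), S.FamilyIn M F → op (⋃₀ F) = ⋃ O ∈ F, op O
  empty : op ∅ = ∅
  univ : op Set.univ = Set.univ
  basis : TopologicalSpace.IsTopologicalBasis (op '' S.opens)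

/-- `h` is a reduction of the preinterpretation `(pt₀, op₀)` to `(pt₁, op₁)`. -/
def IsReduction (S : MSpace.{u, w}) {Y₀ : Type v} {Y₁ : Type w'}
    (pt₀ : S.Pt → Y₀) (op₀ : Set S.Pt → Set Y₀) (pt₁ : S.Pt → Y₁) (op₁ : Set S.Pt → Set Y₁)
    (h : Y₀ → Y₁) : Prop :=
  pt₁ = h ∘ pt₀ ∧ ∀ O ∈ S.opens, h ⁻¹' (op₁ O) = op₀ O

/-- `(pt, op)` is an interpretation of `S` over `M`: a preinterpretation to which every
preinterpretation in `V` can be reduced. -/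
def IsInterpretation (M : Set ZFSet.{u}) (S : MSpace.{u, w}) {Y : Type v}
    (top : TopologicalSpace Y) (pt : S.Pt → Y) (op : Set S.Pt → Set Y) : Prop :=
  IsPreinterpretation M S top pt op ∧
    ∀ (Y' : Type u) (top' : TopologicalSpace Y') (pt' : S.Pt → Y') (op' : Set S.Pt → Set Y'),
      IsPreinterpretation M S top' pt' op' → ∃ h : Y' → Y, IsReduction S pt' op' pt op h

/-- The map `pt` on points extends to an interpretation of `S` over `M`. -/
def Interprets (M : Set ZFSet.{u}) (S : MSpace.{u, w}) {Y : Type v}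
    (top : TopologicalSpace Y) (pt : S.Pt → Y) : Prop :=
  ∃ op : Set S.Pt → Set Y, IsInterpretation M S top pt op

/-- With respect to the interpretations `π` of `S` and `χ` of `T`, the continuous function `g` is
the interpretation of `f`. -/
def InterpretsMap {S : MSpace.{u, w}} {T : MSpace.{u, w'}} (M : Set ZFSet.{u})
    {Y : Type*} {Z : Type*} [TopologicalSpace Y] [TopologicalSpace Z]
    (π : S.Pt → Y) (χ : T.Pt → Z) (f : S.Pt → T.Pt) (g : Y → Z) : Prop :=
  Interprets M S inferInstance π ∧ Interprets M T inferInstance χ ∧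
    Continuous g ∧ ∀ x, g (π x) = χ (f x)

/-! ### Banach spaces in a model and their duals -/

/-- `M ⊨` "`carrier` is a real Banach space with norm `norm`". The set and the operations belong
to `M`, the scalars are the reals of `M`, and the sequences considered in the completeness axiom
are those in `M`. Sums, products and the order of reals of `M` are computed in `ℝ`. -/
structure BanachIn (M : Set ZFSet.{u}) where
  carrier : ZFSet.{u}
  carrier_mem : carrier ∈ M
  [group : AddCommGroup carrier]
  smul : MReal M → carrier → carrier
  norm : carrier → MReal M
  add_mem : InModel M {z | ∃ x y : carrier, z = ZFSet.pair (ZFSet.pair x y) (x + y : carrier)}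
  smul_mem : InModel M
    {z | ∃ (r : MReal M) (x : carrier), z = ZFSet.pair (ZFSet.pair (realCode r.val) x) (smul r x)}
  norm_mem : InModel M {z | ∃ x : carrier, z = ZFSet.pair x (realCode (norm x).val)}
  smul_add : ∀ r x y, smul r (x + y) = smul r x + smul r y
  add_smul : ∀ r s t x, t.val = r.val + s.val → smul t x = smul r x + smul s x
  mul_smul : ∀ r s t x, t.val = r.val * s.val → smul t x = smul r (smul s x)
  one_smul : ∀ r x, r.val = 1 → smul r x = x
  norm_add_le : ∀ x y, (norm (x + y)).val ≤ (norm x).val + (norm y).val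
  norm_smul : ∀ r x, (norm (smul r x)).val = |r.val| * (norm x).val
  eq_zero_of_norm : ∀ x, (norm x).val = 0 → x = 0
  complete : ∀ s : ℕ → carrier,
    InModel M {z | ∃ n, z = ZFSet.pair (natCode n) (s n)} →
    (∀ ε : ℝ, 0 < ε → ∃ N, ∀ m ≥ N, ∀ n ≥ N, (norm (s m - s n)).val < ε) →
    ∃ x : carrier, ∀ ε : ℝ, 0 < ε → ∃ N, ∀ n ≥ N, (norm (s n - x)).val < ε

namespace BanachIn

variable {M : Set ZFSet.{u}}

instance (X : BanachIn M) : AddCommGroup X.carrier := X.group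

/-- The topological space underlying `X`, in `M`. -/
def space (X : BanachIn M) : MSpace.{u, u + 1} where
  Pt := X.carrier
  code := fun x => x
  opens := {O | InModel M ((fun x : X.carrier => (x : ZFSet.{u})) '' O) ∧
    ∀ x ∈ O, ∃ ε > 0, ∀ y, (X.norm (y - x)).val < ε → y ∈ O}

/-- `M ⊨ X` is uniformly convex. -/
def UniformlyConvex (X : BanachIn M) : Prop :=
  ∀ ε : ℝ, 0 < ε → ∃ δ : ℝ, 0 < δ ∧ ∀ x y, (X.norm x).val = 1 → (X.norm y).val = 1 →
    ε ≤ (X.norm (x - y)).val → (X.norm (x + y)).val ≤ 2 - δ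

/-- The elements of the dual `X^*` computed in `M`: the bounded linear functionals `X → ℝ^M`
whose graph belongs to `M`. -/
structure Dual (X : BanachIn M) where
  toFun : X.carrier → MReal M
  graph : ZFSet.{u}
  graph_mem : graph ∈ M
  coe_graph : (graph : Set ZFSet.{u}) = 
    {z | ∃ x : X.carrier, z = ZFSet.pair x (realCode (toFun x).val)}
  map_add : ∀ x y, (toFun (x + y)).val = (toFun x).val + (toFun y).val
  map_smul : ∀ r x, (toFun (X.smul r x)).val = r.val * (toFun x).val
  bounded : ∃ C : ℝ, ∀ x, |(toFun x).val| ≤ C * (X.norm x).val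

/-- The supremum of `|f|` over the closed unit ball of `X`. -/
noncomputable def supNorm (X : BanachIn M) (f : X.carrier → ℝ) : ℝ :=
  sSup {t | ∃ x, (X.norm x).val ≤ 1 ∧ t = |f x|}

/-- The dual `X^*` with the topology of the dual norm, in `M`. -/
noncomputable def dualSpace (X : BanachIn M) : MSpace.{u, u + 1} where
  Pt := X.Dual
  code := Dual.graph
  opens := {O | InModel M (Dual.graph '' O) ∧
    ∀ f ∈ O, ∃ ε > 0, ∀ g : X.Dual,
      X.supNorm (fun x => (g.toFun x).val - (f.toFun x).val) < ε → g ∈ O}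

end BanachIn

/-!
The interpretation of a metric space of `M` which `M` believes to be complete is its metric
completion in `V`: given a preinterpretation and a point `x` of it, the open sets of `M` whose
images contain `x` form a Cauchy filter, because `M` covers the space by small open sets, and `x`
is sent to the limit. Conversely the completion respects the covers in `M`: a counterexample would
give an infinite sequence of shrinking balls, none of them inside a member of the cover. Being
well-founded is absolute, so `M` would contain such a sequence, and a limit of it, a contradiction.
Interpretations are unique up to homeomorphism, so `Xhat` is the completion of `X`, and every
functional of `M` extends to it; by density the dual norm of the extension is the one computed in
`M`. Hence `C` is the closure of the set of extensions in the dual of `Xhat`.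

If `X` is uniformly convex, then so is `Xhat`, which is thus reflexive by the Milman–Pettis theorem.
A functional which separates a point of the dual of `Xhat` from `C` would be the evaluation at a
nonzero point of `Xhat`, so it suffices that functionals of `M` separate the points of `Xhat`. This
is the Hahn–Banach theorem in `M`. Its proof transfers a maximality argument only: extend the cone
over the ball of radius `‖x‖ / 2` around `x` to a maximal, hence total, order cone in `M`. As it
misses the ball around `-x`, there is in `V` a nonzero functional which is nonnegative on it. This
functional is unique up to a factor, hence definable from the cone, and so belongs to `M`.
-/

namespace ModelInterpretation

open Filter Topology

section DefinableRel

variable {M : Set ZFSet.{u}} {α : Type}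

/-- A relation on `M`, with arguments indexed by `α`, which is first-order definable over `(M, ∈)`
with parameters from `M`. -/
def DefinableRel (P : (α → M) → Prop) : Prop :=
  (Set.univ : Set M).Definable setLang {v | P v}

namespace DefinableRel

variable {P Q : (α → M) → Prop}

theorem congr (h : DefinableRel P) (hPQ : ∀ v, Q v ↔ P v) : DefinableRel Q := by
  rwa [funext fun v => propext (hPQ v)]

theorem and (hP : DefinableRel P) (hQ : DefinableRel Q) : DefinableRel fun v => P v ∧ Q v :=
  Set.Definable.inter hP hQ

theorem or (hP : DefinableRel P) (hQ : DefinableRel Q) : DefinableRel fun v => P v ∨ Q v :=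
  Set.Definable.union hP hQ

theorem not (hP : DefinableRel P) : DefinableRel fun v => ¬ P v :=
  Set.Definable.compl hP

theorem imp (hP : DefinableRel P) (hQ : DefinableRel Q) : DefinableRel fun v => P v → Q v :=
  (hP.not.or hQ).congr fun _ => imp_iff_not_or

theorem iff (hP : DefinableRel P) (hQ : DefinableRel Q) : DefinableRel fun v => (P v ↔ Q v) :=
  ((hP.imp hQ).and (hQ.imp hP)).congr fun _ => iff_def

theorem ex [Finite α] {P : (α → M) → M → Prop}
    (h : DefinableRel fun w : Option α → M => P (fun a => w (some a)) (w none)) :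
    DefinableRel fun v => ∃ x, P v x := by
  refine DefinableRel.congr (Set.Definable.image_comp h (some : α → Option α)) fun v => ⟨?_, ?_⟩
  · rintro ⟨x, hx⟩
    exact ⟨fun o => o.elim x v, hx, rfl⟩
  · rintro ⟨w, hw, rfl⟩
    exact ⟨w none, hw⟩

theorem all [Finite α] {P : (α → M) → M → Prop}
    (h : DefinableRel fun w : Option α → M => P (fun a => w (some a)) (w none)) :
    DefinableRel fun v => ∀ x, P v x :=
  (DefinableRel.ex (P := fun v x => ¬ P v x) h.not).not.congr fun v => by simp

theorem comp {β : Type} {P : (β → M) → Prop} (h : DefinableRel P) (f : β → α) :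
    DefinableRel fun v : α → M => P fun b => v (f b) :=
  Set.Definable.preimage_comp f h

theorem subst₁ {S : M → Prop} (h : DefinableRel fun v : Fin 1 → M => S (v 0)) (i : α) :
    DefinableRel fun v : α → M => S (v i) :=
  h.comp fun _ => i

theorem subst₂ {S : M → M → Prop} (h : DefinableRel fun v : Fin 2 → M => S (v 0) (v 1))
    (i j : α) : DefinableRel fun v : α → M => S (v i) (v j) :=
  h.comp ![i, j]

theorem mem (i j : α) :
    DefinableRel fun v : α → M => (v i : ZFSet.{u}) ∈ (v j : ZFSet.{u}) := by
  refine subst₂ (S := fun x y => (x : ZFSet.{u}) ∈ (y : ZFSet.{u})) ?_ i j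
  have hmem : (∅ : Set M).Definable setLang
      {v : Fin 2 → M | (v 0 : ZFSet.{u}) ∈ (v 1 : ZFSet.{u})} :=
    Set.empty_definable_iff.2 ⟨FirstOrder.Language.Relations.formula (L := setLang) MemSymbol.mem
      ![FirstOrder.Language.Term.var 0, FirstOrder.Language.Term.var 1], rfl⟩
  exact hmem.mono (Set.empty_subset _)

theorem eq (i j : α) : DefinableRel fun v : α → M => v i = v j :=
  subst₂ (S := fun x y => x = y) (Set.Definable.diagonal setLang (Set.univ : Set M)) i j

theorem eq_const (i : α) (c : M) : DefinableRel fun v : α → M => v i = c :=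
  subst₁ (S := fun x => x = c)
    (Set.Definable.singleton_of_mem setLang (Set.mem_univ c)) i

end DefinableRel

end DefinableRel

section Pairing

variable {M : Set ZFSet.{u}} [hM : Fact (IsTransitiveModelZFC M)] {α : Type}

theorem mem_of_mem {x y : ZFSet.{u}} (hy : y ∈ M) (h : x ∈ y) : x ∈ M :=
  hM.out.transitive y hy x h

theorem eq_of_forall_mem_iff {x y : M} (h : ∀ t : M, t.1 ∈ x.1 ↔ t.1 ∈ y.1) : x = y :=
  Subtype.ext <| ZFSet.ext fun t =>
    ⟨fun ht => (h ⟨t, mem_of_mem x.2 ht⟩).1 ht, fun ht => (h ⟨t, mem_of_mem y.2 ht⟩).2 ht⟩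

theorem unorderedPair_mem {x y : ZFSet.{u}} (hx : x ∈ M) (hy : y ∈ M) :
    ({x, y} : ZFSet.{u}) ∈ M := by
  obtain ⟨z, hz, h⟩ := hM.out.pairing x hx y hy
  suffices hzxy : ({x, y} : ZFSet.{u}) = z by rwa [hzxy]
  ext t
  rw [ZFSet.mem_pair]
  refine ⟨?_, fun ht => (h t (mem_of_mem hz ht)).1 ht⟩
  rintro (rfl | rfl)
  · exact (h _ hx).2 (Or.inl rfl)
  · exact (h _ hy).2 (Or.inr rfl)

/-- The unordered pair as an operation on `M`. -/
def unorderedPair (x y : M) : M := ⟨{x.1, y.1}, unorderedPair_mem x.2 y.2⟩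

theorem eq_unorderedPair_iff {x y z : M} :
    z = unorderedPair x y ↔ ∀ t : M, t.1 ∈ z.1 ↔ t = x ∨ t = y := by
  have hmem (t : M) : t.1 ∈ (unorderedPair x y).1 ↔ t = x ∨ t = y := by
    simp only [unorderedPair, ZFSet.mem_pair, Subtype.ext_iff]
  refine ⟨?_, fun h => eq_of_forall_mem_iff fun t => (h t).trans (hmem t).symm⟩
  rintro rfl
  exact hmem

theorem pair_mem {x y : ZFSet.{u}} (hx : x ∈ M) (hy : y ∈ M) : ZFSet.pair x y ∈ M := by
  rw [ZFSet.pair, ← ZFSet.pair_eq_singleton]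
  exact unorderedPair_mem (unorderedPair_mem hx hx) (unorderedPair_mem hx hy)

/-- The ordered pair as an operation on `M`. -/
def orderedPair (x y : M) : M := ⟨ZFSet.pair x.1 y.1, pair_mem x.2 y.2⟩

@[simp]
theorem orderedPair_inj {x y x' y' : M} :
    orderedPair x y = orderedPair x' y' ↔ x = x' ∧ y = y' := by
  simp only [orderedPair, ZFSet.pair_inj, Subtype.ext_iff]

theorem orderedPair_eq (x y : M) :
    orderedPair x y = unorderedPair (unorderedPair x x) (unorderedPair x y) := by
  simp only [orderedPair, unorderedPair, ZFSet.pair, ZFSet.pair_eq_singleton]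

theorem DefinableRel.eq_unorderedPair (i j k : α) :
    DefinableRel fun v : α → M => v k = unorderedPair (v i) (v j) := by
  refine DefinableRel.comp (β := Fin 3) (P := fun v => v 2 = unorderedPair (v 0) (v 1)) ?_
    ![i, j, k]
  simp only [eq_unorderedPair_iff]
  exact all ((mem _ _).iff ((eq _ _).or (eq _ _)))

theorem DefinableRel.eq_orderedPair (i j k : α) :
    DefinableRel fun v : α → M => v k = orderedPair (v i) (v j) := by
  refine DefinableRel.comp (β := Fin 3) (P := fun v => v 2 = orderedPair (v 0) (v 1)) ?_
    ![i, j, k]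
  have h : DefinableRel fun v : Fin 3 → M => ∃ s t, s = unorderedPair (v 0) (v 0) ∧
      t = unorderedPair (v 0) (v 1) ∧ v 2 = unorderedPair s t :=
    ex (ex ((eq_unorderedPair _ _ _).and
      ((eq_unorderedPair _ _ _).and (eq_unorderedPair _ _ _))))
  exact h.congr fun v => by simp [orderedPair_eq]

end Pairing

section Coded

/-- The elements of the type `A` are coded by elements of `M`; the codes form a definable class. -/
class Coded (M : Set ZFSet.{u}) (A : Type v) where
  code : A → M
  injective : Function.Injective code
  definable_range : DefinableRel fun v : Fin 1 → M => ∃ a, v 0 = code a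

open Coded

variable {M : Set ZFSet.{u}} {A : Type v} {B : Type w} {C : Type w'}

/-- A predicate on a coded type which is definable over `M` with parameters. -/
def DefinablePred (M : Set ZFSet.{u}) {A : Type v} [Coded M A] (P : A → Prop) : Prop :=
  DefinableRel fun v : Fin 1 → M => ∃ a, v 0 = code a ∧ P a

/-- A function between coded types whose graph is definable over `M` with parameters. -/
def DefinableFun (M : Set ZFSet.{u}) {A : Type v} {B : Type w} [Coded M A] [Coded M B]
    (f : A → B) : Prop :=
  DefinableRel fun v : Fin 2 → M => ∃ a, v 0 = code a ∧ v 1 = code (f a)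

@[simp]
theorem code_inj [Coded M A] {a b : A} : (code a : M) = code b ↔ a = b :=
  Coded.injective.eq_iff

theorem DefinableRel.exists_eq_code [Coded M A] {α : Type} (i : α) :
    DefinableRel fun v : α → M => ∃ a : A, v i = code a :=
  DefinableRel.subst₁ (S := fun x => ∃ a : A, x = code a) Coded.definable_range i

theorem DefinablePred.definableRel [Coded M A] {P : A → Prop} (h : DefinablePred M P)
    {α : Type} (i : α) : DefinableRel fun v : α → M => ∃ a, v i = code a ∧ P a :=
  DefinableRel.subst₁ (S := fun x => ∃ a, x = code a ∧ P a) h i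

theorem DefinableFun.definableRel [Coded M A] [Coded M B] {f : A → B} (h : DefinableFun M f)
    {α : Type} (i j : α) : DefinableRel fun v : α → M => ∃ a, v i = code a ∧ v j = code (f a) :=
  DefinableRel.subst₂ (S := fun x y => ∃ a, x = code a ∧ y = code (f a)) h i j

instance instCodedModel : Coded M M where
  code := id
  injective := Function.injective_id
  definable_range := (DefinableRel.eq 0 0).congr fun v => by simp

/-- A type is coded by an injection with definable range into a coded type. -/
abbrev Coded.ofInjective [Coded M A] (f : B → A) (hf : Function.Injective f)
    (h : DefinablePred M fun a => ∃ b, a = f b) : Coded M B where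
  code b := code (f b)
  injective := Coded.injective.comp hf
  definable_range := DefinableRel.congr h fun v => by aesop

instance instCodedProd [Fact (IsTransitiveModelZFC M)] [Coded M A] [Coded M B] :
    Coded M (A × B) where
  code p := orderedPair (code p.1) (code p.2)
  injective := by
    rintro ⟨a, b⟩ ⟨a', b'⟩ h
    rwa [orderedPair_inj, code_inj, code_inj, ← Prod.mk_inj] at h
  definable_range := by
    have h : DefinableRel fun v : Fin 1 → M => ∃ x y, (∃ a : A, x = code a) ∧
        (∃ b : B, y = code b) ∧ v 0 = orderedPair x y :=
      .ex (.ex ((DefinableRel.exists_eq_code _).and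
        ((DefinableRel.exists_eq_code _).and (DefinableRel.eq_orderedPair _ _ _))))
    exact h.congr fun v => by aesop

@[simp]
theorem code_prod [Fact (IsTransitiveModelZFC M)] [Coded M A] [Coded M B] (a : A) (b : B) :
    (code (a, b) : M) = orderedPair (code a) (code b) := rfl

namespace DefinablePred

section Boolean

variable [Coded M A] {P Q : A → Prop}

theorem congr (h : DefinablePred M P) (hPQ : ∀ a, Q a ↔ P a) : DefinablePred M Q := by
  rwa [funext fun a => propext (hPQ a)]

theorem and (hP : DefinablePred M P) (hQ : DefinablePred M Q) :
    DefinablePred M fun a => P a ∧ Q a :=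
  (DefinableRel.and hP hQ).congr fun v => by aesop

theorem not (hP : DefinablePred M P) : DefinablePred M fun a => ¬ P a :=
  ((DefinableRel.exists_eq_code (A := A) 0).and (DefinableRel.not hP)).congr fun v => by aesop

theorem or (hP : DefinablePred M P) (hQ : DefinablePred M Q) :
    DefinablePred M fun a => P a ∨ Q a :=
  (hP.not.and hQ.not).not.congr fun _ => by tauto

theorem imp (hP : DefinablePred M P) (hQ : DefinablePred M Q) :
    DefinablePred M fun a => P a → Q a :=
  (hP.not.or hQ).congr fun _ => imp_iff_not_or

theorem iff (hP : DefinablePred M P) (hQ : DefinablePred M Q) :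
    DefinablePred M fun a => (P a ↔ Q a) :=
  ((hP.imp hQ).and (hQ.imp hP)).congr fun _ => iff_def

end Boolean

section Composition

variable [Coded M A] [Coded M B]

theorem comp {f : A → B} {P : B → Prop} (hP : DefinablePred M P) (hf : DefinableFun M f) :
    DefinablePred M fun a => P (f a) := by
  have h : DefinableRel fun v : Fin 1 → M => ∃ y, (∃ a, v 0 = code a ∧ y = code (f a)) ∧
      ∃ b, y = code b ∧ P b :=
    .ex ((hf.definableRel _ _).and (hP.definableRel _))
  exact h.congr fun v => by aesop

theorem mem {f g : A → M} (hf : DefinableFun M f) (hg : DefinableFun M g) :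
    DefinablePred M fun a => (f a : ZFSet.{u}) ∈ (g a : ZFSet.{u}) := by
  have h : DefinableRel fun v : Fin 1 → M => ∃ y z, (∃ a, v 0 = code a ∧ y = code (f a)) ∧
      (∃ a, v 0 = code a ∧ z = code (g a)) ∧ y.1 ∈ z.1 :=
    .ex (.ex ((hf.definableRel _ _).and ((hg.definableRel _ _).and (DefinableRel.mem _ _))))
  exact DefinableRel.congr h fun v => by aesop

theorem eq {f g : A → B} (hf : DefinableFun M f) (hg : DefinableFun M g) :
    DefinablePred M fun a => f a = g a := by
  have h : DefinableRel fun v : Fin 1 → M => ∃ y, (∃ a, v 0 = code a ∧ y = code (f a)) ∧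
      ∃ a, v 0 = code a ∧ y = code (g a) :=
    .ex ((hf.definableRel _ _).and (hg.definableRel _ _))
  exact h.congr fun v => by aesop

end Composition

section Quantifiers

variable [Fact (IsTransitiveModelZFC M)] [Coded M A] [Coded M B] {R : A → B → Prop}

theorem ex (h : DefinablePred M fun p : A × B => R p.1 p.2) :
    DefinablePred M fun a => ∃ b, R a b := by
  have h' : DefinableRel fun v : Fin 1 → M => ∃ y z, (∃ p : A × B, z = code p ∧ R p.1 p.2) ∧
      z = orderedPair (v 0) y :=
    .ex (.ex ((h.definableRel _).and (DefinableRel.eq_orderedPair _ _ _)))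
  exact h'.congr fun v => by aesop

theorem all (h : DefinablePred M fun p : A × B => R p.1 p.2) :
    DefinablePred M fun a => ∀ b, R a b :=
  (DefinablePred.ex (R := fun a b => ¬ R a b) h.not).not.congr fun a => by simp

end Quantifiers

end DefinablePred

namespace DefinableFun

section Basic

variable [Coded M A] [Coded M B] [Coded M C]

theorem id : DefinableFun M fun a : A => a :=
  ((DefinableRel.exists_eq_code (A := A) 0).and (DefinableRel.eq 1 0)).congr fun v => by aesop

theorem const (b : B) : DefinableFun M fun _ : A => b :=
  ((DefinableRel.exists_eq_code (A := A) 0).and (DefinableRel.eq_const 1 (code b))).congr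
    fun v => by aesop

theorem comp {f : A → B} {g : B → C} (hg : DefinableFun M g) (hf : DefinableFun M f) :
    DefinableFun M fun a => g (f a) := by
  have h : DefinableRel fun v : Fin 2 → M => ∃ y, (∃ a, v 0 = code a ∧ y = code (f a)) ∧
      ∃ b, y = code b ∧ v 1 = code (g b) :=
    .ex ((hf.definableRel _ _).and (hg.definableRel _ _))
  exact h.congr fun v => by aesop

theorem code {f : C → A} (hf : DefinableFun M f) :
    DefinableFun M fun c => (Coded.code (f c) : M) :=
  hf.congr fun _ => Iff.rfl

end Basic

section Product

variable [Fact (IsTransitiveModelZFC M)] [Coded M A] [Coded M B] [Coded M C]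

theorem fst {f : C → A × B} (hf : DefinableFun M f) : DefinableFun M fun c => (f c).1 := by
  have h : DefinableRel fun v : Fin 2 → M =>
      ∃ z, (∃ c, v 0 = Coded.code c ∧ z = Coded.code (f c)) ∧ ∃ y, z = orderedPair (v 1) y :=
    .ex ((hf.definableRel _ _).and (.ex (DefinableRel.eq_orderedPair _ _ _)))
  refine h.congr fun v => ⟨?_, ?_⟩
  · rintro ⟨c, h₀, h₁⟩
    exact ⟨_, ⟨c, h₀, rfl⟩, Coded.code (f c).2, by rw [h₁, ← code_prod]⟩
  · rintro ⟨_, ⟨c, h₀, rfl⟩, y, h⟩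
    exact ⟨c, h₀, (orderedPair_inj.1 h).1.symm⟩

theorem snd {f : C → A × B} (hf : DefinableFun M f) : DefinableFun M fun c => (f c).2 := by
  have h : DefinableRel fun v : Fin 2 → M =>
      ∃ z, (∃ c, v 0 = Coded.code c ∧ z = Coded.code (f c)) ∧ ∃ y, z = orderedPair y (v 1) :=
    .ex ((hf.definableRel _ _).and (.ex (DefinableRel.eq_orderedPair _ _ _)))
  refine h.congr fun v => ⟨?_, ?_⟩
  · rintro ⟨c, h₀, h₁⟩
    exact ⟨_, ⟨c, h₀, rfl⟩, Coded.code (f c).1, by rw [h₁, ← code_prod]⟩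
  · rintro ⟨_, ⟨c, h₀, rfl⟩, y, h⟩
    exact ⟨c, h₀, (orderedPair_inj.1 h).2.symm⟩

theorem prodMk {f : A → B} {g : A → C} (hf : DefinableFun M f) (hg : DefinableFun M g) :
    DefinableFun M fun a => (f a, g a) := by
  have h : DefinableRel fun v : Fin 2 → M =>
      ∃ y z, (∃ a, v 0 = Coded.code a ∧ y = Coded.code (f a)) ∧
      (∃ a, v 0 = Coded.code a ∧ z = Coded.code (g a)) ∧ v 1 = orderedPair y z :=
    .ex (.ex ((hf.definableRel _ _).and
      ((hg.definableRel _ _).and (DefinableRel.eq_orderedPair _ _ _))))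
  exact h.congr fun v => by aesop

theorem orderedPair {f g : A → M} (hf : DefinableFun M f) (hg : DefinableFun M g) :
    DefinableFun M fun a => orderedPair (f a) (g a) :=
  (hf.prodMk hg).code

theorem of_graph {f : A → B} (hf : DefinablePred M fun p : A × B => p.2 = f p.1) :
    DefinableFun M f := by
  have h : DefinableRel fun v : Fin 2 → M =>
      ∃ z, (∃ p : A × B, z = Coded.code p ∧ p.2 = f p.1) ∧
        z = ModelInterpretation.orderedPair (v 0) (v 1) :=
    .ex ((hf.definableRel _).and (DefinableRel.eq_orderedPair _ _ _))
  refine h.congr fun v => ⟨?_, ?_⟩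
  · rintro ⟨a, h₀, h₁⟩
    exact ⟨Coded.code (a, f a), ⟨_, rfl, rfl⟩, by rw [h₀, h₁, code_prod]⟩
  · rintro ⟨_, ⟨⟨a, b⟩, rfl, hb⟩, h⟩
    obtain rfl : b = f a := hb
    exact ⟨a, (orderedPair_inj.1 h).1.symm, (orderedPair_inj.1 h).2.symm⟩

end Product

end DefinableFun

attribute [fun_prop] DefinablePred DefinableFun
attribute [fun_prop] DefinableFun.id DefinableFun.const DefinableFun.comp DefinableFun.fst
  DefinableFun.snd DefinableFun.prodMk DefinableFun.code DefinableFun.orderedPair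
attribute [fun_prop] DefinablePred.and DefinablePred.or DefinablePred.not DefinablePred.imp
  DefinablePred.iff DefinablePred.ex DefinablePred.all DefinablePred.eq DefinablePred.mem

end Coded

open Coded

section Small

variable {M : Set ZFSet.{u}} {A : Type v} {B : Type w} {C : Type w'}

/-- The codes of the elements of `A` form a set in `M`. -/
class IsSmall (M : Set ZFSet.{u}) (A : Type v) [Coded M A] : Prop where
  exists_mem_iff : ∃ z : M, ∀ t : M, t.1 ∈ z.1 ↔ ∃ a : A, t = code a

/-- `z` is the set of the codes of the elements of `S`. -/
def IsCodeSet [Coded M A] (z : M) (S : Set A) : Prop :=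
  ∀ t : M, t.1 ∈ z.1 ↔ ∃ a, t = code a ∧ a ∈ S

namespace IsCodeSet

variable [Coded M A] {y z : M} {S : Set A}

theorem code_mem_iff (h : IsCodeSet z S) {a : A} : (code a : M).1 ∈ z.1 ↔ a ∈ S := by
  simp only [h (code a), code_inj, exists_eq_left']

theorem of_forall_exists (h : ∀ t : M, t.1 ∈ z.1 → ∃ a : A, t = code a) :
    IsCodeSet z {a : A | (code a : M).1 ∈ z.1} := fun t => by
  refine ⟨fun ht => ?_, ?_⟩
  · obtain ⟨a, rfl⟩ := h t ht
    exact ⟨a, rfl, ht⟩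
  · rintro ⟨a, rfl, ha⟩
    exact ha

variable [Fact (IsTransitiveModelZFC M)]

theorem unique (hy : IsCodeSet y S) (hz : IsCodeSet z S) : y = z :=
  eq_of_forall_mem_iff fun t => (hy t).trans (hz t).symm

theorem coe_eq_image (h : IsCodeSet z S) :
    (z.1 : Set ZFSet.{u}) = (fun a => (code a : M).1) '' S := by
  ext t
  refine ⟨fun ht => ?_, ?_⟩
  · obtain ⟨a, hta, ha⟩ := (h ⟨t, mem_of_mem z.2 ht⟩).1 ht
    exact ⟨a, ha, (congrArg Subtype.val hta).symm⟩
  · rintro ⟨a, ha, rfl⟩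
    exact h.code_mem_iff.2 ha

end IsCodeSet

variable [hM : Fact (IsTransitiveModelZFC M)]

theorem inModel_image_code_iff [Coded M A] {S : Set A} :
    InModel M ((fun a => (code a : M).1) '' S) ↔ ∃ z : M, IsCodeSet z S := by
  refine ⟨?_, fun ⟨z, h⟩ => ⟨z.1, z.2, h.coe_eq_image⟩⟩
  rintro ⟨z, hz, h⟩
  refine ⟨⟨z, hz⟩, fun t => (Set.ext_iff.1 h t.1).trans ?_⟩
  simp only [Set.mem_image, Subtype.ext_iff, eq_comm, and_comm]

theorem exists_separation [Coded M A] [hA : IsSmall M A] {P : A → Prop}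
    (h : DefinablePred M P) : ∃ z : M, IsCodeSet z {a | P a} := by
  obtain ⟨x, hx⟩ := hA.exists_mem_iff
  obtain ⟨z, hz⟩ := hM.out.separation {t | ∃ a : A, t = code a ∧ P a} h x
  refine ⟨z, fun t => ?_⟩
  rw [hz, hx]
  exact ⟨And.right, fun ⟨a, h, ha⟩ => ⟨⟨a, h⟩, a, h, ha⟩⟩

theorem exists_replacement [Coded M A] [IsSmall M A] {R : A → M → Prop}
    (h : DefinablePred M fun p : A × M => R p.1 p.2) (hR : ∀ a x y, R a x → R a y → x = y) :
    ∃ z : M, ∀ t : M, t.1 ∈ z.1 ↔ ∃ a, R a t := by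
  obtain ⟨d, hd⟩ := exists_separation (M := M) (A := A) (P := fun a => ∃ x, R a x) h.ex
  have hgraph : DefinableRel fun v : Fin 2 → M => ∃ z, (∃ p : A × M, z = code p ∧ R p.1 p.2) ∧
      z = orderedPair (v 0) (v 1) :=
    .ex ((h.definableRel _).and (DefinableRel.eq_orderedPair _ _ _))
  have hdef : DefinableRel fun v : Fin 2 → M => ∃ a, v 0 = code a ∧ R a (v 1) := by
    refine hgraph.congr fun v => ⟨?_, ?_⟩
    · rintro ⟨a, ha, hR⟩
      exact ⟨code (a, v 1), ⟨_, rfl, hR⟩, by rw [ha]; rfl⟩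
    · rintro ⟨_, ⟨⟨a, b⟩, rfl, hab⟩, hz⟩
      obtain ⟨ha, hb⟩ := orderedPair_inj.1 hz
      exact ⟨a, ha.symm, hb ▸ hab⟩
  obtain ⟨z, hz⟩ := hM.out.replacement {p | ∃ a, p.1 = code a ∧ R a p.2} hdef d (by
    intro x hx
    obtain ⟨a, rfl, y, hy⟩ := (hd x).1 hx
    refine ⟨y, ⟨a, rfl, hy⟩, ?_⟩
    rintro y' ⟨a', ha', hy'⟩
    obtain rfl := code_inj.1 ha'
    exact hR _ _ _ hy' hy)
  refine ⟨z, fun t => (hz t).trans ⟨?_, ?_⟩⟩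
  · rintro ⟨_, _, a, _, ha⟩
    exact ⟨a, ha⟩
  · rintro ⟨a, ha⟩
    exact ⟨code a, (hd _).2 ⟨a, rfl, t, ha⟩, a, rfl, ha⟩

theorem exists_sUnion (x : M) :
    ∃ z : M, ∀ t : M, t.1 ∈ z.1 ↔ ∃ y : M, y.1 ∈ x.1 ∧ t.1 ∈ y.1 := by
  obtain ⟨z, hz, h⟩ := hM.out.union x.1 x.2
  refine ⟨⟨z, hz⟩, fun t => (h t.1 t.2).trans ?_⟩
  exact ⟨fun ⟨y, hy, h⟩ => ⟨⟨y, hy⟩, h⟩, fun ⟨y, h⟩ => ⟨y.1, y.2, h⟩⟩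

instance instIsSmallProd [Coded M A] [Coded M B] [IsSmall M A] [IsSmall M B] :
    IsSmall M (A × B) where
  exists_mem_iff := by
    have hrow : ∀ b : B, ∃ z : M, ∀ t : M, t.1 ∈ z.1 ↔
        ∃ a : A, t = orderedPair (code a) (code b) := fun b =>
      exists_replacement (R := fun (a : A) t => t = orderedPair (code a) (code b))
        (by fun_prop) fun a x y hx hy => hx.trans hy.symm
    obtain ⟨w, hw⟩ := exists_replacement (M := M)
      (R := fun (b : B) z => ∀ t : M, t.1 ∈ z.1 ↔ ∃ a : A, t = orderedPair (code a) (code b))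
      (by fun_prop) (fun b x y hx hy => eq_of_forall_mem_iff fun t => by rw [hx, hy])
    obtain ⟨z, hz⟩ := exists_sUnion w
    refine ⟨z, fun t => (hz t).trans ⟨?_, ?_⟩⟩
    · rintro ⟨y, hy, ht⟩
      obtain ⟨b, hb⟩ := (hw y).1 hy
      obtain ⟨a, ha⟩ := (hb t).1 ht
      exact ⟨(a, b), ha⟩
    · rintro ⟨⟨a, b⟩, rfl⟩
      obtain ⟨y, hy⟩ := hrow b
      exact ⟨y, (hw y).2 ⟨b, hy⟩, (hy _).2 ⟨a, rfl⟩⟩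

theorem IsSmall.ofInjective [Coded M A] [IsSmall M A] (f : B → A) (hf : Function.Injective f)
    (h : DefinablePred M fun a => ∃ b, a = f b) :
    @IsSmall M B (Coded.ofInjective f hf h) := by
  obtain ⟨z, hz⟩ := exists_separation h
  refine @IsSmall.mk M B (Coded.ofInjective f hf h) ⟨z, fun t => (hz t).trans ⟨?_, ?_⟩⟩
  · rintro ⟨_, rfl, b, rfl⟩
    exact ⟨b, rfl⟩
  · rintro ⟨b, rfl⟩
    exact ⟨f b, rfl, b, rfl⟩

end Small

section SetIn

variable {M : Set ZFSet.{u}} {A : Type v} {B : Type w} {C : Type w'} [Coded M A]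

/-- The power set of `A` computed in `M`: the subsets of `A` which belong to `M`. -/
structure SetIn (M : Set ZFSet.{u}) (A : Type v) [Coded M A] where
  carrier : Set A
  exists_isCodeSet : ∃ z : M, IsCodeSet z carrier

instance : Membership A (SetIn M A) where
  mem S a := a ∈ S.1

theorem SetIn.carrier_injective : Function.Injective (SetIn.carrier (M := M) (A := A)) := by
  rintro ⟨S, hS⟩ ⟨_, hT⟩ rfl
  rfl

theorem SetIn.ext {S T : SetIn M A} (h : ∀ a, a ∈ S ↔ a ∈ T) : S = T :=
  SetIn.carrier_injective (Set.ext h)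

variable [hM : Fact (IsTransitiveModelZFC M)]

noncomputable instance instCodedSetIn : Coded M (SetIn M A) where
  code S := S.2.choose
  injective S T h := SetIn.ext fun a => by
    have hS := S.2.choose_spec.code_mem_iff (a := a)
    rw [show S.2.choose = T.2.choose from h] at hS
    exact hS.symm.trans T.2.choose_spec.code_mem_iff
  definable_range := by
    have h : DefinablePred M fun x : M => ∀ t : M, t.1 ∈ x.1 → ∃ a : A, t = code a := by fun_prop
    refine DefinableRel.congr h fun v => ⟨?_, ?_⟩
    · rintro ⟨S, hS⟩
      refine ⟨v 0, rfl, fun t ht => ?_⟩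
      obtain ⟨a, ha, _⟩ := (S.2.choose_spec t).1 (hS ▸ ht)
      exact ⟨a, ha⟩
    · rintro ⟨x, hx, h⟩
      let S : SetIn M A := ⟨_, x, .of_forall_exists h⟩
      exact ⟨S, hx.trans ((IsCodeSet.of_forall_exists h).unique S.2.choose_spec)⟩

theorem SetIn.isCodeSet (S : SetIn M A) : IsCodeSet (code S : M) S.1 := S.2.choose_spec

theorem SetIn.code_mem_code_iff (S : SetIn M A) (a : A) :
    (code a : M).1 ∈ (code S : M).1 ↔ a ∈ S :=
  S.isCodeSet.code_mem_iff

theorem SetIn.exists_eq_code (x : M) (h : ∀ t : M, t.1 ∈ x.1 → ∃ a : A, t = code a) :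
    ∃ S : SetIn M A, x = code S :=
  ⟨⟨_, x, .of_forall_exists h⟩, (IsCodeSet.of_forall_exists h).unique (SetIn.isCodeSet _)⟩

/-- Comprehension for definable predicates on a small type. -/
def SetIn.sep [IsSmall M A] (P : A → Prop) (h : DefinablePred M P) : SetIn M A :=
  ⟨{a | P a}, exists_separation h⟩

instance instIsSmallSetIn [hA : IsSmall M A] : IsSmall M (SetIn M A) where
  exists_mem_iff := by
    obtain ⟨x, hx⟩ := hA.exists_mem_iff
    obtain ⟨z, hz, h⟩ := hM.out.powerset x.1 x.2
    refine ⟨⟨z, hz⟩, fun t => (h t.1 t.2).trans ⟨fun ht => ?_, ?_⟩⟩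
    · exact SetIn.exists_eq_code t fun s hs => (hx s).1 (ht s.1 s.2 hs)
    · rintro ⟨S, rfl⟩ y hy hyS
      obtain ⟨a, ha, _⟩ := (S.isCodeSet ⟨y, hy⟩).1 hyS
      exact (hx ⟨y, hy⟩).2 ⟨a, ha⟩

variable [Coded M B] [Coded M C]

@[fun_prop]
theorem DefinablePred.mem_setIn {f : C → A} {g : C → SetIn M A} (hf : DefinableFun M f)
    (hg : DefinableFun M g) : DefinablePred M fun c => f c ∈ g c :=
  (DefinablePred.mem hf.code hg.code).congr fun _ => (SetIn.code_mem_code_iff _ _).symm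

theorem DefinableFun.setIn {F : C → SetIn M A}
    (h : DefinablePred M fun p : C × A => p.2 ∈ F p.1) : DefinableFun M F := by
  have hgraph : DefinablePred M fun p : C × SetIn M A => ∀ a : A, a ∈ p.2 ↔ a ∈ F p.1 := by
    refine .all (.iff (by fun_prop) ?_)
    exact h.comp (f := fun p : (C × SetIn M A) × A => (p.1.1, p.2)) (by fun_prop)
  exact .of_graph (hgraph.congr fun p => ⟨fun h => by simp [h], SetIn.ext⟩)

theorem exists_selector [IsSmall M B] {F : A → SetIn M B} (hF : DefinableFun M F)
    (hne : ∀ a, ∃ b, b ∈ F a) (hdisj : ∀ a a' b, b ∈ F a → b ∈ F a' → F a = F a') :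
    ∃ c : M, ∀ a, ∃! b, b ∈ F a ∧ (code b : M).1 ∈ c.1 := by
  obtain ⟨x, hx⟩ := exists_separation (M := M) (A := SetIn M B) (P := fun S => ∃ a, S = F a)
    (by fun_prop)
  obtain ⟨c, hcM, hc⟩ := hM.out.choice x.1 x.2 (by
      intro y hy hyx
      obtain ⟨_, hS, a, rfl⟩ := (hx ⟨y, hy⟩).1 hyx
      obtain ⟨b, hb⟩ := hne a
      obtain rfl := congrArg Subtype.val hS
      exact ⟨_, (code b : M).2, ((F a).code_mem_code_iff b).2 hb⟩)
    (by
      rintro y hy hyx z hz hzx ⟨t, htM, hty, htz⟩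
      obtain ⟨_, hS, a, rfl⟩ := (hx ⟨y, hy⟩).1 hyx
      obtain ⟨_, hS', a', rfl⟩ := (hx ⟨z, hz⟩).1 hzx
      obtain rfl := congrArg Subtype.val hS
      obtain rfl := congrArg Subtype.val hS'
      obtain ⟨b, hb, hba⟩ := ((F a).isCodeSet ⟨t, htM⟩).1 hty
      obtain ⟨b', hb', hba'⟩ := ((F a').isCodeSet ⟨t, htM⟩).1 htz
      obtain rfl := code_inj.1 (hb.symm.trans hb')
      rw [hdisj a a' b hba hba'])
  refine ⟨⟨c, hcM⟩, fun a => ?_⟩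
  obtain ⟨t, ⟨htM, hta, htc⟩, huniq⟩ :=
    hc (code (F a) : M).1 (code (F a) : M).2 ((hx _).2 ⟨_, rfl, a, rfl⟩)
  obtain ⟨b, hb, hba⟩ := ((F a).isCodeSet ⟨t, htM⟩).1 hta
  obtain rfl : t = (code b : M).1 := congrArg Subtype.val hb
  refine ⟨b, ⟨hba, htc⟩, fun b' ⟨hba', hbc'⟩ => (code_inj (M := M)).1 (Subtype.ext ?_)⟩
  exact huniq _ ⟨(code b' : M).2, ((F a).code_mem_code_iff b').2 hba', hbc'⟩

theorem exists_choice [IsSmall M A] [IsSmall M B] {R : A → B → Prop}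
    (h : DefinablePred M fun p : A × B => R p.1 p.2) (hR : ∀ a, ∃ b, R a b) :
    ∃ g : A → B, DefinableFun M g ∧ ∀ a, R a (g a) := by
  -- The fibres of `R` are made disjoint by tagging each of their elements with the base point.
  let F (a : A) : SetIn M (A × B) := .sep (fun p => p.1 = a ∧ R p.1 p.2) (by fun_prop)
  have hF : DefinableFun M F := by
    refine DefinableFun.setIn (.and (by fun_prop) ?_)
    exact h.comp (f := fun p : A × (A × B) => p.2) (by fun_prop)
  obtain ⟨c, hc⟩ := exists_selector hF
    (fun a => (hR a).elim fun b hb => ⟨(a, b), rfl, hb⟩)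
    (fun a a' p hp hp' => by rw [← hp.1, ← hp'.1])
  choose p hp hp_unique using hc
  have hfst (a : A) : (p a).1 = a := (hp a).1.1
  have hR_snd (a : A) : R a (p a).2 := by simpa only [hfst] using (hp a).1.2
  refine ⟨fun a => (p a).2, .of_graph ?_, hR_snd⟩
  have hdef : DefinablePred M fun q : A × B => R q.1 q.2 ∧ (code q : M).1 ∈ c.1 :=
    h.and (by fun_prop)
  refine hdef.congr fun q => ⟨fun hq => ?_, fun hq => ?_⟩
  · rw [show q = p q.1 from Prod.ext (hfst _).symm hq]
    exact ⟨(hp _).1.2, (hp _).2⟩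
  · rw [← hp_unique q.1 q ⟨⟨rfl, hq.1⟩, hq.2⟩]

end SetIn

section Naturals

variable {M : Set ZFSet.{u}}

theorem natCode_mem_natCode {m n : ℕ} (h : m < n) : natCode.{u} m ∈ natCode.{u} n := by
  induction n with
  | zero => exact absurd h m.not_lt_zero
  | succ n ih =>
    rw [natCode, ZFSet.mem_insert_iff]
    rcases Nat.lt_succ_iff_lt_or_eq.1 h with h | rfl
    · exact Or.inr (ih h)
    · exact Or.inl rfl

theorem natCode_injective : Function.Injective natCode.{u} := by
  intro m n h
  rcases lt_trichotomy m n with hlt | heq | hlt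
  · exact absurd (h ▸ natCode_mem_natCode hlt) (ZFSet.mem_irrefl _)
  · exact heq
  · exact absurd (h ▸ natCode_mem_natCode hlt) (ZFSet.mem_irrefl _)

variable [hM : Fact (IsTransitiveModelZFC M)]

theorem eq_empty_of_forall_notMem {e : M} (h : ∀ t : M, t.1 ∉ e.1) : e.1 = ∅ := by
  rw [ZFSet.eq_empty]
  exact fun t ht => h ⟨t, mem_of_mem e.2 ht⟩ ht

theorem eq_insert_iff {s n : M} :
    s.1 = insert n.1 n.1 ↔ ∀ t : M, t.1 ∈ s.1 ↔ t.1 ∈ n.1 ∨ t = n := by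
  refine ⟨fun h t => by rw [h, ZFSet.mem_insert_iff, or_comm, Subtype.ext_iff], fun h => ?_⟩
  ext t
  rw [ZFSet.mem_insert_iff]
  refine ⟨fun ht => ?_, ?_⟩
  · rcases (h ⟨t, mem_of_mem s.2 ht⟩).1 ht with htn | htn
    · exact Or.inr htn
    · exact Or.inl (congrArg Subtype.val htn)
  · rintro (rfl | ht)
    · exact (h n).2 (Or.inr rfl)
    · exact (h ⟨t, mem_of_mem n.2 ht⟩).2 (Or.inl ht)

theorem empty_mem : ∅ ∈ M := by
  obtain ⟨-, -, ⟨e, heM, he, -⟩, -⟩ := hM.out.infinity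
  rwa [← eq_empty_of_forall_notMem (e := ⟨e, heM⟩) fun t => he t.1 t.2]

theorem insert_self_mem {x : ZFSet.{u}} (hx : x ∈ M) : insert x x ∈ M := by
  let n : M := ⟨x, hx⟩
  obtain ⟨s, hs⟩ := exists_sUnion (unorderedPair n (unorderedPair n n))
  rw [← (eq_insert_iff (n := n)).2 fun t => ?_]
  · exact s.2
  simp only [hs, eq_unorderedPair_iff.1 rfl, or_and_right, exists_or, exists_eq_left, or_self]

/-- The successor `n ∪ {n}` as an operation on `M`. -/
def insertSelf (n : M) : M := ⟨insert n.1 n.1, insert_self_mem n.2⟩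

variable {A : Type v} {C : Type w}

@[fun_prop]
theorem DefinableFun.insertSelf [Coded M C] {f : C → M} (hf : DefinableFun M f) :
    DefinableFun M fun c => insertSelf (f c) := by
  refine DefinableFun.comp (g := ModelInterpretation.insertSelf) (.of_graph ?_) hf
  have h : DefinablePred M fun p : M × M => ∀ t : M, t.1 ∈ p.2.1 ↔ t.1 ∈ p.1.1 ∨ t = p.1 := by
    fun_prop
  exact h.congr fun p => Subtype.ext_iff.trans eq_insert_iff

/-- `w` contains `0` and is closed under successors. -/
def IsInductiveSet (w : ZFSet.{u}) : Prop :=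
  ∅ ∈ w ∧ ∀ n ∈ w, insert n n ∈ w

theorem IsInductiveSet.natCode_mem {w : ZFSet.{u}} (hw : IsInductiveSet w) :
    ∀ n, natCode n ∈ w
  | 0 => hw.1
  | n + 1 => hw.2 _ (hw.natCode_mem n)

theorem exists_isInductiveSet : ∃ w : M, IsInductiveSet w.1 := by
  obtain ⟨z, hz, ⟨e, heM, he, hez⟩, hsucc⟩ := hM.out.infinity
  refine ⟨⟨z, hz⟩, ?_, fun n hn => ?_⟩
  · rwa [← eq_empty_of_forall_notMem (e := ⟨e, heM⟩) fun t => he t.1 t.2]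
  · obtain ⟨s, hsM, hsz, hs⟩ := hsucc n (mem_of_mem hz hn) hn
    rwa [← (eq_insert_iff (s := ⟨s, hsM⟩) (n := ⟨n, mem_of_mem hz hn⟩)).2 fun t => by
      rw [Subtype.ext_iff]; exact hs t.1 t.2]

theorem DefinablePred.isInductiveSet : DefinablePred M fun w : M => IsInductiveSet w.1 := by
  have h : DefinablePred M fun w : M => (⟨∅, empty_mem⟩ : M).1 ∈ w.1 ∧
      ∀ n : M, n.1 ∈ w.1 → (insertSelf n).1 ∈ w.1 := by fun_prop
  exact h.congr fun w => and_congr Iff.rfl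
    ⟨fun h n => h n.1, fun h n hn => h ⟨n, mem_of_mem w.2 hn⟩ hn⟩

theorem exists_separation_mem {P : M → Prop} (h : DefinablePred M P) (x : M) :
    ∃ z : M, ∀ t : M, t.1 ∈ z.1 ↔ t.1 ∈ x.1 ∧ P t :=
  hM.out.separation {t | P t} (DefinableRel.congr h fun _ => exists_eq_left'.symm) x

theorem exists_least_isInductiveSet :
    ∃ I : M, IsInductiveSet I.1 ∧ ∀ w : M, IsInductiveSet w.1 → I.1 ⊆ w.1 := by
  obtain ⟨z, hz⟩ := exists_isInductiveSet (M := M)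
  have hdef : DefinablePred M fun x : M => ∀ w : M, IsInductiveSet w.1 → x.1 ∈ w.1 :=
    .all (.imp (DefinablePred.isInductiveSet.comp (f := Prod.snd) (by fun_prop)) (by fun_prop))
  obtain ⟨I, hI⟩ := exists_separation_mem hdef z
  refine ⟨I, ⟨?_, fun n hn => ?_⟩, fun w hw n hn => ((hI ⟨n, mem_of_mem I.2 hn⟩).1 hn).2 w hw⟩
  · exact (hI ⟨∅, empty_mem⟩).2 ⟨hz.1, fun w hw => hw.1⟩
  · have hnI := (hI ⟨n, mem_of_mem I.2 hn⟩).1 hn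
    exact (hI ⟨_, insert_self_mem (mem_of_mem I.2 hn)⟩).2
      ⟨hz.2 n hnI.1, fun w hw => hw.2 n (hnI.2 w hw)⟩

theorem exists_omega : ∃ I : M, ∀ x, x ∈ I.1 ↔ ∃ n, x = natCode.{u} n := by
  obtain ⟨I, hI, hleast⟩ := exists_least_isInductiveSet (M := M)
  obtain ⟨J, hJ⟩ := exists_separation_mem (M := M)
    (P := fun x => x = ⟨∅, empty_mem⟩ ∨ ∃ n : M, n.1 ∈ I.1 ∧ x = insertSelf n) (by fun_prop) I
  have hJ_ind : IsInductiveSet J.1 := by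
    refine ⟨(hJ ⟨∅, empty_mem⟩).2 ⟨hI.1, Or.inl rfl⟩, fun n hn => ?_⟩
    have hnI := ((hJ ⟨n, mem_of_mem J.2 hn⟩).1 hn).1
    exact (hJ (insertSelf ⟨n, mem_of_mem J.2 hn⟩)).2 ⟨hI.2 n hnI, Or.inr ⟨_, hnI, rfl⟩⟩
  refine ⟨I, fun x => ⟨fun hx => ?_, ?_⟩⟩
  · induction x using ZFSet.inductionOn with | _ x ih
    rcases ((hJ ⟨x, mem_of_mem I.2 hx⟩).1 (hleast J hJ_ind hx)).2 with h | ⟨n, hn, h⟩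
    · exact ⟨0, congrArg Subtype.val h⟩
    · obtain rfl : x = insert n.1 n.1 := congrArg Subtype.val h
      obtain ⟨k, hk⟩ := ih n.1 (ZFSet.mem_insert _ _) hn
      exact ⟨k + 1, by rw [hk, natCode]⟩
  · rintro ⟨n, rfl⟩
    exact hI.natCode_mem n

theorem natCode_mem (n : ℕ) : natCode.{u} n ∈ M := by
  obtain ⟨I, hI⟩ := exists_omega (M := M)
  exact mem_of_mem I.2 ((hI _).2 ⟨n, rfl⟩)

instance instCodedNat : Coded M ℕ where
  code n := ⟨natCode n, natCode_mem n⟩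
  injective _ _ h := natCode_injective (congrArg Subtype.val h)
  definable_range := by
    obtain ⟨I, hI⟩ := exists_omega (M := M)
    have h : DefinablePred M fun x : M => x.1 ∈ I.1 := by fun_prop
    refine DefinableRel.congr h fun v => ⟨?_, ?_⟩
    · rintro ⟨n, hn⟩
      exact ⟨v 0, rfl, (hI _).2 ⟨n, congrArg Subtype.val hn⟩⟩
    · rintro ⟨x, hx, hxI⟩
      exact ((hI _).1 hxI).imp fun n hn => hx.trans (Subtype.ext hn)

instance instIsSmallNat : IsSmall M ℕ where
  exists_mem_iff :=
    (exists_omega (M := M)).imp fun _ hI t =>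
      (hI t.1).trans (exists_congr fun n => by rw [Subtype.ext_iff]; rfl)

section Arithmetic

variable [Coded M A] [Coded M C]

@[fun_prop]
theorem DefinableFun.natSucc {f : C → ℕ} (hf : DefinableFun M f) :
    DefinableFun M fun c => f c + 1 := by
  refine DefinableFun.comp (g := fun n : ℕ => n + 1) (.of_graph ?_) hf
  have h : DefinablePred M fun p : ℕ × ℕ =>
      (Coded.code p.2 : M) = ModelInterpretation.insertSelf (Coded.code p.1) := by fun_prop
  exact h.congr fun p => (code_inj (M := M) (b := p.1 + 1)).symm

/-- `(n, b)` belongs to the least set in `M` which contains `(0, a)` and is closed under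
`(m, c) ↦ (m + 1, g c)`: this is `b = g^[n] a`, in a form which is visibly definable. -/
def IsIterate (M : Set ZFSet.{u}) [Fact (IsTransitiveModelZFC M)] [Coded M A] (g : A → A)
    (a : A) (n : ℕ) (b : A) : Prop :=
  ∀ G : SetIn M (ℕ × A), (0, a) ∈ G → (∀ m c, (m, c) ∈ G → (m + 1, g c) ∈ G) → (n, b) ∈ G

theorem isIterate_iff [IsSmall M A] {g : A → A} (hg : DefinableFun M g) {a : A} {n : ℕ} {b : A} :
    IsIterate M g a n b ↔ b = g^[n] a := by
  have hdef : DefinablePred M fun q : ℕ × A => IsIterate M g a q.1 q.2 := by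
    unfold IsIterate; fun_prop
  have hsucc {n b} (h : IsIterate M g a n b) : IsIterate M g a (n + 1) (g b) :=
    fun G h₀ hG => hG _ _ (h G h₀ hG)
  -- Removing a pair which is not reached from the set of all iterates leaves a closed set.
  have hremove {n b} (h : IsIterate M g a n b) (h₀ : (0, a) ≠ (n, b))
      (hne : ∀ m c, IsIterate M g a m c → (m + 1, g c) ≠ (n, b)) : False :=
    (h (.sep (fun q => IsIterate M g a q.1 q.2 ∧ q ≠ (n, b))
      (hdef.and (.not (.eq .id (.const _))))) ⟨fun _ h₀ _ => h₀, h₀⟩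
      fun m c hmc => ⟨hsucc hmc.1, hne m c hmc.1⟩).2 rfl
  induction n generalizing b with
  | zero =>
    refine ⟨fun h => ?_, by rintro rfl; exact fun _ h₀ _ => h₀⟩
    by_contra hb
    exact hremove h (fun heq => hb (congrArg Prod.snd heq).symm) fun m c _ => by simp
  | succ n ih =>
    rw [Function.iterate_succ_apply']
    refine ⟨fun h => ?_, by rintro rfl; exact hsucc (ih.2 rfl)⟩
    by_contra hb
    refine hremove h (by simp) fun m c hmc heq => hb ?_
    obtain ⟨hm, rfl⟩ := Prod.mk.inj heq
    obtain rfl := Nat.succ_injective hm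
    rw [ih.1 hmc]

theorem DefinableFun.iterate [IsSmall M A] {g : A → A} (hg : DefinableFun M g) :
    DefinableFun M fun p : ℕ × A => g^[p.1] p.2 := by
  have h : DefinablePred M fun q : (ℕ × A) × A => IsIterate M g q.1.2 q.1.1 q.2 := by
    unfold IsIterate; fun_prop
  exact .of_graph (h.congr fun q => (isIterate_iff hg).symm)

@[fun_prop]
theorem DefinableFun.natAdd {f g : C → ℕ} (hf : DefinableFun M f) (hg : DefinableFun M g) :
    DefinableFun M fun c => f c + g c := by
  have h : DefinableFun M fun c => (fun n => n + 1)^[g c] (f c) :=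
    (DefinableFun.iterate (g := fun n : ℕ => n + 1) (by fun_prop)).comp (hg.prodMk hf)
  simpa using h

@[fun_prop]
theorem DefinableFun.natMul {f g : C → ℕ} (hf : DefinableFun M f) (hg : DefinableFun M g) :
    DefinableFun M fun c => f c * g c := by
  have hiterate (m n : ℕ) : (fun p : ℕ × ℕ => (p.1, p.2 + p.1))^[n] (m, 0) = (m, m * n) := by
    induction n with
    | zero => rfl
    | succ n ih => rw [Function.iterate_succ_apply', ih]; rfl
  have hg' : DefinableFun M fun p : ℕ × ℕ => (p.1, p.2 + p.1) := by fun_prop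
  have h : DefinableFun M fun c => (g c, (f c, 0)) := by fun_prop
  simpa only [hiterate] using (hg'.iterate.comp h).snd

@[fun_prop]
theorem DefinablePred.natLe {f g : C → ℕ} (hf : DefinableFun M f) (hg : DefinableFun M g) :
    DefinablePred M fun c => f c ≤ g c := by
  have h : DefinablePred M fun c => ∃ k, g c = f c + k := by fun_prop
  exact h.congr fun c => le_iff_exists_add

@[fun_prop]
theorem DefinablePred.natLt {f g : C → ℕ} (hf : DefinableFun M f) (hg : DefinableFun M g) :
    DefinablePred M fun c => f c < g c :=
  DefinablePred.natLe hf.natSucc hg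

end Arithmetic

theorem exists_dependentChoice [Coded M A] [IsSmall M A] {P : A → Prop} {R : A → A → Prop}
    (hP : DefinablePred M P) (hR : DefinablePred M fun p : A × A => R p.1 p.2) (a₀ : A)
    (h₀ : P a₀) (h : ∀ a, P a → ∃ b, P b ∧ R a b) :
    ∃ s : ℕ → A, DefinableFun M s ∧ s 0 = a₀ ∧ ∀ n, P (s n) ∧ R (s n) (s (n + 1)) := by
  obtain ⟨g, hg, hgR⟩ := exists_choice (R := fun a b => P a → P b ∧ R a b)
    ((hP.comp (.fst .id)).imp ((hP.comp (.snd .id)).and hR)) fun a => by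
      by_cases ha : P a
      · exact (h a ha).imp fun b hb _ => hb
      · exact ⟨a, fun h => absurd h ha⟩
  have hs (n : ℕ) : P (g^[n] a₀) := by
    induction n with
    | zero => exact h₀
    | succ n ih => rw [Function.iterate_succ_apply']; exact (hgR _ ih).1
  refine ⟨fun n => g^[n] a₀, hg.iterate.comp (.prodMk .id (.const a₀)), rfl, fun n =>
    ⟨hs n, ?_⟩⟩
  simp only [Function.iterate_succ_apply']
  exact (hgR _ (hs n)).2

end Naturals

section WellFounded

variable {M : Set ZFSet.{u}} [Fact (IsTransitiveModelZFC M)] {A : Type v} [Coded M A]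

/-- `x` is the set of the values of `Φ` at the `R`-predecessors of `a`, where `Φ` is total. -/
def CollapsesAt (R : SetIn M (A × A)) (Φ : A → M → Prop) (a : A) (x : M) : Prop :=
  (∀ b, (b, a) ∈ R → ∃ y, Φ b y) ∧ ∀ y : M, y.1 ∈ x.1 ↔ ∃ b, (b, a) ∈ R ∧ Φ b y

namespace CollapsesAt

variable {R : SetIn M (A × A)} {Φ Φ' : A → M → Prop} {a : A} {x x' : M}

theorem mono (h : CollapsesAt R Φ a x) (hle : ∀ b y, Φ b y → Φ' b y)
    (huniq : ∀ b y y', Φ' b y → Φ' b y' → y = y') : CollapsesAt R Φ' a x := by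
  refine ⟨fun b hb => (h.1 b hb).imp (hle b), fun y => (h.2 y).trans ⟨?_, ?_⟩⟩
  · exact fun ⟨b, hb, hy⟩ => ⟨b, hb, hle b y hy⟩
  · rintro ⟨b, hb, hy⟩
    obtain ⟨z, hz⟩ := h.1 b hb
    exact ⟨b, hb, huniq b y z hy (hle b z hz) ▸ hz⟩

theorem unique (h : CollapsesAt R Φ a x)
    (h' : CollapsesAt R Φ' a x')
    (huniq : ∀ b, (b, a) ∈ R → ∀ y y', Φ b y → Φ' b y' → y = y') : x = x' := by
  refine eq_of_forall_mem_iff fun t => ⟨fun ht => ?_, fun ht => ?_⟩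
  · obtain ⟨b, hb, hbt⟩ := (h.2 t).1 ht
    obtain ⟨y, hy⟩ := h'.1 b hb
    exact (h'.2 t).2 ⟨b, hb, huniq b hb t y hbt hy ▸ hy⟩
  · obtain ⟨b, hb, hbt⟩ := (h'.2 t).1 ht
    obtain ⟨y, hy⟩ := h.1 b hb
    exact (h.2 t).2 ⟨b, hb, huniq b hb y t hy hbt ▸ hy⟩

end CollapsesAt

/-- `x` is the image of `a` under a partial Mostowski collapse of `R` which belongs to `M`. -/
def Collapses (R : SetIn M (A × A)) (a : A) (x : M) : Prop :=
  ∃ f : SetIn M (A × M), (∀ b y, (b, y) ∈ f → CollapsesAt R (fun c z => (c, z) ∈ f) b y) ∧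
    (a, x) ∈ f

/-- `M ⊨` "`R` is well-founded". -/
def WellFoundedIn (R : SetIn M (A × A)) : Prop :=
  ∀ P : A → Prop, DefinablePred M P → (∃ a, P a) → ∃ a, P a ∧ ∀ b, (b, a) ∈ R → ¬ P b

variable {R : SetIn M (A × A)}

@[fun_prop]
theorem DefinablePred.collapses {C : Type w} [Coded M C] {f : C → A} {g : C → M}
    (hf : DefinableFun M f) (hg : DefinableFun M g) :
    DefinablePred M fun c => Collapses R (f c) (g c) := by
  unfold Collapses CollapsesAt; fun_prop

theorem Collapses.unique (hR : WellFoundedIn R) (a : A) (x x' : M) (h : Collapses R a x)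
    (h' : Collapses R a x') : x = x' := by
  by_contra hne
  obtain ⟨a, ⟨x, x', ⟨f, hf, hx⟩, ⟨f', hf', hx'⟩, hne⟩, hmin⟩ :=
    hR (fun a => ∃ x x', Collapses R a x ∧ Collapses R a x' ∧ ¬ x = x') (by fun_prop)
      ⟨a, x, x', h, h', hne⟩
  refine hne ((hf a x hx).unique (hf' a x' hx') fun b hb y y' hy hy' => ?_)
  by_contra hyy
  exact hmin b hb ⟨y, y', ⟨f, hf, hy⟩, ⟨f', hf', hy'⟩, hyy⟩

theorem Collapses.collapsesAt (hR : WellFoundedIn R) {a : A} {x : M} (h : Collapses R a x) :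
    CollapsesAt R (Collapses R) a x := by
  obtain ⟨f, hf, hx⟩ := h
  exact (hf a x hx).mono (fun b y hy => ⟨f, hf, hy⟩) (Collapses.unique hR)

theorem exists_collapses_of_forall_mem [IsSmall M A] (hR : WellFoundedIn R) {a : A}
    (h : ∀ b, (b, a) ∈ R → ∃ y, Collapses R b y) : ∃ x, Collapses R a x := by
  by_contra! ha
  obtain ⟨x, hx⟩ := exists_replacement (M := M) (A := A)
    (R := fun b y => (b, a) ∈ R ∧ Collapses R b y) (by fun_prop)
    fun b y y' hy hy' => Collapses.unique hR b y y' hy.2 hy'.2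
  let Φ (b : A) (y : M) : Prop := Collapses R b y ∨ b = a ∧ y = x
  have hΦ_unique (b : A) (y y' : M) (hy : Φ b y) (hy' : Φ b y') : y = y' := by
    rcases hy with hy | ⟨rfl, rfl⟩ <;> rcases hy' with hy' | ⟨hb, rfl⟩
    · exact Collapses.unique hR b y y' hy hy'
    · exact absurd (hb ▸ hy) (ha y)
    · exact absurd hy' (ha y')
    · rfl
  have hΦ (b : A) (y : M) (hby : Φ b y) : CollapsesAt R Φ b y := by
    rcases hby with hby | ⟨rfl, rfl⟩
    · exact (hby.collapsesAt hR).mono (fun _ _ => Or.inl) hΦ_unique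
    · exact CollapsesAt.mono (Φ := Collapses R) ⟨h, hx⟩ (fun _ _ => Or.inl) hΦ_unique
  obtain ⟨z, hz⟩ := exists_replacement (M := M) (A := A)
    (R := fun b t => ∃ y, Φ b y ∧ t = orderedPair (code b) y)
    (by simp only [Φ]; fun_prop) fun b _ _ ⟨y, hy, ht⟩ ⟨y', hy', ht'⟩ => by
      rw [ht, ht', hΦ_unique b y y' hy hy']
  obtain ⟨f, rfl⟩ := SetIn.exists_eq_code (A := A × M) z fun t ht => by
    obtain ⟨b, y, -, hty⟩ := (hz t).1 ht
    exact ⟨(b, y), hty⟩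
  have hf (b : A) (y : M) : (b, y) ∈ f ↔ Φ b y := by
    rw [← SetIn.code_mem_code_iff, hz]
    refine ⟨?_, fun hby => ⟨b, y, hby, rfl⟩⟩
    rintro ⟨b', y', hby, heq⟩
    rw [code_prod, orderedPair_inj, code_inj] at heq
    obtain ⟨rfl, rfl⟩ : b = b' ∧ y = y' := heq
    exact hby
  refine ha x ⟨f, ?_, (hf a x).2 (Or.inr ⟨rfl, rfl⟩)⟩
  simpa only [hf] using hΦ

theorem exists_collapses [IsSmall M A] (hR : WellFoundedIn R) (a : A) : ∃ x, Collapses R a x := by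
  by_contra ha
  obtain ⟨a, ha, hmin⟩ := hR (fun a => ¬ ∃ x, Collapses R a x) (by fun_prop) ⟨a, ha⟩
  exact ha (exists_collapses_of_forall_mem hR fun b hb => not_not.1 (hmin b hb))

/-- Absoluteness of well-foundedness: the Mostowski collapse of `R`, computed in `M`, embeds `R`
into the membership relation of `V`. -/
theorem WellFoundedIn.wellFounded [IsSmall M A] (hR : WellFoundedIn R) :
    WellFounded fun b a => (b, a) ∈ R := by
  choose ρ hρ using exists_collapses hR
  refine Subrelation.wf (fun {b a} hba => ?_) (InvImage.wf (fun a => (ρ a).1) ZFSet.mem_wf)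
  exact (((hρ a).collapsesAt hR).2 (ρ b)).2 ⟨b, hba, hρ b⟩

end WellFounded

section Reals

/-- Codes for rational numbers: `(m, n, k)` stands for `(m - n) / (k + 1)`. -/
abbrev RatCode : Type := ℕ × ℕ × ℕ

/-- The rational number with code `q`, as a real number. -/
noncomputable def ratVal (q : RatCode) : ℝ := ((q.1 : ℝ) - q.2.1) / (q.2.2 + 1)

/-- Addition of rational numbers on the level of codes. -/
def ratAdd (p q : RatCode) : RatCode :=
  (p.1 * (q.2.2 + 1) + q.1 * (p.2.2 + 1), p.2.1 * (q.2.2 + 1) + q.2.1 * (p.2.2 + 1),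
    p.2.2 * q.2.2 + p.2.2 + q.2.2)

/-- Multiplication of rational numbers on the level of codes. -/
def ratMul (p q : RatCode) : RatCode :=
  (p.1 * q.1 + p.2.1 * q.2.1, p.1 * q.2.1 + p.2.1 * q.1, p.2.2 * q.2.2 + p.2.2 + q.2.2)

theorem ratVal_ratAdd (p q : RatCode) : ratVal (ratAdd p q) = ratVal p + ratVal q := by
  have hden : (p.2.2 : ℝ) * q.2.2 + p.2.2 + q.2.2 + 1 = (p.2.2 + 1) * (q.2.2 + 1) := by ring
  simp only [ratVal, ratAdd]
  push_cast
  rw [hden]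
  field_simp
  ring

theorem ratVal_ratMul (p q : RatCode) : ratVal (ratMul p q) = ratVal p * ratVal q := by
  have hden : (p.2.2 : ℝ) * q.2.2 + p.2.2 + q.2.2 + 1 = (p.2.2 + 1) * (q.2.2 + 1) := by ring
  simp only [ratVal, ratMul]
  push_cast
  rw [hden]
  field_simp
  ring

theorem ratVal_one_zero (k : ℕ) : ratVal (1, 0, k) = 1 / ((k : ℝ) + 1) := by simp [ratVal]

theorem ratVal_lt_ratVal_iff (p q : RatCode) : ratVal p < ratVal q ↔
    p.1 * (q.2.2 + 1) + q.2.1 * (p.2.2 + 1) < q.1 * (p.2.2 + 1) + p.2.1 * (q.2.2 + 1) := by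
  rw [← Nat.cast_lt (α := ℝ), ratVal, ratVal, div_lt_div_iff₀ (by positivity) (by positivity)]
  push_cast
  constructor <;> intro h <;> linarith

theorem exists_ratVal_eq (x : ℚ) : ∃ q, ratVal q = x := by
  refine ⟨(x.num.toNat, (-x.num).toNat, x.den - 1), ?_⟩
  have hden : ((x.den - 1 : ℕ) : ℝ) + 1 = x.den := by
    rw [Nat.cast_pred x.den_pos, sub_add_cancel]
  have hnum : (x.num.toNat : ℝ) - (-x.num).toNat = x.num := by
    exact_mod_cast Int.toNat_sub_toNat_neg x.num
  rw [ratVal, hden, hnum, Rat.cast_def]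

theorem exists_ratVal_btwn {a b : ℝ} (h : a < b) : ∃ q, a < ratVal q ∧ ratVal q < b := by
  obtain ⟨x, hax, hxb⟩ := exists_rat_btwn h
  obtain ⟨q, hq⟩ := exists_ratVal_eq x
  exact ⟨q, by rwa [hq], by rwa [hq]⟩

theorem le_of_forall_ratVal_lt {a b : ℝ} (h : ∀ q, ratVal q < a → ratVal q < b) : a ≤ b := by
  by_contra! hlt
  obtain ⟨q, hbq, hqa⟩ := exists_ratVal_btwn hlt
  exact (h q hqa).not_gt hbq

theorem setOf_ratVal_lt_injective : Function.Injective fun r : ℝ => {q | ratVal q < r} :=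
  fun _ _ h => le_antisymm (le_of_forall_ratVal_lt fun _ hq => h.subset hq)
    (le_of_forall_ratVal_lt fun _ hq => h.superset hq)

/-- A set of codes which is a (strict, lower) Dedekind cut, in terms which make sense in `M`. -/
def IsDedekindCut (S : Set RatCode) : Prop :=
  (∃ q, q ∈ S) ∧ (∃ q, q ∉ S) ∧ (∀ p q, q ∈ S → ¬ ratVal q < ratVal p → p ∈ S) ∧
    ∀ p, p ∈ S → ∃ q, q ∈ S ∧ ratVal p < ratVal q

theorem isDedekindCut_setOf_ratVal_lt (r : ℝ) : IsDedekindCut {q | ratVal q < r} := by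
  refine ⟨?_, ?_, fun p q hq hpq => (not_lt.1 hpq).trans_lt hq, fun p hp => ?_⟩
  · exact (exists_ratVal_btwn (sub_one_lt r)).imp fun _ => And.right
  · exact (exists_ratVal_btwn (lt_add_one r)).imp fun _ hq => hq.1.not_gt
  · exact (exists_ratVal_btwn hp).imp fun _ => And.symm

theorem IsDedekindCut.exists_eq {S : Set RatCode} (hS : IsDedekindCut S) :
    ∃ r : ℝ, S = {q | ratVal q < r} := by
  obtain ⟨⟨q₀, hq₀⟩, ⟨q₁, hq₁⟩, hlower, hopen⟩ := hS
  have hbdd : BddAbove (ratVal '' S) := by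
    refine ⟨ratVal q₁, ?_⟩
    rintro _ ⟨q, hq, rfl⟩
    exact le_of_not_gt fun h => hq₁ (hlower _ _ hq h.not_gt)
  refine ⟨sSup (ratVal '' S), Set.ext fun q => ⟨fun hq => ?_, fun hq => ?_⟩⟩
  · obtain ⟨q', hq', hlt⟩ := hopen q hq
    exact hlt.trans_le (le_csSup hbdd ⟨q', hq', rfl⟩)
  · obtain ⟨_, ⟨q', hq', rfl⟩, hlt⟩ :=
      exists_lt_of_lt_csSup (⟨_, q₀, hq₀, rfl⟩ : (ratVal '' S).Nonempty) hq
    exact hlower q q' hq' hlt.not_gt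

variable {M : Set ZFSet.{u}} [hM : Fact (IsTransitiveModelZFC M)]

@[fun_prop]
theorem DefinableFun.ratAdd {C : Type w} [Coded M C] {f g : C → RatCode} (hf : DefinableFun M f)
    (hg : DefinableFun M g) : DefinableFun M fun c => ratAdd (f c) (g c) := by
  unfold ModelInterpretation.ratAdd; fun_prop

@[fun_prop]
theorem DefinableFun.ratMul {C : Type w} [Coded M C] {f g : C → RatCode} (hf : DefinableFun M f)
    (hg : DefinableFun M g) : DefinableFun M fun c => ratMul (f c) (g c) := by
  unfold ModelInterpretation.ratMul; fun_prop

@[fun_prop]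
theorem DefinablePred.ratVal_lt_ratVal {C : Type w} [Coded M C] {f g : C → RatCode}
    (hf : DefinableFun M f) (hg : DefinableFun M g) :
    DefinablePred M fun c => ratVal (f c) < ratVal (g c) := by
  simp only [ratVal_lt_ratVal_iff]; fun_prop

theorem isCodeSet_setOf_ratVal_lt_iff {z : M} {r : ℝ} :
    IsCodeSet z {q | ratVal q < r} ↔ z.1 = realCode r := by
  have hmem (t : M) : t.1 ∈ realCode.{u} r ↔ ∃ q : RatCode, t = code q ∧ ratVal q < r := by
    rw [realCode, ZFSet.mem_range]
    exact ⟨fun ⟨q, hq⟩ => ⟨q.1, Subtype.ext hq.symm, q.2⟩,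
      fun ⟨q, htq, hq⟩ => ⟨⟨q, hq⟩, congrArg Subtype.val htq.symm⟩⟩
  constructor
  · refine fun h => ZFSet.ext fun t => ⟨fun ht => ?_, fun ht => ?_⟩
    · exact (hmem ⟨t, mem_of_mem z.2 ht⟩).2 ((h ⟨t, mem_of_mem z.2 ht⟩).1 ht)
    · obtain ⟨q, rfl⟩ := ZFSet.mem_range.1 ht
      exact (h (code q.1)).2 ⟨q.1, rfl, q.2⟩
  · rintro h t
    rw [h]
    exact hmem t

/-- The Dedekind cut of a real number of `M`, as a subset of `RatCode` in `M`. -/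
def cut (r : MReal M) : SetIn M RatCode :=
  ⟨{q | ratVal q < r.val}, ⟨realCode r.val, r.2⟩, isCodeSet_setOf_ratVal_lt_iff.2 rfl⟩

theorem cut_injective : Function.Injective (cut (M := M)) := fun _ _ h =>
  Subtype.ext (setOf_ratVal_lt_injective (congrArg SetIn.carrier h))

theorem exists_eq_cut_iff (S : SetIn M RatCode) : (∃ r, S = cut r) ↔ IsDedekindCut S.1 := by
  constructor
  · rintro ⟨r, rfl⟩
    exact isDedekindCut_setOf_ratVal_lt r.val
  · intro h
    obtain ⟨r, hr⟩ := h.exists_eq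
    obtain ⟨z, hz⟩ := S.2
    rw [hr, isCodeSet_setOf_ratVal_lt_iff] at hz
    exact ⟨⟨r, hz ▸ z.2⟩, SetIn.carrier_injective hr⟩

theorem DefinablePred.exists_eq_cut :
    DefinablePred M fun S : SetIn M RatCode => ∃ r, S = cut r := by
  simp only [exists_eq_cut_iff, IsDedekindCut]
  change DefinablePred M fun S : SetIn M RatCode => (∃ q, q ∈ S) ∧ (∃ q, q ∉ S) ∧
    (∀ p q, q ∈ S → ¬ ratVal q < ratVal p → p ∈ S) ∧ ∀ p, p ∈ S → ∃ q, q ∈ S ∧ ratVal p < ratVal q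
  fun_prop

noncomputable instance instCodedMReal : Coded M (MReal M) :=
  Coded.ofInjective cut cut_injective DefinablePred.exists_eq_cut

instance instIsSmallMReal : IsSmall M (MReal M) :=
  IsSmall.ofInjective cut cut_injective DefinablePred.exists_eq_cut

theorem code_mreal (r : MReal M) : (code r : M).1 = realCode r.val :=
  isCodeSet_setOf_ratVal_lt_iff.1 (cut r).isCodeSet

variable {C : Type w} [Coded M C]

/-- The real number `L c` has a Dedekind cut which is definable over `M`, uniformly in `c`. -/
@[fun_prop]
def DefinableReal (M : Set ZFSet.{u}) [Fact (IsTransitiveModelZFC M)] {C : Type w} [Coded M C]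
    (L : C → ℝ) : Prop :=
  DefinablePred M fun p : C × RatCode => ratVal p.2 < L p.1

namespace DefinableReal

variable {K L : C → ℝ}

@[fun_prop]
theorem val {f : C → MReal M} (hf : DefinableFun M f) : DefinableReal M fun c => (f c).val := by
  have hcut : DefinableFun M fun c => cut (f c) := hf
  exact DefinablePred.mem_setIn (.snd .id) (hcut.comp (.fst .id))

theorem definableFun {f : C → MReal M} (h : DefinableReal M fun c => (f c).val) :
    DefinableFun M f := by
  have hcut : DefinableFun M fun c => cut (f c) := .setIn h
  exact hcut

@[fun_prop]
theorem ratVal_comp {f : C → RatCode} (hf : DefinableFun M f) :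
    DefinableReal M fun c => ratVal (f c) :=
  DefinablePred.ratVal_lt_ratVal (by fun_prop) (by fun_prop)

@[fun_prop]
theorem one_div_nat_add_one {k : C → ℕ} (hk : DefinableFun M k) :
    DefinableReal M fun c => 1 / ((k c : ℝ) + 1) := by
  simp only [← ratVal_one_zero]
  fun_prop

theorem ratVal_lt (hL : DefinableReal M L) {D : Type v} [Coded M D] {f : D → C} {q : D → RatCode}
    (hf : DefinableFun M f) (hq : DefinableFun M q) :
    DefinablePred M fun d => ratVal (q d) < L (f d) :=
  DefinablePred.comp hL (hf.prodMk hq)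

theorem comp (hL : DefinableReal M L) {D : Type v} [Coded M D] {f : D → C}
    (hf : DefinableFun M f) : DefinableReal M fun d => L (f d) :=
  hL.ratVal_lt (hf.comp (.fst .id)) (.snd .id)

@[fun_prop]
theorem lt (hK : DefinableReal M K) (hL : DefinableReal M L) :
    DefinablePred M fun c => K c < L c := by
  have h : DefinablePred M fun c =>
      ∃ q, ¬ ratVal q < K c ∧ ratVal q < L c :=
    .ex ((hK.ratVal_lt (by fun_prop) (by fun_prop)).not.and
      (hL.ratVal_lt (by fun_prop) (by fun_prop)))
  refine h.congr fun c => ⟨fun hlt => ?_, fun ⟨q, hq, hq'⟩ => (not_lt.1 hq).trans_lt hq'⟩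
  exact (exists_ratVal_btwn hlt).imp fun q hq => ⟨hq.1.not_gt, hq.2⟩

@[fun_prop]
theorem le (hK : DefinableReal M K) (hL : DefinableReal M L) :
    DefinablePred M fun c => K c ≤ L c :=
  (hL.lt hK).not.congr fun _ => not_lt.symm

@[fun_prop]
theorem add (hK : DefinableReal M K) (hL : DefinableReal M L) :
    DefinableReal M fun c => K c + L c := by
  have h : DefinablePred M fun p : C × RatCode => ∃ a b, ratVal a < K p.1 ∧
      ratVal b < L p.1 ∧
        ¬ ratVal (ratAdd a b) < ratVal p.2 :=
    .ex (.ex (.and (hK.ratVal_lt (by fun_prop) (by fun_prop))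
      (.and (hL.ratVal_lt (by fun_prop) (by fun_prop)) (by fun_prop))))
  refine h.congr fun p => ?_
  simp only [ratVal_ratAdd, not_lt]
  constructor
  · intro hp
    obtain ⟨a, hpa, haK⟩ := exists_ratVal_btwn (sub_lt_iff_lt_add.2 hp)
    obtain ⟨b, hab, hbL⟩ := exists_ratVal_btwn (sub_lt_comm.1 hpa)
    exact ⟨a, b, haK, hbL, (sub_lt_iff_lt_add'.1 hab).le⟩
  · rintro ⟨a, b, haK, hbL, hle⟩
    exact hle.trans_lt (add_lt_add haK hbL)

@[fun_prop]
theorem max (hK : DefinableReal M K) (hL : DefinableReal M L) :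
    DefinableReal M fun c => max (K c) (L c) :=
  DefinablePred.congr (.or hK hL) fun _ => lt_max_iff

@[fun_prop]
theorem dist (hK : DefinableReal M K) (hL : DefinableReal M L) :
    DefinableReal M fun c => dist (K c) (L c) := by
  have hK' : DefinableReal M fun p : C × RatCode => K p.1 := hK.comp (.fst .id)
  have hL' : DefinableReal M fun p : C × RatCode => L p.1 := hL.comp (.fst .id)
  have h : DefinablePred M fun p : C × RatCode =>
      ¬ (K p.1 ≤ L p.1 + ratVal p.2 ∧ L p.1 ≤ K p.1 + ratVal p.2) :=
    .not (.and (hK'.le (hL'.add (by fun_prop))) (hL'.le (hK'.add (by fun_prop))))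
  refine h.congr fun p => ?_
  beta_reduce
  rw [← not_le, Real.dist_eq, abs_sub_le_iff, sub_le_iff_le_add', sub_le_iff_le_add']

theorem inv (hL : DefinableReal M L) (hpos : ∀ c, 0 < L c) :
    DefinableReal M fun c => (L c)⁻¹ := by
  have h : DefinablePred M fun p : C × RatCode => ∃ a, ¬ ratVal a < L p.1 ∧
      ratVal (ratMul p.2 a) < ratVal (1, 0, 0) :=
    .ex (.and (hL.ratVal_lt (by fun_prop) (by fun_prop)).not (by fun_prop))
  refine h.congr fun p => ?_
  simp only [ratVal_ratMul, ratVal_one_zero, Nat.cast_zero, zero_add, div_one, not_lt]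
  rw [← one_div, lt_div_iff₀ (hpos p.1)]
  rcases le_or_gt (ratVal p.2) 0 with hq | hq
  · obtain ⟨a, hLa, -⟩ := exists_ratVal_btwn (lt_add_one (L p.1))
    refine iff_of_true ?_ ⟨a, hLa.le, ?_⟩
    · nlinarith [hpos p.1]
    · nlinarith [hpos p.1]
  · refine ⟨fun hlt => ?_, fun ⟨a, hLa, hlt⟩ => (mul_le_mul_of_nonneg_left hLa hq.le).trans_lt hlt⟩
    obtain ⟨a, hLa, ha⟩ := exists_ratVal_btwn ((lt_div_iff₀' hq).2 hlt)
    exact ⟨a, hLa.le, (lt_div_iff₀' hq).1 ha⟩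

theorem of_tendsto {F : C × ℕ → ℝ} (hF : DefinableReal M F)
    (h : ∀ c, Tendsto (fun n => F (c, n)) atTop (𝓝 (L c))) : DefinableReal M L := by
  have hlt : DefinablePred M fun p : C × RatCode => ∃ q,
      ratVal p.2 < ratVal q ∧ ∃ N, ∀ n, N ≤ n →
        ratVal q < F (p.1, n) :=
    .ex (.and (by fun_prop) (.ex (.all (.imp (by fun_prop)
      (hF.ratVal_lt (by fun_prop) (by fun_prop))))))
  refine hlt.congr fun p => ⟨fun hp => ?_, fun ⟨q, hpq, N, hN⟩ => ?_⟩
  · obtain ⟨q, hpq, hq⟩ := exists_ratVal_btwn hp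
    exact ⟨q, hpq, eventually_atTop.1 ((h p.1).eventually (lt_mem_nhds hq))⟩
  · refine hpq.trans_le (ge_of_tendsto (h p.1) ?_)
    exact (eventually_ge_atTop N).mono fun n hn => (hN n hn).le

theorem exists_mreal (hL : DefinableReal M L) (c : C) : ∃ r : MReal M, r.val = L c := by
  obtain ⟨z, hz⟩ := exists_separation (M := M)
    (hL.ratVal_lt (D := RatCode) (f := fun _ => c) (by fun_prop) .id)
  exact ⟨⟨L c, isCodeSet_setOf_ratVal_lt_iff.1 hz ▸ z.2⟩, rfl⟩

end DefinableReal

theorem exists_mreal_add (r s : MReal M) : ∃ t : MReal M, t.val = r.val + s.val :=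
  DefinableReal.exists_mreal (C := ℕ) (L := fun _ => r.val + s.val) (by fun_prop) 0

/-- Addition of real numbers of `M`. -/
noncomputable def mrealAdd (r s : MReal M) : MReal M := (exists_mreal_add r s).choose

@[simp]
theorem mrealAdd_val (r s : MReal M) : (mrealAdd r s).val = r.val + s.val :=
  (exists_mreal_add r s).choose_spec

@[fun_prop]
theorem DefinableFun.mrealAdd {f g : C → MReal M} (hf : DefinableFun M f)
    (hg : DefinableFun M g) : DefinableFun M fun c => mrealAdd (f c) (g c) :=
  DefinableReal.definableFun (by simp only [mrealAdd_val]; fun_prop)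

theorem exists_mreal_inv (r : MReal M) (hr : 0 < r.val) : ∃ t : MReal M, t.val = r.val⁻¹ :=
  DefinableReal.exists_mreal (C := ℕ)
    (DefinableReal.inv (L := fun _ => r.val) (by fun_prop) fun _ => hr) 0

theorem exists_mreal_ratCast (x : ℚ) : ∃ t : MReal M, t.val = x := by
  obtain ⟨q, hq⟩ := exists_ratVal_eq x
  rw [← hq]
  exact DefinableReal.exists_mreal (C := ℕ) (L := fun _ => ratVal q) (by fun_prop) 0

theorem denseRange_mreal_val : DenseRange (MReal.val (M := M)) := by
  refine Rat.denseRange_cast.mono ?_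
  rintro _ ⟨x, rfl⟩
  exact exists_mreal_ratCast x

theorem exists_tendsto_mreal_val {s : ℕ → MReal M} (hs : DefinableFun M s)
    (hcauchy : CauchySeq fun n => (s n).val) :
    ∃ r : MReal M, Tendsto (fun n => (s n).val) atTop (𝓝 r.val) := by
  obtain ⟨L, hL⟩ := cauchySeq_tendsto_of_complete hcauchy
  obtain ⟨r, hr⟩ := DefinableReal.exists_mreal (M := M) (C := ℕ) (L := fun _ => L)
    (.of_tendsto (F := fun p : ℕ × ℕ => (s p.2).val) (by fun_prop) fun _ => hL) 0
  exact ⟨r, hr ▸ hL⟩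

end Reals

section OpenExtension

variable {P : Type v} {Z : Type w}

/-- The largest open subset of `Z` whose preimage under `j : P → Z` is contained in `O`. -/
def openExtension [TopologicalSpace Z] (j : P → Z) (O : Set P) : Set Z := (closure (j '' Oᶜ))ᶜ

theorem mem_openExtension_iff [PseudoMetricSpace Z] {j : P → Z} {O : Set P} {z : Z} :
    z ∈ openExtension j O ↔ ∃ ε > 0, ∀ y, dist (j y) z < ε → y ∈ O := by
  rw [openExtension, Set.mem_compl_iff, Metric.mem_closure_iff]
  push Not
  refine exists_congr fun ε => and_congr_right fun _ => ?_
  rw [Set.forall_mem_image]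
  exact forall_congr' fun y => by rw [dist_comm, Set.mem_compl_iff, ← not_imp_not, not_not, not_le]

variable [TopologicalSpace Z] {j : P → Z}

theorem isOpen_openExtension {O : Set P} : IsOpen (openExtension j O) :=
  isClosed_closure.isOpen_compl

theorem mem_of_mem_openExtension {O : Set P} {x : P} (h : j x ∈ openExtension j O) : x ∈ O := by
  by_contra hx
  exact h (subset_closure ⟨x, hx, rfl⟩)

theorem openExtension_mono {O Q : Set P} (h : O ⊆ Q) : openExtension j O ⊆ openExtension j Q :=
  Set.compl_subset_compl.2 (closure_mono (Set.image_mono (Set.compl_subset_compl.2 h)))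

theorem openExtension_inter (O Q : Set P) :
    openExtension j (O ∩ Q) = openExtension j O ∩ openExtension j Q := by
  simp only [openExtension, Set.compl_inter, Set.image_union, closure_union, Set.compl_union]

theorem openExtension_univ : openExtension j Set.univ = Set.univ := by simp [openExtension]

theorem openExtension_empty (hj : DenseRange j) : openExtension j ∅ = ∅ := by
  simp [openExtension, hj.closure_range]

theorem subset_openExtension_preimage {U : Set Z} (hU : IsOpen U) :
    U ⊆ openExtension j (j ⁻¹' U) := by
  rw [openExtension, Set.subset_compl_comm]
  refine closure_minimal ?_ hU.isClosed_compl
  rintro _ ⟨x, hx, rfl⟩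
  exact hx

theorem openExtension_preimage_subset_closure (hj : DenseRange j) {U : Set Z} :
    openExtension j (j ⁻¹' U) ⊆ closure U := by
  refine (hj.open_subset_closure_inter isOpen_openExtension).trans (closure_mono ?_)
  rintro _ ⟨hz, x, rfl⟩
  exact (mem_of_mem_openExtension (j := j) hz : x ∈ j ⁻¹' U)

end OpenExtension

section NestedBalls

variable {P : Type v} {Z : Type w} [PseudoMetricSpace Z] {j : P → Z}

/-- The pair `(x, k)` stands for the ball of radius `1 / (k + 1)` around `x`, in the metric induced
by `j`; the ball `b` is smaller than `a` and so far inside of it that it is contained in `a`. -/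
def IsNested (j : P → Z) (b a : P × ℕ) : Prop :=
  a.2 < b.2 ∧ dist (j a.1) (j b.1) + 1 / ((b.2 : ℝ) + 1) ≤ 1 / ((a.2 : ℝ) + 1)

theorem exists_isNested (hj : DenseRange j) {a : P × ℕ} {z : Z}
    (ha : dist (j a.1) z < 1 / ((a.2 : ℝ) + 1)) :
    ∃ b, IsNested j b a ∧ dist (j b.1) z < 1 / ((b.2 : ℝ) + 1) := by
  obtain ⟨k, hk⟩ := exists_nat_one_div_lt (half_pos (sub_pos.2 ha))
  set l := max k (a.2 + 1)
  have hl : 1 / ((l : ℝ) + 1) ≤ 1 / ((k : ℝ) + 1) := Nat.one_div_le_one_div (le_max_left _ _)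
  obtain ⟨x, hx⟩ := hj.exists_dist_lt z (Nat.one_div_pos_of_nat (α := ℝ) (n := l))
  rw [dist_comm] at hx
  refine ⟨(x, l), ⟨(Nat.lt_succ_self _).trans_le (le_max_right _ _), ?_⟩, hx⟩
  linarith [dist_triangle_right (j a.1) (j x) z]

variable {s : ℕ → P × ℕ} (hs : ∀ n, IsNested j (s (n + 1)) (s n))
include hs

theorem le_snd_of_isNested (n : ℕ) : n ≤ (s n).2 := by
  induction n with
  | zero => exact Nat.zero_le _
  | succ n ih => exact Nat.succ_le_of_lt (ih.trans_lt (hs n).1)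

theorem dist_le_of_isNested {n m : ℕ} (hnm : n ≤ m) :
    dist (j (s n).1) (j (s m).1) ≤ 1 / (((s n).2 : ℝ) + 1) := by
  have h : dist (j (s n).1) (j (s m).1) + 1 / (((s m).2 : ℝ) + 1) ≤ 1 / (((s n).2 : ℝ) + 1) := by
    induction m, hnm using Nat.le_induction with
    | base => rw [dist_self, zero_add]
    | succ m _ ih => linarith [(hs m).2, dist_triangle (j (s n).1) (j (s m).1) (j (s (m + 1)).1)]
  exact le_of_add_le_of_nonneg_left h (by positivity)

theorem cauchySeq_of_isNested : CauchySeq fun n => j (s n).1 := by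
  refine cauchySeq_of_le_tendsto_0' (fun n : ℕ => 1 / ((n : ℝ) + 1)) (fun n m hnm => ?_)
    tendsto_one_div_add_atTop_nhds_zero_nat
  exact (dist_le_of_isNested hs hnm).trans (Nat.one_div_le_one_div (le_snd_of_isNested hs n))

theorem dist_le_of_isNested_of_tendsto {z : Z} (hz : Tendsto (fun n => j (s n).1) atTop (𝓝 z))
    (n : ℕ) : dist (j (s n).1) z ≤ 1 / (((s n).2 : ℝ) + 1) :=
  le_of_tendsto (tendsto_const_nhds.dist hz)
    ((eventually_ge_atTop n).mono fun _ => dist_le_of_isNested hs)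

end NestedBalls

section Metric

variable {M : Set ZFSet.{u}} [hM : Fact (IsTransitiveModelZFC M)]

/-- The sets in `M` which are open for the metric induced by `j`. -/
def metricOpens (M : Set ZFSet.{u}) {P : Type v} [Coded M P] {Z : Type w} [PseudoMetricSpace Z]
    (j : P → Z) : Set (Set P) :=
  {O | InModel M ((fun x => (code x : M).1) '' O) ∧
    ∀ x ∈ O, ∃ ε > 0, ∀ y, dist (j y) (j x) < ε → y ∈ O}

/-- The metric space in `M` whose metric is induced by `j`. -/
abbrev metricMSpace (M : Set ZFSet.{u}) {P : Type v} [Coded M P] {Z : Type w} [PseudoMetricSpace Z]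
    (j : P → Z) : MSpace.{u, v} where
  Pt := P
  code x := (code x : M).1
  opens := metricOpens M j

/-- The map `j` with dense range exhibits `Z` as the completion of a metric space of `M`, with
points `P`, which is complete in `M`. -/
structure IsMetricIn (M : Set ZFSet.{u}) [Fact (IsTransitiveModelZFC M)]
    {P : Type v} [Coded M P] {Z : Type w} [PseudoMetricSpace Z] (j : P → Z) : Prop where
  denseRange : DenseRange j
  definable_dist : DefinableReal M fun p : P × P => dist (j p.1) (j p.2)
  complete : ∀ s : ℕ → P, DefinableFun M s → CauchySeq (fun n => j (s n)) →
    ∃ x, Tendsto (fun n => j (s n)) atTop (𝓝 (j x))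

variable {P : Type v} [Coded M P] {Z : Type w} [PseudoMetricSpace Z] {j : P → Z}

theorem mem_metricOpens_iff {O : Set P} : O ∈ metricOpens M j ↔
    (∃ S : SetIn M P, S.1 = O) ∧ ∀ x ∈ O, ∃ ε > 0, ∀ y, dist (j y) (j x) < ε → y ∈ O := by
  rw [metricOpens, Set.mem_ofPred_eq, inModel_image_code_iff]
  exact and_congr_left fun _ => ⟨fun h => ⟨⟨O, h⟩, rfl⟩, fun ⟨S, hS⟩ => hS ▸ S.2⟩

omit hM in
theorem mem_openExtension_iff_mem {O : Set P} (hO : O ∈ metricOpens M j) {x : P} :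
    j x ∈ openExtension j O ↔ x ∈ O :=
  ⟨mem_of_mem_openExtension, fun hx => mem_openExtension_iff.2 (hO.2 x hx)⟩

theorem setOf_exists_coe_eq_image {F : Set (Set P)} (hF : ∀ O ∈ F, ∃ S : SetIn M P, S.1 = O) :
    {z : ZFSet.{u} | ∃ O ∈ F, (z : Set ZFSet.{u}) = (fun x => (code x : M).1) '' O} =
      (fun S : SetIn M P => (code S : M).1) '' (SetIn.carrier ⁻¹' F) := by
  ext z
  constructor
  · rintro ⟨O, hO, hz⟩
    obtain ⟨S, rfl⟩ := hF O hO
    exact ⟨S, hO, SetLike.coe_injective (S.isCodeSet.coe_eq_image.trans hz.symm)⟩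
  · rintro ⟨S, hS, rfl⟩
    exact ⟨S.1, hS, S.isCodeSet.coe_eq_image⟩

theorem familyIn_iff {F : Set (Set P)} : (metricMSpace M j).FamilyIn M F ↔
    F ⊆ metricOpens M j ∧ ∃ G : SetIn M (SetIn M P), F = SetIn.carrier '' G.1 := by
  refine and_congr_right fun hF => ?_
  have hF' (O : Set P) (hO : O ∈ F) : ∃ S : SetIn M P, S.1 = O :=
    (mem_metricOpens_iff.1 (hF hO)).1
  rw [setOf_exists_coe_eq_image hF', inModel_image_code_iff]
  constructor
  · exact fun h => ⟨⟨_, h⟩, (Set.image_preimage_eq_of_subset hF').symm⟩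
  · rintro ⟨G, rfl⟩
    rw [Set.preimage_image_eq _ SetIn.carrier_injective]
    exact G.2

theorem univ_mem_metricOpens [IsSmall M P] : Set.univ ∈ metricOpens M j :=
  mem_metricOpens_iff.2 ⟨⟨.sep (fun x => x = x) (by fun_prop), Set.eq_univ_of_forall fun _ => rfl⟩,
    fun _ _ => ⟨1, one_pos, fun _ _ => trivial⟩⟩

namespace IsMetricIn

theorem definableReal (hj : IsMetricIn M j) {C : Type*} [Coded M C] {f g : C → P}
    (hf : DefinableFun M f) (hg : DefinableFun M g) :
    DefinableReal M fun c => dist (j (f c)) (j (g c)) :=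
  hj.definable_dist.comp (hf.prodMk hg)

variable [IsSmall M P] (hj : IsMetricIn M j)
include hj

/-- The open ball of radius `1 / (k + 1)` around `x`, as an element of `M`. -/
def ball (x : P) (k : ℕ) : SetIn M P :=
  .sep (fun y => dist (j y) (j x) < 1 / ((k : ℝ) + 1))
    ((hj.definableReal .id (.const x)).lt (by fun_prop))

@[simp]
theorem mem_ball {x y : P} {k : ℕ} :
    y ∈ hj.ball x k ↔ dist (j y) (j x) < 1 / ((k : ℝ) + 1) := Iff.rfl

theorem self_mem_ball (x : P) (k : ℕ) : x ∈ hj.ball x k := by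
  rw [mem_ball, dist_self]
  positivity

theorem definableFun_ball {C : Type*} [Coded M C] {f : C → P} {k : C → ℕ} (hf : DefinableFun M f)
    (hk : DefinableFun M k) : DefinableFun M fun c => hj.ball (f c) (k c) :=
  .setIn ((hj.definableReal (by fun_prop) (by fun_prop)).lt (by fun_prop))

theorem ball_mem_metricOpens (x : P) (k : ℕ) : (hj.ball x k).1 ∈ metricOpens M j := by
  refine mem_metricOpens_iff.2 ⟨⟨_, rfl⟩, fun y hy => ?_⟩
  refine ⟨1 / ((k : ℝ) + 1) - dist (j y) (j x), sub_pos.2 hy, fun z hz => ?_⟩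
  exact (dist_triangle _ (j y) _).trans_lt (lt_sub_iff_add_lt.1 hz)

end IsMetricIn

end Metric

section Cover

variable {M : Set ZFSet.{u}} [hM : Fact (IsTransitiveModelZFC M)]
variable {P : Type v} [Coded M P] {Z : Type w} [PseudoMetricSpace Z] {j : P → Z}

/-- The ball `a` is covered by the family `G` of sets, but by none of its members alone. -/
def IsBad (j : P → Z) (G : SetIn M (SetIn M P)) (a : P × ℕ) : Prop :=
  (∀ y, dist (j a.1) (j y) ≤ 1 / ((a.2 : ℝ) + 1) → ∃ S ∈ G, y ∈ S) ∧
    ¬ ∃ S ∈ G, ∀ y, dist (j a.1) (j y) ≤ 1 / ((a.2 : ℝ) + 1) → y ∈ S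

namespace IsMetricIn

variable (hj : IsMetricIn M j)
include hj

theorem definablePred_isNested :
    DefinablePred M fun p : (P × ℕ) × (P × ℕ) => IsNested j p.1 p.2 :=
  .and (by fun_prop) (((hj.definableReal (by fun_prop) (by fun_prop)).add (by fun_prop)).le
    (by fun_prop))

variable {G : SetIn M (SetIn M P)}

theorem definablePred_isBad : DefinablePred M (IsBad j G) := by
  have hle : DefinablePred M fun p : (P × ℕ) × P =>
      dist (j p.1.1) (j p.2) ≤ 1 / ((p.1.2 : ℝ) + 1) :=
    (hj.definableReal (by fun_prop) (by fun_prop)).le (by fun_prop)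
  exact .and (.all (hle.imp (by fun_prop)))
    (.not (.ex (.and (by fun_prop) (.all (.imp (hle.comp
      (f := fun p : ((P × ℕ) × SetIn M P) × P => (p.1.1, p.2)) (by fun_prop)) (by fun_prop))))))

variable (hG : ∀ S ∈ G, S.1 ∈ metricOpens M j)
include hG

theorem exists_not_isBad {s : ℕ → P × ℕ} (hs : DefinableFun M s)
    (hnest : ∀ n, IsNested j (s (n + 1)) (s n)) : ∃ n, ¬ IsBad j G (s n) := by
  by_contra! hbad
  obtain ⟨x, hx⟩ := hj.complete (fun n => (s n).1) (by fun_prop) (cauchySeq_of_isNested hnest)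
  have hdist := dist_le_of_isNested_of_tendsto hnest hx
  obtain ⟨S, hS, hxS⟩ := (hbad 0).1 x (hdist 0)
  obtain ⟨δ, hδ, hδS⟩ := (hG S hS).2 x hxS
  obtain ⟨n, hn⟩ := exists_nat_one_div_lt (half_pos hδ)
  refine (hbad n).2 ⟨S, hS, fun y hy => hδS y ?_⟩
  have hsn : 1 / (((s n).2 : ℝ) + 1) ≤ 1 / ((n : ℝ) + 1) :=
    Nat.one_div_le_one_div (le_snd_of_isNested hnest n)
  linarith [hdist n, dist_triangle_left (j y) (j x) (j (s n).1)]

variable [IsSmall M P]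

theorem wellFounded_isNested_isBad :
    WellFounded fun b a : P × ℕ => IsBad j G a ∧ IsNested j b a := by
  have hR : DefinablePred M fun p : (P × ℕ) × (P × ℕ) => IsBad j G p.2 ∧ IsNested j p.1 p.2 :=
    (hj.definablePred_isBad.comp (.snd .id)).and hj.definablePred_isNested
  refine WellFoundedIn.wellFounded (R := .sep _ hR) fun Q hQ ⟨a₀, ha₀⟩ => ?_
  by_contra! hno
  obtain ⟨s, hs, -, hQR⟩ := exists_dependentChoice hQ
    (R := fun a b => IsBad j G a ∧ IsNested j b a)
    (hR.comp (f := fun p : (P × ℕ) × (P × ℕ) => (p.2, p.1)) (by fun_prop)) a₀ ha₀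
    fun a ha => (hno a ha).imp fun b hb => ⟨hb.2, hb.1⟩
  obtain ⟨n, hn⟩ := hj.exists_not_isBad hG hs fun n => (hQR n).2.2
  exact hn (hQR n).2.1

/-- A small bad ball around `z` contains a smaller one; in `M` there is no infinite sequence of
such balls, by completeness, and by absoluteness of well-foundedness there is none in `V`. -/
theorem exists_mem_openExtension_of_cover {z : Z}
    (hz : z ∈ openExtension j {x | ∃ S ∈ G, x ∈ S}) : ∃ S ∈ G, z ∈ openExtension j S.1 := by
  obtain ⟨ε, hε, hcover⟩ := mem_openExtension_iff.1 hz
  by_contra! hcon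
  have hbad (a : P × ℕ) (ha : dist (j a.1) z < 1 / ((a.2 : ℝ) + 1))
      (haε : 2 * (1 / ((a.2 : ℝ) + 1)) < ε) : IsBad j G a := by
    refine ⟨fun y hy => hcover y ?_, fun ⟨S, hS, hy⟩ => hcon S hS (mem_openExtension_iff.2 ?_)⟩
    · linarith [dist_triangle_left (j y) z (j a.1)]
    · exact ⟨_, sub_pos.2 ha, fun y hyz => hy y (by linarith [dist_triangle_right (j a.1) (j y) z])⟩
  have hfalse (a : P × ℕ) : dist (j a.1) z < 1 / ((a.2 : ℝ) + 1) →
      ¬ 2 * (1 / ((a.2 : ℝ) + 1)) < ε := by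
    induction a using (hj.wellFounded_isNested_isBad hG).induction with
    | _ a ih =>
      intro ha haε
      obtain ⟨b, hba, hb⟩ := exists_isNested hj.denseRange ha
      refine ih b ⟨hbad a ha haε, hba⟩ hb (haε.trans_le' ?_)
      exact mul_le_mul_of_nonneg_left (Nat.one_div_le_one_div hba.1.le) zero_le_two
  obtain ⟨k, hk⟩ := exists_nat_one_div_lt (half_pos hε)
  obtain ⟨x, hx⟩ := hj.denseRange.exists_dist_lt z (Nat.one_div_pos_of_nat (α := ℝ) (n := k))
  rw [dist_comm] at hx
  exact hfalse (x, k) hx ((lt_div_iff₀' two_pos).1 hk)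

end IsMetricIn

end Cover

section Preinterpretation

variable {M : Set ZFSet.{u}} {S : MSpace.{u, v}} {Y : Type w} {top : TopologicalSpace Y}
  {pt : S.Pt → Y} {op : Set S.Pt → Set Y} (h : IsPreinterpretation M S top pt op)
include h

theorem op_mono {O Q : Set S.Pt} (hO : O ∈ S.opens) (hQ : Q ∈ S.opens) (hOQ : O ⊆ Q) :
    op O ⊆ op Q := by
  rw [← Set.inter_eq_left, ← h.inter O hO Q hQ, Set.inter_eq_left.2 hOQ]

theorem inter_nonempty_of_mem_op {O Q : Set S.Pt} (hO : O ∈ S.opens) (hQ : Q ∈ S.opens) {y : Y}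
    (hyO : y ∈ op O) (hyQ : y ∈ op Q) : (O ∩ Q).Nonempty := by
  by_contra hne
  have hy : y ∈ op (O ∩ Q) := (h.inter O hO Q hQ).symm ▸ ⟨hyO, hyQ⟩
  rw [Set.not_nonempty_iff_eq_empty.1 hne, h.empty] at hy
  exact hy

end Preinterpretation

section Reduction

variable {M : Set ZFSet.{u}} {S : MSpace.{u, v}} {Y : Type w} {Y' : Type w'}
  {top : TopologicalSpace Y} {top' : TopologicalSpace Y'} {pt : S.Pt → Y} {op : Set S.Pt → Set Y}
  {pt' : S.Pt → Y'} {op' : Set S.Pt → Set Y'} {f : Y → Y'}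

theorem continuous_of_isReduction (h : IsPreinterpretation M S top pt op)
    (h' : IsPreinterpretation M S top' pt' op') (hf : IsReduction S pt op pt' op' f) :
    Continuous f := by
  rw [h'.basis.continuous_iff]
  rintro _ ⟨O, hO, rfl⟩
  exact (hf.2 O hO).symm ▸ h.isOpen O hO

theorem leftInverse_of_isReduction (h : IsPreinterpretation M S top pt op)
    (hf : IsReduction S pt op pt' op' f) {g : Y' → Y} (hg : IsReduction S pt' op' pt op g) :
    Function.LeftInverse g f := by
  have := h.t0
  intro y
  refine (h.basis.inseparable_iff.2 ?_).eq
  rintro _ ⟨O, hO, rfl⟩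
  rw [← Set.mem_preimage, hg.2 O hO, ← Set.mem_preimage, hf.2 O hO]

theorem exists_homeomorph_of_interprets {Y Y' : Type u} {top : TopologicalSpace Y}
    {top' : TopologicalSpace Y'} {pt : S.Pt → Y} {pt' : S.Pt → Y'} (h : Interprets M S top pt)
    (h' : Interprets M S top' pt') : ∃ e : Y ≃ₜ Y', ∀ x, e (pt x) = pt' x := by
  obtain ⟨op, hp, hr⟩ := h
  obtain ⟨op', hp', hr'⟩ := h'
  obtain ⟨f, hf⟩ := hr' Y top pt op hp
  obtain ⟨g, hg⟩ := hr Y' top' pt' op' hp'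
  exact ⟨⟨⟨f, g, leftInverse_of_isReduction hp hf hg, leftInverse_of_isReduction hp' hg hf⟩,
    continuous_of_isReduction hp hp' hf, continuous_of_isReduction hp' hp hg⟩,
    fun x => (congrFun hf.1 x).symm⟩

end Reduction

section MetricInterpretation

variable {M : Set ZFSet.{u}} [hM : Fact (IsTransitiveModelZFC M)]
variable {P : Type v} [Coded M P]

theorem sUnion_image_coe (G : SetIn M (SetIn M P)) :
    ⋃₀ (SetIn.carrier '' G.1) = {x | ∃ S ∈ G, x ∈ S} := by
  ext x
  rw [Set.sUnion_image, Set.mem_iUnion₂]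
  exact exists_congr fun S => exists_prop

theorem exists_mem_op_of_mem_op_cover {Z : Type*} [PseudoMetricSpace Z] {j : P → Z} {Y : Type w'}
    {top : TopologicalSpace Y} {pt : P → Y} {op : Set P → Set Y}
    (h : IsPreinterpretation M (metricMSpace M j) top pt op) {G : SetIn M (SetIn M P)}
    (hG : ∀ S ∈ G, S.1 ∈ metricOpens M j) {y : Y} (hy : y ∈ op {x | ∃ S ∈ G, x ∈ S}) :
    ∃ S ∈ G, y ∈ op S.1 := by
  have hunion : op (⋃₀ (SetIn.carrier '' G.1)) = ⋃ O ∈ SetIn.carrier '' G.1, op O :=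
    h.sUnion _ (familyIn_iff.2 ⟨Set.image_subset_iff.2 hG, G, rfl⟩)
  rw [sUnion_image_coe] at hunion
  rw [hunion, Set.biUnion_image] at hy
  obtain ⟨S, hS, hyS⟩ := Set.mem_iUnion₂.1 hy
  exact ⟨S, hS, hyS⟩

namespace IsMetricIn

section Pseudo

variable [IsSmall M P] {Z : Type w} [PseudoMetricSpace Z] {j : P → Z} (hj : IsMetricIn M j)
include hj

theorem isTopologicalBasis :
    TopologicalSpace.IsTopologicalBasis (openExtension j '' metricOpens M j) := by
  refine TopologicalSpace.isTopologicalBasis_of_isOpen_of_nhds ?_ fun z U hz hU => ?_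
  · rintro _ ⟨O, -, rfl⟩
    exact isOpen_openExtension
  obtain ⟨ε, hε, hεU⟩ := Metric.isOpen_iff.1 hU z hz
  obtain ⟨k, hk⟩ := exists_nat_one_div_lt (half_pos hε)
  obtain ⟨x, hx⟩ := hj.denseRange.exists_dist_lt z (Nat.one_div_pos_of_nat (α := ℝ) (n := k))
  refine ⟨_, ⟨_, hj.ball_mem_metricOpens x k, rfl⟩,
    subset_openExtension_preimage Metric.isOpen_ball (Metric.mem_ball.2 hx), fun t ht => hεU ?_⟩
  have htx : dist t (j x) ≤ 1 / ((k : ℝ) + 1) := Metric.closure_ball_subset_closedBall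
    (openExtension_preimage_subset_closure hj.denseRange ht)
  rw [Metric.mem_ball]
  linarith [dist_triangle_right t z (j x)]

theorem openExtension_sUnion {F : Set (Set P)} (hF : (metricMSpace M j).FamilyIn M F) :
    openExtension j (⋃₀ F) = ⋃ O ∈ F, openExtension j O := by
  refine subset_antisymm ?_ (Set.iUnion₂_subset fun O hO =>
    openExtension_mono (Set.subset_sUnion_of_mem hO))
  obtain ⟨hFO, G, rfl⟩ := familyIn_iff.1 hF
  intro z hz
  rw [sUnion_image_coe] at hz
  rw [Set.biUnion_image]
  obtain ⟨S, hS, hzS⟩ := hj.exists_mem_openExtension_of_cover (Set.image_subset_iff.1 hFO) hz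
  exact Set.mem_iUnion₂.2 ⟨S, hS, hzS⟩

variable {Y : Type w'} {top : TopologicalSpace Y} {pt : P → Y} {op : Set P → Set Y}
  (h : IsPreinterpretation M (metricMSpace M j) top pt op)
include h

theorem exists_mem_op_ball {O : Set P} (hO : O ∈ metricOpens M j) {y : Y} (hy : y ∈ op O) (k : ℕ) :
    ∃ x, ∃ l ≥ k, y ∈ op (hj.ball x l).1 ∧
      ∀ x', dist (j x') (j x) < 1 / ((l : ℝ) + 1) + 1 / ((l : ℝ) + 1) → x' ∈ O := by
  obtain ⟨⟨T, rfl⟩, hT⟩ := mem_metricOpens_iff.1 hO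
  let Small (S : SetIn M P) : Prop := ∃ x l, S = hj.ball x l ∧ k ≤ l ∧
    ∀ x', dist (j x') (j x) < 1 / ((l : ℝ) + 1) + 1 / ((l : ℝ) + 1) → x' ∈ T
  have hsmall : DefinablePred M Small := by
    refine .ex (.ex (.and (.eq (by fun_prop) (hj.definableFun_ball (by fun_prop) (by fun_prop)))
      (.and (.natLe (by fun_prop) (by fun_prop)) (.all (.imp ?_ (by fun_prop))))))
    exact (hj.definableReal (by fun_prop) (by fun_prop)).lt (.add (by fun_prop) (by fun_prop))
  have hcover : T.1 = {x | ∃ S ∈ SetIn.sep Small hsmall, x ∈ S} := by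
    ext x
    constructor
    · intro hx
      obtain ⟨ε, hε, hεT⟩ := hT x hx
      obtain ⟨l, hl⟩ := exists_nat_one_div_lt (half_pos hε)
      have hkl : 1 / (((max k l : ℕ) : ℝ) + 1) ≤ 1 / ((l : ℝ) + 1) :=
        Nat.one_div_le_one_div (le_max_right _ _)
      exact ⟨_, ⟨x, max k l, rfl, le_max_left _ _, fun x' hx' => hεT x' (by linarith)⟩,
        hj.self_mem_ball x _⟩
    · rintro ⟨_, ⟨x', l, rfl, -, hl⟩, hx⟩
      rw [mem_ball] at hx
      exact hl x (hx.trans (lt_add_of_pos_left _ Nat.one_div_pos_of_nat))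
  rw [hcover] at hy
  obtain ⟨_, ⟨x, l, rfl, hkl, hl⟩, hyx⟩ := exists_mem_op_of_mem_op_cover h
    (by rintro _ ⟨x, l, rfl, -⟩; exact hj.ball_mem_metricOpens x l) hy
  exact ⟨x, l, hkl, hyx, hl⟩

theorem exists_forall_dist_le [CompleteSpace Z] (y : Y) :
    ∃ z, ∀ x k, y ∈ op (hj.ball x k).1 → dist (j x) z ≤ 1 / ((k : ℝ) + 1) := by
  choose c l hkl hc using fun k => hj.exists_mem_op_ball h univ_mem_metricOpens
    (h.univ.symm ▸ Set.mem_univ y) k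
  have hdist (x k n) (hx : y ∈ op (hj.ball x k).1) :
      dist (j x) (j (c n)) ≤ 1 / ((k : ℝ) + 1) + 1 / ((n : ℝ) + 1) := by
    obtain ⟨t, htx, htc⟩ := inter_nonempty_of_mem_op h (hj.ball_mem_metricOpens x k)
      (hj.ball_mem_metricOpens (c n) (l n)) hx (hc n).1
    have htx : dist (j t) (j x) < _ := htx
    have htc : dist (j t) (j (c n)) < _ := htc
    have hnl : 1 / ((l n : ℝ) + 1) ≤ 1 / ((n : ℝ) + 1) := Nat.one_div_le_one_div (hkl n)
    linarith [dist_triangle_left (j x) (j (c n)) (j t)]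
  have hcauchy : CauchySeq fun n => j (c n) := by
    refine cauchySeq_of_le_tendsto_0' (fun n : ℕ => 2 * (1 / ((n : ℝ) + 1))) (fun n m hnm => ?_)
      (by simpa using tendsto_one_div_add_atTop_nhds_zero_nat.const_mul (2 : ℝ))
    have hln : 1 / ((l n : ℝ) + 1) ≤ 1 / ((n : ℝ) + 1) := Nat.one_div_le_one_div (hkl n)
    have hmn : 1 / ((m : ℝ) + 1) ≤ 1 / ((n : ℝ) + 1) := Nat.one_div_le_one_div hnm
    linarith [hdist (c n) (l n) m (hc n).1]
  obtain ⟨z, hz⟩ := cauchySeq_tendsto_of_complete hcauchy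
  refine ⟨z, fun x k hx => ?_⟩
  have hlim : Tendsto (fun n : ℕ => 1 / ((k : ℝ) + 1) + 1 / ((n : ℝ) + 1)) atTop
      (𝓝 (1 / ((k : ℝ) + 1) + 0)) :=
    tendsto_const_nhds.add tendsto_one_div_add_atTop_nhds_zero_nat
  rw [add_zero] at hlim
  exact le_of_tendsto_of_tendsto' (tendsto_const_nhds.dist hz) hlim fun n => hdist x k n hx

theorem mem_openExtension_iff_mem_op {O : Set P} (hO : O ∈ metricOpens M j) {y : Y} {z : Z}
    (hz : ∀ x k, y ∈ op (hj.ball x k).1 → dist (j x) z ≤ 1 / ((k : ℝ) + 1)) :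
    z ∈ openExtension j O ↔ y ∈ op O := by
  rw [mem_openExtension_iff]
  constructor
  · rintro ⟨ε, hε, hεO⟩
    obtain ⟨k, hk⟩ := exists_nat_one_div_lt (half_pos hε)
    obtain ⟨x, l, hkl, hyx, -⟩ := hj.exists_mem_op_ball h univ_mem_metricOpens
      (h.univ.symm ▸ Set.mem_univ y) k
    have hlk : 1 / ((l : ℝ) + 1) ≤ 1 / ((k : ℝ) + 1) := Nat.one_div_le_one_div hkl
    refine op_mono h (hj.ball_mem_metricOpens x l) hO (fun x' hx' => hεO x' ?_) hyx
    have hx' : dist (j x') (j x) < _ := hx'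
    linarith [dist_triangle (j x') (j x) z, hz x l hyx]
  · intro hy
    obtain ⟨x, l, -, hyx, hl⟩ := hj.exists_mem_op_ball h hO hy 0
    refine ⟨_, Nat.one_div_pos_of_nat (n := l), fun x' hx' => hl x' ?_⟩
    linarith [dist_triangle_right (j x') (j x) z, hz x l hyx]

end Pseudo

variable [IsSmall M P] {Z : Type w} [MetricSpace Z] {j : P → Z} (hj : IsMetricIn M j)
include hj

theorem isPreinterpretation :
    IsPreinterpretation M (metricMSpace M j) inferInstance j (openExtension j) where
  t0 := inferInstance
  isOpen _ _ := isOpen_openExtension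
  mem_iff _ _ hO := (mem_openExtension_iff_mem hO).symm
  inter _ _ _ _ := openExtension_inter _ _
  sUnion _ := hj.openExtension_sUnion
  empty := openExtension_empty hj.denseRange
  univ := openExtension_univ
  basis := hj.isTopologicalBasis

theorem isInterpretation [CompleteSpace Z] :
    IsInterpretation M (metricMSpace M j) inferInstance j (openExtension j) := by
  refine ⟨hj.isPreinterpretation, fun Y top pt op h => ?_⟩
  choose r hr using hj.exists_forall_dist_le h
  refine ⟨r, funext fun x => ?_, fun O hO =>
    Set.ext fun y => hj.mem_openExtension_iff_mem_op h hO (hr y)⟩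
  refine dist_le_zero.1 (ge_of_tendsto' tendsto_one_div_add_atTop_nhds_zero_nat fun k => ?_)
  exact hr _ x k ((h.mem_iff x _ (hj.ball_mem_metricOpens x k)).1 (hj.self_mem_ball x k))

theorem interprets [CompleteSpace Z] : Interprets M (metricMSpace M j) inferInstance j :=
  ⟨_, hj.isInterpretation⟩

end IsMetricIn

end MetricInterpretation

section Product

variable {M : Set ZFSet.{u}}

theorem interprets_congr {P : Type v} {c c' : P → ZFSet.{u}} {o o' : Set (Set P)} {Z : Type w}
    {top : TopologicalSpace Z} {j : P → Z} (hc : c' = c) (ho : o' = o)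
    (h : Interprets M ⟨P, c, o⟩ top j) : Interprets M ⟨P, c', o'⟩ top j := by
  subst hc ho
  exact h

variable [hM : Fact (IsTransitiveModelZFC M)]
variable {P : Type v} [Coded M P] {P' : Type w'} [Coded M P']

theorem inModel_graph_iff [IsSmall M P] [IsSmall M P'] {f : P → P'} :
    InModel M {z | ∃ a, z = (orderedPair (code a) (code (f a)) : M).1} ↔ DefinableFun M f := by
  have hgraph : {z | ∃ a, z = (orderedPair (code a) (code (f a)) : M).1} =
      (fun p => (code p : M).1) '' {p : P × P' | p.2 = f p.1} := by
    ext z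
    constructor
    · rintro ⟨a, rfl⟩
      exact ⟨(a, f a), rfl, rfl⟩
    · rintro ⟨⟨a, b⟩, hb, rfl⟩
      exact ⟨a, by rw [← (hb : b = f a)]; rfl⟩
  rw [hgraph, inModel_image_code_iff]
  constructor
  · intro h
    let S : SetIn M (P × P') := ⟨_, h⟩
    exact .of_graph (by fun_prop : DefinablePred M fun p => p ∈ S)
  · exact fun h => exists_separation (by fun_prop)

variable {Z : Type w} [PseudoMetricSpace Z] {j : P → Z} {Z' : Type*} [PseudoMetricSpace Z']
  {j' : P' → Z'}

theorem IsMetricIn.prod (hj : IsMetricIn M j) (hj' : IsMetricIn M j') :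
    IsMetricIn M (Prod.map j j') where
  denseRange := hj.denseRange.prodMap hj'.denseRange
  definable_dist := (hj.definableReal (by fun_prop) (by fun_prop)).max
    (hj'.definableReal (by fun_prop) (by fun_prop))
  complete s hs hc := by
    obtain ⟨x, hx⟩ := hj.complete (fun n => (s n).1) (by fun_prop)
      (uniformContinuous_fst.comp_cauchySeq hc)
    obtain ⟨y, hy⟩ := hj'.complete (fun n => (s n).2) (by fun_prop)
      (uniformContinuous_snd.comp_cauchySeq hc)
    exact ⟨(x, y), hx.prodMk_nhds hy⟩

variable [IsSmall M P] [IsSmall M P']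

theorem opens_prod_metricMSpace (hj : IsMetricIn M j) (hj' : IsMetricIn M j') :
    ((metricMSpace M j).prod M (metricMSpace M j')).opens = metricOpens M (Prod.map j j') := by
  ext O
  refine and_congr_right fun _ => forall₂_congr fun p _ => ⟨?_, ?_⟩
  · rintro ⟨U, hU, W, hW, hpU, hpW, hUW⟩
    obtain ⟨ε, hε, hεU⟩ := hU.2 _ hpU
    obtain ⟨ε', hε', hεW⟩ := hW.2 _ hpW
    refine ⟨min ε ε', lt_min hε hε', fun q hq => hUW ⟨hεU _ ?_, hεW _ ?_⟩⟩
    · exact (le_max_left _ _).trans_lt (hq.trans_le (min_le_left _ _))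
    · exact (le_max_right _ _).trans_lt (hq.trans_le (min_le_right _ _))
  · rintro ⟨ε, hε, hεO⟩
    obtain ⟨k, hk⟩ := exists_nat_one_div_lt hε
    exact ⟨_, hj.ball_mem_metricOpens p.1 k, _, hj'.ball_mem_metricOpens p.2 k,
      hj.self_mem_ball _ _, hj'.self_mem_ball _ _,
      fun q hq => hεO q ((max_lt hq.1 hq.2).trans hk)⟩

theorem interprets_prod {Z : Type w} [MetricSpace Z] [CompleteSpace Z] {j : P → Z} {Z' : Type*}
    [MetricSpace Z'] [CompleteSpace Z'] {j' : P' → Z'} (hj : IsMetricIn M j)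
    (hj' : IsMetricIn M j') {c : P → ZFSet.{u}} {o : Set (Set P)} {c' : P' → ZFSet.{u}}
    {o' : Set (Set P')} (hc : c = fun x => (code x : M).1) (ho : o = metricOpens M j)
    (hc' : c' = fun x => (code x : M).1) (ho' : o' = metricOpens M j') :
    Interprets M ((⟨P, c, o⟩ : MSpace.{u, v}).prod M ⟨P', c', o'⟩) inferInstance
      (Prod.map j j') := by
  subst hc ho hc' ho'
  exact interprets_congr rfl (opens_prod_metricMSpace hj hj') (hj.prod hj').interprets

end Product

section RealLine

variable {M : Set ZFSet.{u}} [hM : Fact (IsTransitiveModelZFC M)]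

theorem isMetricIn_val : IsMetricIn M (MReal.val (M := M)) where
  denseRange := denseRange_mreal_val
  definable_dist := .dist (.val (.fst .id)) (.val (.snd .id))
  complete _ := exists_tendsto_mreal_val

theorem code_realSpace : (realSpace M).code = fun r : MReal M => (code r : M).1 :=
  funext fun r => (code_mreal r).symm

theorem opens_realSpace : (realSpace M).opens = metricOpens M (MReal.val (M := M)) := by
  unfold metricOpens
  rw [← code_realSpace]
  rfl

theorem interprets_realSpace : Interprets M (realSpace M) inferInstance MReal.val :=
  interprets_congr code_realSpace opens_realSpace isMetricIn_val.interprets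

end RealLine

section Operations

variable {M : Set ZFSet.{u}} [hM : Fact (IsTransitiveModelZFC M)] {X : BanachIn M}

instance instCodedCarrier (X : BanachIn M) : Coded M X.carrier where
  code x := ⟨x.1, mem_of_mem X.carrier_mem x.2⟩
  injective _ _ h := Subtype.ext (congrArg (Subtype.val : M → ZFSet.{u}) h)
  definable_range := by
    have : DefinablePred M fun x : M => x.1 ∈ (⟨X.carrier, X.carrier_mem⟩ : M).1 := by fun_prop
    refine DefinableRel.congr this fun v => ⟨?_, ?_⟩
    · rintro ⟨x, hx⟩
      exact ⟨v 0, rfl, by rw [hx]; exact x.2⟩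
    · rintro ⟨x, hx, h⟩
      exact ⟨⟨x.1, h⟩, hx⟩

instance instIsSmallCarrier (X : BanachIn M) : IsSmall M X.carrier where
  exists_mem_iff := ⟨⟨X.carrier, X.carrier_mem⟩, fun t =>
    ⟨fun h => ⟨⟨t.1, h⟩, rfl⟩, fun ⟨a, ha⟩ => by rw [ha]; exact a.2⟩⟩

variable {C : Type*} [Coded M C]

@[fun_prop]
theorem DefinableFun.vectorAdd {f g : C → X.carrier} (hf : DefinableFun M f)
    (hg : DefinableFun M g) : DefinableFun M fun c => f c + g c := by
  refine .comp (g := fun p : X.carrier × X.carrier => p.1 + p.2) (inModel_graph_iff.1 ?_)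
    (hf.prodMk hg)
  convert X.add_mem using 1
  ext z
  exact ⟨fun ⟨p, hp⟩ => ⟨p.1, p.2, hp⟩, fun ⟨x, y, h⟩ => ⟨(x, y), h⟩⟩

@[fun_prop]
theorem DefinableFun.vectorNeg {f : C → X.carrier} (hf : DefinableFun M f) :
    DefinableFun M fun c => - f c :=
  .of_graph ((by fun_prop : DefinablePred M fun p : C × X.carrier => p.2 + f p.1 = 0).congr
    fun _ => eq_neg_iff_add_eq_zero)

@[fun_prop]
theorem DefinableFun.vectorSub {f g : C → X.carrier} (hf : DefinableFun M f)
    (hg : DefinableFun M g) : DefinableFun M fun c => f c - g c := by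
  simp only [sub_eq_add_neg]
  fun_prop

@[fun_prop]
theorem DefinableFun.vectorSmul {f : C → MReal M} {g : C → X.carrier} (hf : DefinableFun M f)
    (hg : DefinableFun M g) : DefinableFun M fun c => X.smul (f c) (g c) := by
  refine .comp (g := fun p : MReal M × X.carrier => X.smul p.1 p.2) (inModel_graph_iff.1 ?_)
    (hf.prodMk hg)
  convert X.smul_mem using 1
  simp only [← code_mreal]
  ext z
  exact ⟨fun ⟨p, hp⟩ => ⟨p.1, p.2, hp⟩, fun ⟨r, x, h⟩ => ⟨(r, x), h⟩⟩

@[fun_prop]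
theorem DefinableFun.norm {f : C → X.carrier} (hf : DefinableFun M f) :
    DefinableFun M fun c => X.norm (f c) := by
  refine .comp (g := X.norm) (inModel_graph_iff.1 ?_) hf
  convert X.norm_mem using 1
  simp only [← code_mreal]
  rfl

@[fun_prop]
theorem DefinableFun.vectorNsmul {n : C → ℕ} {f : C → X.carrier} (hn : DefinableFun M n)
    (hf : DefinableFun M f) : DefinableFun M fun c => n c • f c := by
  have hiter : ∀ (x : X.carrier) (n : ℕ),
      (fun p : X.carrier × X.carrier => (p.1, p.2 + p.1))^[n] (x, 0) = (x, n • x) := by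
    intro x n
    induction n with
    | zero => simp
    | succ n ih => rw [Function.iterate_succ_apply', ih, succ_nsmul]
  have h := (DefinableFun.iterate (M := M)
    (g := fun p : X.carrier × X.carrier => (p.1, p.2 + p.1)) (by fun_prop)).comp
      (hn.prodMk (hf.prodMk (.const 0)))
  simpa only [hiter] using h.snd

end Operations

section RationalScalars

theorem nonempty_normedSpace_real (Z : Type w) [NormedAddCommGroup Z] [NormedSpace ℚ Z]
    [CompleteSpace Z] : Nonempty (NormedSpace ℝ Z) := by
  have hlip : ∀ q : ℚ, ‖algebraMap ℚ (Z →L[ℚ] Z) q‖ ≤ 1 * ‖q‖ := fun q =>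
    ContinuousLinearMap.opNorm_le_bound _ (by positivity) fun z => by
      simp [Algebra.algebraMap_eq_smul_one, norm_smul]
  have hcont : UniformContinuous (algebraMap ℚ (Z →L[ℚ] Z)) :=
    (AddMonoidHomClass.lipschitz_of_bound (algebraMap ℚ (Z →L[ℚ] Z)) 1 hlip).uniformContinuous
  have hdense := Rat.isDenseEmbedding_coe_real.isDenseInducing
  let scalar : ℝ →+* (Z →L[ℚ] Z) := IsDenseInducing.extendRingHom (i := Rat.castHom ℝ)
    Rat.isUniformEmbedding_coe_real.isUniformInducing hdense.dense hcont
  have hscalar : ∀ (q : ℚ) z, scalar q z = q • z := fun q z => by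
    have := hdense.extend_eq hcont.continuous q
    exact DFunLike.congr_fun this z
  have hscalar_cont : Continuous scalar :=
    (uniformContinuous_uniformly_extend Rat.isUniformEmbedding_coe_real.isUniformInducing
      hdense.dense hcont).continuous
  let _ : Module ℝ Z := Module.compHom Z scalar
  refine ⟨{ norm_smul_le := fun r z => ?_ }⟩
  have : ‖scalar r z‖ ≤ ‖r‖ * ‖z‖ := by
    refine hdense.dense.induction_on (p := fun r => ‖scalar r z‖ ≤ ‖r‖ * ‖z‖) r
      (isClosed_le (by fun_prop) (by fun_prop)) fun q => ?_
    rw [hscalar, norm_smul, Rat.norm_cast_real]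
  exact this

end RationalScalars

section Completion

variable {M : Set ZFSet.{u}} [hM : Fact (IsTransitiveModelZFC M)] {X : BanachIn M}

/-- `j` embeds `X` isometrically onto a dense subspace of the real normed space `Z`. -/
structure IsBanachCompletion (X : BanachIn M) {Z : Type w} [NormedAddCommGroup Z]
    [NormedSpace ℝ Z] (j : X.carrier → Z) : Prop where
  map_add : ∀ x y, j (x + y) = j x + j y
  map_smul : ∀ r x, j (X.smul r x) = r.val • j x
  norm_map : ∀ x, ‖j x‖ = (X.norm x).val
  denseRange : DenseRange j

variable (M) in
/-- A rational number as a real number of `M`. -/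
noncomputable def ratReal (q : ℚ) : MReal M := (exists_mreal_ratCast q).choose

theorem ratReal_val (q : ℚ) : (ratReal M q).val = q := (exists_mreal_ratCast q).choose_spec

variable (X) in
/-- The scalar multiplication of `X` restricted to `ℚ`, which is a field also in `V`. -/
@[reducible]
noncomputable def ratModule : Module ℚ X.carrier :=
  letI : SMul ℚ X.carrier := ⟨fun q => X.smul (ratReal M q)⟩
  Module.ofMinimalAxioms (fun q => X.smul_add (ratReal M q))
    (fun p q x => X.add_smul (ratReal M p) (ratReal M q) (ratReal M (p + q)) x
      (by simp [ratReal_val]))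
    (fun p q x => X.mul_smul (ratReal M p) (ratReal M q) (ratReal M (p * q)) x
      (by simp [ratReal_val]))
    (fun x => X.one_smul (ratReal M 1) x (by simp [ratReal_val]))

attribute [local instance] ratModule

theorem norm_rat_smul (q : ℚ) (x : X.carrier) : (X.norm (q • x)).val = |(q : ℝ)| * (X.norm x).val :=
  (X.norm_smul (ratReal M q) x).trans (by rw [ratReal_val])

variable (X) in
/-- The norm of `X`, as a norm in `V`. -/
noncomputable def addGroupNorm : AddGroupNorm X.carrier where
  toFun x := (X.norm x).val
  map_zero' := by simpa using norm_rat_smul 0 (0 : X.carrier)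
  add_le' := X.norm_add_le
  neg' x := by simpa using norm_rat_smul (-1) x
  eq_zero_of_map_eq_zero' x h := X.eq_zero_of_norm x h

variable (X) in
/-- `X` as a normed group in `V`. -/
@[reducible]
noncomputable def normedGroup : NormedAddCommGroup X.carrier :=
  (addGroupNorm X).toNormedAddCommGroup

theorem norm_smul_sub_rat_smul (r : MReal M) (q : ℚ) (x : X.carrier) :
    (X.norm (X.smul r x - q • x)).val = |r.val - q| * (X.norm x).val := by
  have : X.smul r x - q • x = X.smul (mrealAdd r (ratReal M (-q))) x := by
    rw [X.add_smul r (ratReal M (-q)) _ x (mrealAdd_val _ _), sub_eq_add_neg, ← neg_smul]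
    rfl
  rw [this, X.norm_smul, mrealAdd_val, ratReal_val, Rat.cast_neg, sub_eq_add_neg]

theorem isBanachCompletion_of_map_rat_smul {Z : Type w} [NormedAddCommGroup Z] [NormedSpace ℝ Z]
    {j : X.carrier → Z} (map_add : ∀ x y, j (x + y) = j x + j y)
    (map_rat_smul : ∀ (q : ℚ) x, j (q • x) = (q : ℝ) • j x)
    (norm_map : ∀ x, ‖j x‖ = (X.norm x).val) (denseRange : DenseRange j) :
    IsBanachCompletion X j where
  map_add := map_add
  map_smul r x := by
    let i : X.carrier →+ Z := AddMonoidHom.mk' j map_add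
    have hdense := Rat.isDenseEmbedding_coe_real.isDenseInducing.dense
    have key : ∀ t : ℝ, ‖i (X.smul r x) - t • i x‖ = |r.val - t| * ‖i x‖ := fun t =>
      hdense.induction_on (p := fun t => ‖i (X.smul r x) - t • i x‖ = |r.val - t| * ‖i x‖) t
        (isClosed_eq (by fun_prop) (by fun_prop)) fun q => by
          rw [show (q : ℝ) • i x = i (q • x) from (map_rat_smul q x).symm, ← map_sub]
          exact (norm_map _).trans
            ((norm_smul_sub_rat_smul r q x).trans (by rw [← norm_map]; rfl))
    have := key r.val
    rwa [sub_self, abs_zero, zero_mul, norm_eq_zero, sub_eq_zero] at this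
  norm_map := norm_map
  denseRange := denseRange

theorem small_completion (α : Type*) [UniformSpace α] [Small.{u} α] :
    Small.{u} (UniformSpace.Completion α) := by
  have : Small.{u} (Filter α) :=
    small_of_injective (f := fun f : Filter α => f.sets) fun _ _ h => Filter.filter_eq h
  have : Small.{u} (CauchyFilter α) := inferInstanceAs (Small.{u} {f : Filter α // Cauchy f})
  exact small_of_surjective (f := fun x : CauchyFilter α =>
    (SeparationQuotient.mk x : SeparationQuotient (CauchyFilter α)))
    SeparationQuotient.surjective_mk

variable (X) in
theorem exists_isBanachCompletion : ∃ (Z : Type (u + 1)) (_ : NormedAddCommGroup Z)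
    (_ : NormedSpace ℝ Z) (j : X.carrier → Z), CompleteSpace Z ∧ Small.{u} Z ∧
      IsBanachCompletion X j := by
  let _ := normedGroup X
  let _ : NormedSpace ℚ X.carrier := { norm_smul_le q x := (norm_rat_smul q x).le }
  let Z := UniformSpace.Completion X.carrier
  obtain ⟨_⟩ := nonempty_normedSpace_real Z
  refine ⟨Z, inferInstance, inferInstance, (↑), inferInstance, small_completion _,
    isBanachCompletion_of_map_rat_smul UniformSpace.Completion.coe_add (fun q x => ?_)
      UniformSpace.Completion.norm_coe UniformSpace.Completion.denseRange_coe⟩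
  rw [Rat.cast_smul_eq_qsmul]
  exact UniformSpace.Completion.coe_smul q x

end Completion

namespace IsBanachCompletion

variable {M : Set ZFSet.{u}} {X : BanachIn M}
  {Z : Type w} [NormedAddCommGroup Z] [NormedSpace ℝ Z] {j : X.carrier → Z}
  (hj : IsBanachCompletion X j)
include hj

theorem map_zero : j 0 = 0 := (AddMonoidHom.mk' j hj.map_add).map_zero

theorem map_neg (x : X.carrier) : j (-x) = - j x := (AddMonoidHom.mk' j hj.map_add).map_neg x

theorem map_sub (x y : X.carrier) : j (x - y) = j x - j y :=
  (AddMonoidHom.mk' j hj.map_add).map_sub x y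

theorem map_nsmul (n : ℕ) (x : X.carrier) : j (n • x) = n • j x :=
  (AddMonoidHom.mk' j hj.map_add).map_nsmul n x

theorem dist_eq (x y : X.carrier) : dist (j x) (j y) = (X.norm (x - y)).val := by
  rw [dist_eq_norm, ← hj.map_sub, hj.norm_map]

theorem injective : Function.Injective j := fun x y h =>
  sub_eq_zero.1 (X.eq_zero_of_norm _ (by rw [← hj.dist_eq, h, dist_self]))

theorem norm_apply_pos {x : X.carrier} (hx : x ≠ 0) : 0 < ‖j x‖ :=
  norm_pos_iff.2 fun h => hx (hj.injective (h.trans hj.map_zero.symm))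

variable [hM : Fact (IsTransitiveModelZFC M)]

theorem isMetricIn : IsMetricIn M j where
  denseRange := hj.denseRange
  definable_dist := by
    simp only [hj.dist_eq]
    exact .val (by fun_prop)
  complete s hs hc := by
    obtain ⟨x, hx⟩ := X.complete s (inModel_graph_iff.2 hs) (fun ε hε => by
      simpa only [hj.dist_eq] using Metric.cauchySeq_iff.1 hc ε hε)
    refine ⟨x, Metric.tendsto_atTop.2 fun ε hε => ?_⟩
    simpa only [hj.dist_eq] using hx ε hε

theorem opens_space : X.space.opens = metricOpens M j := by
  ext O
  refine and_congr_right fun _ => ?_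
  simp only [hj.dist_eq]

theorem interprets [CompleteSpace Z] : Interprets M X.space inferInstance j :=
  interprets_congr rfl hj.opens_space hj.isMetricIn.interprets

end IsBanachCompletion

section Extension

theorem exists_strongDual_eq {E : Type v} [AddCommGroup E] [Module ℚ E] {Z : Type w}
    [NormedAddCommGroup Z] [NormedSpace ℝ Z] {j : E →+ Z} (hj : DenseRange j) (g : E →+ ℝ)
    (hg : ∃ C : ℝ, ∀ x, |g x| ≤ C * ‖j x‖) : ∃ F : StrongDual ℝ Z, ∀ x, F (j x) = g x := by
  let _ := NormedSpace.restrictScalars ℚ ℝ Z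
  let G := g.toRatLinearMap.extendOfNorm j.toRatLinearMap
  exact ⟨G.toLinearMap.toAddMonoidHom.toRealLinearMap G.continuous, fun x =>
    LinearMap.extendOfNorm_eq (f := g.toRatLinearMap) (e := j.toRatLinearMap) hj hg x⟩

end Extension

section Dual

variable {M : Set ZFSet.{u}} [hM : Fact (IsTransitiveModelZFC M)] {X : BanachIn M}

theorem exists_abs_le_mul_norm {g : X.carrier → ℝ} (hadd : ∀ x y, g (x + y) = g x + g y) {c : ℝ}
    (hc : 0 < c) (h : ∀ x, (X.norm x).val ≤ c → |g x| ≤ 1) :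
    ∃ C : ℝ, ∀ x, |g x| ≤ C * (X.norm x).val := by
  let _ := ratModule X
  let _ := normedGroup X
  let _ : NormedSpace ℚ X.carrier := { norm_smul_le q x := (norm_rat_smul q x).le }
  exact (AddMonoidHom.mk' g hadd).toRatLinearMap.bound_of_ball_bound hc 1 fun x hx =>
    h x (mem_ball_zero_iff.1 hx).le

theorem exists_dual (φ : X.carrier → MReal M) (hφ : DefinableFun M φ)
    (hadd : ∀ x y, (φ (x + y)).val = (φ x).val + (φ y).val)
    (hb : ∃ C : ℝ, ∀ x, |(φ x).val| ≤ C * (X.norm x).val) : ∃ f : X.Dual, f.toFun = φ := by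
  let _ := ratModule X
  obtain ⟨Z, _, _, j, _, _, hj⟩ := exists_isBanachCompletion X
  obtain ⟨F, hF⟩ := exists_strongDual_eq (j := AddMonoidHom.mk' j hj.map_add) hj.denseRange
    (AddMonoidHom.mk' (fun x => (φ x).val) hadd)
    (hb.imp fun C hC x => (hC x).trans_eq (by rw [← hj.norm_map]; rfl))
  have hF (x : X.carrier) : F (j x) = (φ x).val := hF x
  obtain ⟨z, hz, hgraph⟩ := inModel_graph_iff.2 hφ
  refine ⟨⟨φ, z, hz, ?_, hadd, fun r x => ?_, hb⟩, rfl⟩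
  · simp only [hgraph, ← code_mreal]
    rfl
  · rw [← hF, ← hF, hj.map_smul, map_smul, smul_eq_mul]

theorem isCodeSet_graph (f : X.Dual) : IsCodeSet (⟨f.graph, f.graph_mem⟩ : M)
    {p : X.carrier × MReal M | p.2 = f.toFun p.1} := by
  intro t
  change t.1 ∈ f.graph ↔ _
  rw [← SetLike.mem_coe, f.coe_graph]
  constructor
  · rintro ⟨x, hx⟩
    exact ⟨(x, f.toFun x), Subtype.ext (by rw [hx, ← code_mreal]; rfl), rfl⟩
  · rintro ⟨⟨x, r⟩, rfl, hr⟩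
    exact ⟨x, by rw [← show r = f.toFun x from hr, ← code_mreal]; rfl⟩

/-- The graph of a functional in `M`, as a subset of `X × ℝ^M` which belongs to `M`. -/
def dualGraph (f : X.Dual) : SetIn M (X.carrier × MReal M) :=
  ⟨_, _, isCodeSet_graph f⟩

@[simp]
theorem mem_dualGraph {f : X.Dual} {p : X.carrier × MReal M} :
    p ∈ dualGraph f ↔ p.2 = f.toFun p.1 :=
  Iff.rfl

theorem dualGraph_injective : Function.Injective (dualGraph (X := X)) := by
  intro f g h
  have hcarrier : {p : X.carrier × MReal M | p.2 = f.toFun p.1} = {p | p.2 = g.toFun p.1} :=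
    congrArg SetIn.carrier h
  have hgraph : f.graph = g.graph := congrArg (Subtype.val : M → ZFSet.{u})
    ((isCodeSet_graph f).unique (hcarrier ▸ isCodeSet_graph g))
  have hfun : f.toFun = g.toFun := funext fun x =>
    mem_dualGraph.1 (h ▸ mem_dualGraph.2 rfl : (x, f.toFun x) ∈ dualGraph g)
  cases f
  cases g
  cases hgraph
  cases hfun
  rfl

/-- A first-order description of the graphs of bounded functionals. The functional is required to
be bounded by `1` on a ball of radius `1 / (k + 1)`; homogeneity is automatic. -/
def IsDualGraph (S : SetIn M (X.carrier × MReal M)) : Prop :=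
  (∀ x, ∃ r, (x, r) ∈ S) ∧ (∀ x r s, (x, r) ∈ S → (x, s) ∈ S → r = s) ∧
    (∀ x y r s, (x, r) ∈ S → (y, s) ∈ S → (x + y, mrealAdd r s) ∈ S) ∧
      ∃ k : ℕ, ∀ x r, (x, r) ∈ S → (X.norm x).val ≤ 1 / ((k : ℝ) + 1) →
        dist r.val (ratReal M 0).val ≤ (ratReal M 1).val

theorem isDualGraph_dualGraph (f : X.Dual) : IsDualGraph (dualGraph f) := by
  simp only [IsDualGraph, mem_dualGraph]
  refine ⟨fun x => ⟨f.toFun x, rfl⟩, fun x r s hr hs => hr.trans hs.symm, ?_, ?_⟩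
  · rintro x y _ _ rfl rfl
    exact Subtype.ext ((mrealAdd_val _ _).trans (f.map_add x y).symm)
  · obtain ⟨C, hC⟩ := f.bounded
    obtain ⟨k, hk⟩ := exists_nat_ge |C|
    refine ⟨k, ?_⟩
    rintro x _ rfl hx
    have hnorm : 0 ≤ (X.norm x).val := apply_nonneg (addGroupNorm X) x
    simp only [ratReal_val, Rat.cast_zero, Rat.cast_one, Real.dist_0_eq_abs]
    calc |(f.toFun x).val| ≤ C * (X.norm x).val := hC x
      _ ≤ (k + 1) * (1 / (k + 1)) := by
        gcongr
        exact (le_abs_self C).trans (hk.trans (by linarith))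
      _ = 1 := mul_one_div_cancel (by positivity)

theorem exists_eq_dualGraph_iff {S : SetIn M (X.carrier × MReal M)} :
    (∃ f, S = dualGraph f) ↔ IsDualGraph S := by
  refine ⟨?_, fun ⟨htotal, hunique, hadd, k, hk⟩ => ?_⟩
  · rintro ⟨f, rfl⟩
    exact isDualGraph_dualGraph f
  · choose φ hφ using htotal
    have hS (p : X.carrier × MReal M) : p ∈ S ↔ p.2 = φ p.1 :=
      ⟨fun h => hunique _ _ _ h (hφ p.1), fun h => by rw [← Prod.mk.eta (p := p), h]; exact hφ p.1⟩
    have hφ_add (x y : X.carrier) : (φ (x + y)).val = (φ x).val + (φ y).val := by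
      rw [← mrealAdd_val, ← (hS _).1 (hadd x y _ _ (hφ x) (hφ y))]
    have hφ_bdd : ∃ C : ℝ, ∀ x, |(φ x).val| ≤ C * (X.norm x).val :=
      exists_abs_le_mul_norm hφ_add (Nat.one_div_pos_of_nat (n := k)) fun x hx => by
        simpa [ratReal_val] using hk x _ (hφ x) hx
    obtain ⟨f, hf⟩ := exists_dual φ
      (.of_graph ((by fun_prop : DefinablePred M fun p => p ∈ S).congr fun p => (hS p).symm))
      hφ_add hφ_bdd
    exact ⟨f, SetIn.ext fun p => (hS p).trans (by rw [mem_dualGraph, hf])⟩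

theorem DefinablePred.exists_eq_dualGraph :
    DefinablePred M fun S : SetIn M (X.carrier × MReal M) => ∃ f, S = dualGraph f := by
  simp only [exists_eq_dualGraph_iff, IsDualGraph]
  fun_prop

noncomputable instance instCodedDual : Coded M X.Dual :=
  Coded.ofInjective dualGraph dualGraph_injective DefinablePred.exists_eq_dualGraph

instance instIsSmallDual : IsSmall M X.Dual :=
  IsSmall.ofInjective dualGraph dualGraph_injective DefinablePred.exists_eq_dualGraph

theorem code_dual (f : X.Dual) : (code f : M).1 = f.graph :=
  congrArg (Subtype.val : M → ZFSet.{u}) ((dualGraph f).isCodeSet.unique (isCodeSet_graph f))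

@[fun_prop]
theorem DefinableFun.dualEval {C : Type*} [Coded M C] {f : C → X.Dual} {g : C → X.carrier}
    (hf : DefinableFun M f) (hg : DefinableFun M g) :
    DefinableFun M fun c => (f c).toFun (g c) := by
  have hgraph : DefinableFun M fun c => dualGraph (f c) := hf
  exact .of_graph (DefinablePred.mem_setIn (f := fun p : C × MReal M => (g p.1, p.2)) (by fun_prop)
    (hgraph.comp (.fst .id)))

end Dual

section OperatorNorm

theorem isLUB_abs_apply_of_denseRange {E : Type v} {Z : Type w} [NormedAddCommGroup Z]
    [NormedSpace ℝ Z] {j : E → Z} (hj : DenseRange j) (F : StrongDual ℝ Z) :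
    IsLUB {t | ∃ x, ‖j x‖ ≤ 1 ∧ t = |F (j x)|} ‖F‖ := by
  constructor
  · rintro _ ⟨x, hx, rfl⟩
    exact F.unit_le_opNorm _ hx
  · intro b hb
    have hdense : Metric.ball (0 : Z) 1 ⊆ closure (Metric.ball 0 1 ∩ Set.range j) :=
      hj.open_subset_closure_inter Metric.isOpen_ball
    have hle : closure (Metric.ball (0 : Z) 1 ∩ Set.range j) ⊆ {z | ‖F z‖ ≤ b} :=
      closure_minimal (fun z ⟨hz, x, hx⟩ => hb ⟨x, hx ▸ (mem_ball_zero_iff.1 hz).le, hx ▸ rfl⟩)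
        (isClosed_le (by fun_prop) (by fun_prop))
    rw [← F.sSup_unit_ball_eq_norm]
    refine csSup_le ((Metric.nonempty_ball.2 one_pos).image _) ?_
    rintro _ ⟨z, hz, rfl⟩
    exact hle (hdense hz)

end OperatorNorm

namespace IsBanachCompletion

section DualCompletion

variable {M : Set ZFSet.{u}} {X : BanachIn M}
  {Z : Type w} [NormedAddCommGroup Z] [NormedSpace ℝ Z] {j : X.carrier → Z}
  (hj : IsBanachCompletion X j)
include hj

theorem dual_ext {F G : StrongDual ℝ Z} (h : ∀ x, F (j x) = G (j x)) : F = G :=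
  DFunLike.coe_injective (hj.denseRange.equalizer F.continuous G.continuous (funext h))

theorem isLUB_abs_apply (F : StrongDual ℝ Z) :
    IsLUB {t | ∃ x, (X.norm x).val ≤ 1 ∧ t = |F (j x)|} ‖F‖ := by
  simpa only [hj.norm_map] using isLUB_abs_apply_of_denseRange hj.denseRange F

theorem lt_norm_iff {F : StrongDual ℝ Z} {c : ℝ} :
    c < ‖F‖ ↔ ∃ x, (X.norm x).val ≤ 1 ∧ c < |F (j x)| :=
  (lt_isLUB_iff (hj.isLUB_abs_apply F)).trans <| by aesop

theorem supNorm_eq (F : StrongDual ℝ Z) : X.supNorm (fun x => F (j x)) = ‖F‖ :=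
  (hj.isLUB_abs_apply F).csSup_eq ⟨_, 0, by
    rw [← hj.norm_map, hj.map_zero, norm_zero]; exact zero_le_one, rfl⟩

variable [hM : Fact (IsTransitiveModelZFC M)]

theorem exists_dualExt (f : X.Dual) : ∃ F : StrongDual ℝ Z, ∀ x, F (j x) = (f.toFun x).val := by
  let _ := ratModule X
  exact exists_strongDual_eq (j := AddMonoidHom.mk' j hj.map_add) hj.denseRange
    (AddMonoidHom.mk' (fun x => (f.toFun x).val) f.map_add)
    (f.bounded.imp fun C hC x => (hC x).trans_eq (by rw [← hj.norm_map]; rfl))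

/-- The continuous extension of a functional in `M` to the completion. -/
noncomputable def dualExt (f : X.Dual) : StrongDual ℝ Z := (hj.exists_dualExt f).choose

theorem dualExt_apply (f : X.Dual) (x : X.carrier) : hj.dualExt f (j x) = (f.toFun x).val :=
  (hj.exists_dualExt f).choose_spec x

theorem exists_dualExt_eq {F : StrongDual ℝ Z} (hF : DefinableReal M fun x => F (j x)) :
    ∃ f : X.Dual, hj.dualExt f = F := by
  choose φ hφ using hF.exists_mreal
  obtain ⟨f, hf⟩ := exists_dual φ (DefinableReal.definableFun (by simpa only [hφ] using hF))
    (fun x y => by simp only [hφ, hj.map_add, _root_.map_add])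
    ⟨‖F‖, fun x => by rw [hφ, ← hj.norm_map]; exact F.le_opNorm _⟩
  exact ⟨f, hj.dual_ext fun x => by rw [hj.dualExt_apply, hf, hφ]⟩

theorem definableReal_norm_dualExt_sub :
    DefinableReal M fun p : X.Dual × X.Dual => ‖hj.dualExt p.1 - hj.dualExt p.2‖ := by
  have h : DefinablePred M fun p : (X.Dual × X.Dual) × RatCode => ∃ x : X.carrier,
      (X.norm x).val ≤ (ratReal M 1).val ∧
        ratVal p.2 < dist (p.1.1.toFun x).val (p.1.2.toFun x).val :=
    .ex (.and (by fun_prop) (DefinableReal.lt (by fun_prop) (by fun_prop)))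
  refine h.congr fun p => hj.lt_norm_iff.trans ?_
  simp [hj.dualExt_apply, ratReal_val, Real.dist_eq]

theorem exists_dualExt_eq_zero : ∃ f : X.Dual, hj.dualExt f = 0 :=
  hj.exists_dualExt_eq (by
    simpa [ratReal_val] using
      (by fun_prop : DefinableReal M fun _ : X.carrier => (ratReal M 0).val))

theorem exists_dualNorm (f : X.Dual) : ∃ r : MReal M, r.val = ‖hj.dualExt f‖ := by
  obtain ⟨o, ho⟩ := hj.exists_dualExt_eq_zero
  simpa only [ho, sub_zero] using hj.definableReal_norm_dualExt_sub.exists_mreal (f, o)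

/-- The closure of the dual of `X` in the dual of the completion. -/
noncomputable def dualClosure : Submodule ℝ (StrongDual ℝ Z) where
  carrier := closure (Set.range hj.dualExt)
  zero_mem' := subset_closure hj.exists_dualExt_eq_zero
  add_mem' hF hG := by
    refine map_mem_closure₂ continuous_add hF hG ?_
    rintro _ ⟨f, rfl⟩ _ ⟨g, rfl⟩
    refine hj.exists_dualExt_eq ?_
    simp only [add_apply, hj.dualExt_apply]
    fun_prop
  smul_mem' c F hF := by
    refine map_mem_closure₂ continuous_smul (denseRange_mreal_val (M := M) c) hF ?_
    rintro _ ⟨r, rfl⟩ _ ⟨f, rfl⟩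
    refine hj.exists_dualExt_eq ?_
    simp only [smul_apply, hj.dualExt_apply, smul_eq_mul, ← f.map_smul]
    fun_prop

theorem isClosed_dualClosure : IsClosed (hj.dualClosure : Set (StrongDual ℝ Z)) :=
  isClosed_closure

/-- The embedding of the dual of `X` in its interpretation. -/
noncomputable def dualEmb (f : X.Dual) : hj.dualClosure := ⟨hj.dualExt f, subset_closure ⟨f, rfl⟩⟩

theorem dist_dualEmb (f g : X.Dual) : dist (hj.dualEmb f) (hj.dualEmb g) =
    ‖hj.dualExt f - hj.dualExt g‖ := by
  rw [Subtype.dist_eq, dist_eq_norm]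
  rfl

theorem denseRange_dualEmb : DenseRange hj.dualEmb := by
  intro F
  rw [closure_subtype, ← Set.range_comp]
  exact F.2

theorem exists_tendsto_dualEmb {s : ℕ → X.Dual} (hs : DefinableFun M s)
    (hcauchy : CauchySeq fun n => hj.dualEmb (s n)) :
    ∃ f, Tendsto (fun n => hj.dualEmb (s n)) atTop (𝓝 (hj.dualEmb f)) := by
  obtain ⟨F, hF⟩ := cauchySeq_tendsto_of_complete
    (uniformContinuous_subtype_val.comp_cauchySeq hcauchy : CauchySeq fun n => hj.dualExt (s n))
  have happly (x : X.carrier) : Tendsto (fun n => ((s n).toFun x).val) atTop (𝓝 (F (j x))) := by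
    simp only [← hj.dualExt_apply]
    exact ((ContinuousLinearMap.apply ℝ ℝ (j x)).continuous.tendsto F).comp hF
  obtain ⟨f, rfl⟩ := hj.exists_dualExt_eq (F := F)
    (.of_tendsto (F := fun p : X.carrier × ℕ => ((s p.2).toFun p.1).val) (by fun_prop) happly)
  exact ⟨f, tendsto_subtype_rng.2 hF⟩

theorem isMetricIn_dualEmb : IsMetricIn M hj.dualEmb where
  denseRange := hj.denseRange_dualEmb
  definable_dist := by
    simpa only [hj.dist_dualEmb] using hj.definableReal_norm_dualExt_sub
  complete _ := hj.exists_tendsto_dualEmb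

theorem supNorm_sub (f g : X.Dual) :
    X.supNorm (fun x => (f.toFun x).val - (g.toFun x).val) =
      dist (hj.dualEmb f) (hj.dualEmb g) := by
  rw [hj.dist_dualEmb, ← hj.supNorm_eq]
  simp only [sub_apply, hj.dualExt_apply]

theorem opens_dualSpace : X.dualSpace.opens = metricOpens M hj.dualEmb := by
  simp only [BanachIn.dualSpace, metricOpens, hj.supNorm_sub, ← code_dual]

theorem interprets_dual : Interprets M X.dualSpace inferInstance hj.dualEmb :=
  have : CompleteSpace hj.dualClosure := hj.isClosed_dualClosure.completeSpace_coe
  interprets_congr (funext fun f => (code_dual f).symm) hj.opens_dualSpace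
    hj.isMetricIn_dualEmb.interprets

end DualCompletion

end IsBanachCompletion

section BourbakiWitt

variable {M : Set ZFSet.{u}} [hM : Fact (IsTransitiveModelZFC M)]
  {A : Type v} [Coded M A] {C : Type w} [Coded M C]

/-- The order of `A` is definable over `M`. -/
class DefinableLE (M : Set ZFSet.{u}) [Fact (IsTransitiveModelZFC M)] (A : Type v) [Coded M A]
    [LE A] : Prop where
  definablePred_le : DefinablePred M fun p : A × A => p.1 ≤ p.2

variable [PartialOrder A]

/-- `T` is closed under `s` and under those suprema of its subsets in `M` which exist in `A`. -/
structure IsTower (s : A → A) (T : SetIn M A) : Prop where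
  map_mem : ∀ a ∈ T, s a ∈ T
  lub_mem : ∀ S : SetIn M A, (∀ a ∈ S, a ∈ T) → ∀ u, IsLUB S.carrier u → u ∈ T

variable [DefinableLE M A]

@[fun_prop]
theorem DefinablePred.le {f g : C → A} (hf : DefinableFun M f) (hg : DefinableFun M g) :
    DefinablePred M fun c => f c ≤ g c :=
  DefinableLE.definablePred_le.comp (hf.prodMk hg)

@[fun_prop]
theorem DefinablePred.lt {f g : C → A} (hf : DefinableFun M f) (hg : DefinableFun M g) :
    DefinablePred M fun c => f c < g c :=
  ((DefinablePred.le hf hg).and (DefinablePred.le hg hf).not).congr fun _ => lt_iff_le_not_ge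

variable {s : A → A}

theorem DefinablePred.isTower (hs : DefinableFun M s) :
    DefinablePred M fun T : SetIn M A => IsTower s T := by
  have h : DefinablePred M fun T : SetIn M A => (∀ a, a ∈ T → s a ∈ T) ∧
      ∀ S : SetIn M A, (∀ a, a ∈ S → a ∈ T) → ∀ u,
        (∀ a, a ∈ S → a ≤ u) ∧ (∀ v, (∀ a, a ∈ S → a ≤ v) → u ≤ v) → u ∈ T := by fun_prop
  exact h.congr fun T => ⟨fun h => ⟨h.1, h.2⟩, fun h => ⟨h.1, h.2⟩⟩

variable [IsSmall M A]

/-- The least tower of `s`, that is the transfinite iteration of `s` from the bottom of `A`,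
defined without ordinals as an intersection. -/
def leastTower (hs : DefinableFun M s) : SetIn M A :=
  .sep (fun a => ∀ T : SetIn M A, IsTower s T → a ∈ T)
    (.all (.imp ((DefinablePred.isTower hs).comp (f := Prod.snd) (by fun_prop)) (by fun_prop)))

theorem isTower_leastTower (hs : DefinableFun M s) : IsTower s (leastTower hs) where
  map_mem a ha T hT := hT.map_mem a (ha T hT)
  lub_mem S hS u hu T hT := hT.lub_mem S (fun a ha => hS a ha T hT) u hu

theorem leastTower_induction (hs : DefinableFun M s) {P : A → Prop} (hP : DefinablePred M P)
    (hmap : ∀ a ∈ leastTower hs, P a → P (s a))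
    (hlub : ∀ S : SetIn M A, (∀ a ∈ S, a ∈ leastTower hs ∧ P a) →
      ∀ u, IsLUB S.carrier u → P u) :
    ∀ a ∈ leastTower hs, P a := by
  have hT : IsTower s (SetIn.sep (fun a => a ∈ leastTower hs ∧ P a) (.and (by fun_prop) hP)) :=
    { map_mem := fun a ha => ⟨(isTower_leastTower hs).map_mem a ha.1, hmap a ha.1 ha.2⟩
      lub_mem := fun S hS u hu =>
        ⟨(isTower_leastTower hs).lub_mem S (fun a ha => (hS a ha).1) u hu, hlub S hS u hu⟩ }
  exact fun a ha => (ha _ hT).2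

theorem le_or_map_le_of_mem_leastTower (hs : DefinableFun M s) (hle : ∀ a, a ≤ s a) {c : A}
    (hc : ∀ x ∈ leastTower hs, x < c → s x ≤ c) : ∀ x ∈ leastTower hs, x ≤ c ∨ s c ≤ x := by
  refine leastTower_induction hs (by fun_prop) (fun x hx hxc => ?_) fun S hS u hu => ?_
  · rcases hxc with hxc | hcx
    · rcases hxc.eq_or_lt with rfl | hlt
      · exact Or.inr le_rfl
      · exact Or.inl (hc x hx hlt)
    · exact Or.inr (hcx.trans (hle x))
  · by_cases hall : ∀ a ∈ S, a ≤ c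
    · exact Or.inl (hu.2 hall)
    · push Not at hall
      obtain ⟨a, ha, hac⟩ := hall
      exact Or.inr (((hS a ha).2.resolve_left hac).trans (hu.1 ha))

theorem map_le_of_lt_of_mem_leastTower (hs : DefinableFun M s) (hle : ∀ a, a ≤ s a) :
    ∀ c ∈ leastTower hs, ∀ x ∈ leastTower hs, x < c → s x ≤ c := by
  refine leastTower_induction hs (by fun_prop) (fun c _ hc x hx hxc => ?_)
    fun S hS u hu x hx hxu => ?_
  · rcases le_or_map_le_of_mem_leastTower hs hle hc x hx with hle' | hcx
    · rcases hle'.eq_or_lt with rfl | hlt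
      · exact le_rfl
      · exact (hc x hx hlt).trans (hle c)
    · exact absurd hcx hxc.not_ge
  · obtain ⟨c, hcS, hcx⟩ : ∃ c ∈ S, ¬ c ≤ x := by
      by_contra! hall
      exact hxu.not_ge (hu.2 hall)
    rcases le_or_map_le_of_mem_leastTower hs hle (hS c hcS).2 x hx with hxc | hcx'
    · have hlt : x < c := hxc.lt_of_ne fun h => hcx h.ge
      exact ((hS c hcS).2 x hx hlt).trans (hu.1 hcS)
    · exact absurd ((hle c).trans hcx') hcx

theorem isChain_leastTower (hs : DefinableFun M s) (hle : ∀ a, a ≤ s a) :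
    IsChain (· ≤ ·) (leastTower hs).carrier := by
  intro x hx y hy _
  rcases le_or_map_le_of_mem_leastTower hs hle
    (map_le_of_lt_of_mem_leastTower hs hle y hy) x hx with hxy | hyx
  · exact Or.inl hxy
  · exact Or.inr ((hle y).trans hyx)

theorem exists_map_eq_of_chains (hs : DefinableFun M s) (hle : ∀ a, a ≤ s a)
    (chains : ∀ S : SetIn M A, IsChain (· ≤ ·) S.carrier → ∃ u, IsLUB S.carrier u) :
    ∃ a, s a = a := by
  obtain ⟨u, hu⟩ := chains _ (isChain_leastTower hs hle)
  have hmem : u ∈ leastTower hs := (isTower_leastTower hs).lub_mem _ (fun _ h => h) u hu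
  exact ⟨u, le_antisymm (hu.1 ((isTower_leastTower hs).map_mem u hmem)) (hle u)⟩

theorem exists_isMax_of_chains
    (chains : ∀ S : SetIn M A, IsChain (· ≤ ·) S.carrier → ∃ u, IsLUB S.carrier u) :
    ∃ m : A, IsMax m := by
  by_contra! hmax
  obtain ⟨s, hs, hlt⟩ := exists_choice (M := M) (R := fun a b : A => a < b) (by fun_prop)
    fun a => not_isMax_iff.1 (hmax a)
  obtain ⟨a, ha⟩ := exists_map_eq_of_chains hs (fun a => (hlt a).le) chains
  exact (hlt a).ne' ha

end BourbakiWitt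

section Elements

variable {M : Set ZFSet.{u}} [hM : Fact (IsTransitiveModelZFC M)]
  {A : Type v} [Coded M A] {C : Type w} [Coded M C]

theorem DefinablePred.exists_eq_val (S : SetIn M A) :
    DefinablePred M fun a : A => ∃ b : {a // a ∈ S}, a = b.1 := by
  have h : DefinablePred M fun a : A => a ∈ S := by fun_prop
  exact h.congr fun a => ⟨fun ⟨b, hb⟩ => hb ▸ b.2, fun h => ⟨⟨a, h⟩, rfl⟩⟩

noncomputable instance instCodedElements (S : SetIn M A) : Coded M {a // a ∈ S} :=
  Coded.ofInjective Subtype.val Subtype.val_injective (DefinablePred.exists_eq_val S)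

instance instIsSmallElements [IsSmall M A] (S : SetIn M A) : IsSmall M {a // a ∈ S} :=
  IsSmall.ofInjective Subtype.val Subtype.val_injective (DefinablePred.exists_eq_val S)

@[fun_prop]
theorem DefinableFun.elementVal {S : SetIn M A} {f : C → {a // a ∈ S}} (hf : DefinableFun M f) :
    DefinableFun M fun c => (f c).1 := hf

instance : PartialOrder (SetIn M A) := .lift SetIn.carrier SetIn.carrier_injective

instance instDefinableLESetInElements (F : SetIn M (SetIn M A)) :
    DefinableLE M {K // K ∈ F} where
  definablePred_le := by
    have h : DefinablePred M fun p : {K // K ∈ F} × {K // K ∈ F} =>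
      ∀ a, a ∈ p.1.1 → a ∈ p.2.1 := by fun_prop
    exact h

end Elements

section OrderCone

variable {M : Set ZFSet.{u}} [hM : Fact (IsTransitiveModelZFC M)] {X : BanachIn M}

/-- `P` is the set of nonnegative elements of a partial order of `X` which makes `X` an ordered
vector space over `ℚ`. -/
structure IsOrderCone (P : SetIn M X.carrier) : Prop where
  zero_mem : 0 ∈ P
  add_mem : ∀ y z, y ∈ P → z ∈ P → y + z ∈ P
  mem_of_nsmul_mem : ∀ (n : ℕ) y, (n + 1) • y ∈ P → y ∈ P
  eq_zero : ∀ y, y ∈ P → -y ∈ P → y = 0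

theorem IsOrderCone.nsmul_mem {P : SetIn M X.carrier} (hP : IsOrderCone P) {y : X.carrier}
    (hy : y ∈ P) (n : ℕ) : n • y ∈ P := by
  induction n with
  | zero => simpa using hP.zero_mem
  | succ n ih => simpa only [succ_nsmul] using hP.add_mem _ _ ih hy

theorem DefinablePred.isOrderCone :
    DefinablePred M fun P : SetIn M X.carrier => IsOrderCone P := by
  have h : DefinablePred M fun P : SetIn M X.carrier => (0 : X.carrier) ∈ P ∧
      (∀ y z, y ∈ P → z ∈ P → y + z ∈ P) ∧ (∀ (n : ℕ) y, (n + 1) • y ∈ P → y ∈ P) ∧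
      ∀ y, y ∈ P → -y ∈ P → y = 0 := by fun_prop
  exact h.congr fun P => ⟨fun ⟨h₁, h₂, h₃, h₄⟩ => ⟨h₁, h₂, h₃, h₄⟩,
    fun ⟨h₁, h₂, h₃, h₄⟩ => ⟨h₁, h₂, h₃, h₄⟩⟩

theorem isOrderCone_of_isChain {S : SetIn M (SetIn M X.carrier)} (hne : ∃ P, P ∈ S)
    (hS : ∀ P ∈ S, IsOrderCone P) (hchain : IsChain (· ≤ ·) S.carrier) {U : SetIn M X.carrier}
    (hU : ∀ y, y ∈ U ↔ ∃ P ∈ S, y ∈ P) : IsOrderCone U := by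
  have hpair : ∀ y z, y ∈ U → z ∈ U → ∃ P ∈ S, y ∈ P ∧ z ∈ P := by
    intro y z hy hz
    obtain ⟨P, hP, hyP⟩ := (hU y).1 hy
    obtain ⟨Q, hQ, hzQ⟩ := (hU z).1 hz
    rcases hchain.total hP hQ with hle | hle
    · exact ⟨Q, hQ, hle hyP, hzQ⟩
    · exact ⟨P, hP, hyP, hle hzQ⟩
  refine ⟨?_, fun y z hy hz => ?_, fun n y hy => ?_, fun y hy hy' => ?_⟩
  · obtain ⟨P, hP⟩ := hne
    exact (hU 0).2 ⟨P, hP, (hS P hP).zero_mem⟩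
  · obtain ⟨P, hP, hyP, hzP⟩ := hpair y z hy hz
    exact (hU _).2 ⟨P, hP, (hS P hP).add_mem y z hyP hzP⟩
  · obtain ⟨P, hP, hyP⟩ := (hU _).1 hy
    exact (hU y).2 ⟨P, hP, (hS P hP).mem_of_nsmul_mem n y hyP⟩
  · obtain ⟨P, hP, hyP, hyP'⟩ := hpair y (-y) hy hy'
    exact (hS P hP).eq_zero y hyP hyP'

theorem exists_isLUB_of_isChain_orderCone {B : SetIn M X.carrier} (hB : IsOrderCone B)
    {F : SetIn M (SetIn M X.carrier)} (hF : ∀ P, P ∈ F ↔ IsOrderCone P ∧ B ≤ P)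
    {S : SetIn M {P // P ∈ F}} (hchain : IsChain (· ≤ ·) S.carrier) :
    ∃ U, IsLUB S.carrier U := by
  -- `B` is added to the chain in order to treat the empty chain at the same time.
  let S' : SetIn M (SetIn M X.carrier) := .sep (fun P => P = B ∨ ∃ Q ∈ S, P = Q.1) (by fun_prop)
  let U : SetIn M X.carrier := .sep (fun y => ∃ P ∈ S', y ∈ P) (by fun_prop)
  have hBS' : B ∈ S' := Or.inl rfl
  have hBU : B ≤ U := fun y hy => ⟨B, hBS', hy⟩
  have hS' : ∀ P ∈ S', IsOrderCone P := by
    rintro P (rfl | ⟨Q, -, rfl⟩)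
    · exact hB
    · exact ((hF _).1 Q.2).1
  have hchain' : IsChain (· ≤ ·) S'.carrier := by
    refine IsChain.mono (t := insert B (Subtype.val '' S.carrier)) ?_ ?_
    · rintro P (rfl | ⟨Q, hQ, rfl⟩)
      · exact Or.inl rfl
      · exact Or.inr ⟨Q, hQ, rfl⟩
    · refine (hchain.image (OrderEmbedding.subtype (· ∈ F))).insert ?_
      rintro _ ⟨Q, -, rfl⟩ _
      exact Or.inl ((hF _).1 Q.2).2
  refine ⟨⟨U, (hF U).2 ⟨isOrderCone_of_isChain ⟨B, hBS'⟩ hS' hchain' fun _ => Iff.rfl, hBU⟩⟩,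
    fun Q hQ y hy => ⟨Q.1, Or.inr ⟨Q, hQ, rfl⟩, hy⟩, fun V hV y => ?_⟩
  rintro ⟨P, rfl | ⟨Q, hQ, rfl⟩, hy⟩
  · exact ((hF _).1 V.2).2 hy
  · exact hV hQ hy

/-- The cone spanned by `P` and `z`. -/
noncomputable def adjoinVector (P : SetIn M X.carrier) (z : X.carrier) : SetIn M X.carrier :=
  .sep (fun y => ∃ n m : ℕ, (n + 1) • y - m • z ∈ P) (by fun_prop)

theorem le_adjoinVector (P : SetIn M X.carrier) (z : X.carrier) : P ≤ adjoinVector P z :=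
  fun y hy => ⟨0, 0, by rwa [zero_add, one_smul, zero_smul, sub_zero]⟩

theorem IsOrderCone.mem_adjoinVector {P : SetIn M X.carrier} (hP : IsOrderCone P)
    (z : X.carrier) : z ∈ adjoinVector P z :=
  ⟨0, 1, by simpa using hP.zero_mem⟩

theorem IsOrderCone.add_sub_nsmul_mem {P : SetIn M X.carrier} (hP : IsOrderCone P)
    {y y' z : X.carrier} {n n' m m' : ℕ} (h : (n + 1) • y - m • z ∈ P)
    (h' : (n' + 1) • y' - m' • z ∈ P) :
    (n * n' + n + n' + 1) • (y + y') - ((n' + 1) * m + (n + 1) * m') • z ∈ P := by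
  have hsum := hP.add_mem _ _ (hP.nsmul_mem h (n' + 1)) (hP.nsmul_mem h' (n + 1))
  convert hsum using 1
  module

theorem isOrderCone_adjoinVector {P : SetIn M X.carrier} (hP : IsOrderCone P) {z : X.carrier}
    (hz : -z ∉ P) : IsOrderCone (adjoinVector P z) where
  zero_mem := le_adjoinVector P z hP.zero_mem
  add_mem := by
    rintro y y' ⟨n, m, h⟩ ⟨n', m', h'⟩
    exact ⟨_, _, hP.add_sub_nsmul_mem h h'⟩
  mem_of_nsmul_mem := by
    rintro l y ⟨n, m, h⟩
    refine ⟨n * l + n + l, m, ?_⟩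
    rwa [show n * l + n + l + 1 = (n + 1) * (l + 1) by ring, mul_smul]
  eq_zero := by
    rintro y ⟨n, m, h⟩ ⟨n', m', h'⟩
    have hsum := hP.add_sub_nsmul_mem h h'
    rw [add_neg_cancel, smul_zero, zero_sub, ← smul_neg] at hsum
    rcases Nat.eq_zero_or_eq_succ_pred ((n' + 1) * m + (n + 1) * m') with hzero | hsucc
    · obtain ⟨rfl, rfl⟩ : m = 0 ∧ m' = 0 := by simpa using hzero
      rw [zero_smul, sub_zero] at h h'
      exact hP.eq_zero y (hP.mem_of_nsmul_mem n y h) (hP.mem_of_nsmul_mem n' _ h')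
    · rw [hsucc] at hsum
      exact absurd (hP.mem_of_nsmul_mem _ _ hsum) hz

theorem IsOrderCone.exists_total {B : SetIn M X.carrier} (hB : IsOrderCone B) :
    ∃ P, IsOrderCone P ∧ B ≤ P ∧ ∀ z, z ∈ P ∨ -z ∈ P := by
  let F : SetIn M (SetIn M X.carrier) :=
    .sep (fun P => IsOrderCone P ∧ ∀ y, y ∈ B → y ∈ P) (DefinablePred.isOrderCone.and (by fun_prop))
  obtain ⟨⟨P, hP, hBP⟩, hmax⟩ := exists_isMax_of_chains (A := {P // P ∈ F}) fun _ =>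
    exists_isLUB_of_isChain_orderCone hB fun _ => Iff.rfl
  refine ⟨P, hP, hBP, fun z => or_iff_not_imp_right.2 fun hz => ?_⟩
  have hle := le_adjoinVector P z
  exact hmax (b := ⟨adjoinVector P z, isOrderCone_adjoinVector hP hz, hle.trans' hBP⟩) hle
    (hP.mem_adjoinVector z)

end OrderCone

section ConeSeparation

variable {E : Type w} [NormedAddCommGroup E] [NormedSpace ℝ E] {S : AddSubmonoid E}

theorem smul_mem_closure_of_inv_smul_mem (hS : ∀ (n : ℕ), ∀ y ∈ S, (n : ℝ)⁻¹ • y ∈ S) {c : ℝ}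
    (hc : 0 ≤ c) {z : E} (hz : z ∈ closure (S : Set E)) : c • z ∈ closure (S : Set E) := by
  refine closure_minimal (fun y hy => ?_)
    (isClosed_closure.preimage (continuous_const_smul c)) hz
  have hlim : Tendsto (fun n : ℕ => (⌊c * n⌋₊ / n : ℝ) • y) atTop (𝓝 (c • y)) :=
    ((tendsto_nat_floor_mul_div_atTop hc).comp tendsto_natCast_atTop_atTop).smul_const y
  refine isClosed_closure.mem_of_tendsto hlim (.of_forall fun n => subset_closure ?_)
  rw [div_eq_mul_inv, mul_smul, Nat.cast_smul_eq_nsmul]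
  exact nsmul_mem (hS n y hy) _

theorem exists_strongDual_nonneg_neg (hS : ∀ (n : ℕ), ∀ y ∈ S, (n : ℝ)⁻¹ • y ∈ S) {z : E}
    (hz : z ∉ closure (S : Set E)) : ∃ F : StrongDual ℝ E, (∀ y ∈ S, 0 ≤ F y) ∧ F z < 0 := by
  let K : ProperCone ℝ E :=
    { S.topologicalClosure with
      smul_mem' c _ hy := smul_mem_closure_of_inv_smul_mem hS c.2 hy
      isClosed' := isClosed_closure }
  obtain ⟨F, hF, hFz⟩ := K.hyperplane_separation_point hz
  exact ⟨F, fun y hy => hF y (subset_closure hy), hFz⟩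

end ConeSeparation

namespace IsBanachCompletion

section OrderCone

variable {M : Set ZFSet.{u}} [hM : Fact (IsTransitiveModelZFC M)] {X : BanachIn M}
  {Z : Type w} [NormedAddCommGroup Z] [NormedSpace ℝ Z] {j : X.carrier → Z}
  (hj : IsBanachCompletion X j)
include hj

theorem exists_map_eq_inv_smul (n : ℕ) (y : X.carrier) : ∃ z, j z = (n : ℝ)⁻¹ • j y :=
  ⟨X.smul (ratReal M (n : ℚ)⁻¹) y, by rw [hj.map_smul, ratReal_val, Rat.cast_inv, Rat.cast_natCast]⟩

theorem exists_strongDual_nonneg_on_orderCone {P : SetIn M X.carrier} (hP : IsOrderCone P)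
    {z : Z} (hz : z ∉ closure (j '' P.carrier)) :
    ∃ F : StrongDual ℝ Z, (∀ y ∈ P, 0 ≤ F (j y)) ∧ F z < 0 := by
  let S : AddSubmonoid Z :=
    { carrier := j '' P.carrier
      zero_mem' := ⟨0, hP.zero_mem, hj.map_zero⟩
      add_mem' := by
        rintro _ _ ⟨y, hy, rfl⟩ ⟨y', hy', rfl⟩
        exact ⟨y + y', hP.add_mem y y' hy hy', hj.map_add y y'⟩ }
  have hS : ∀ (n : ℕ), ∀ y ∈ S, (n : ℝ)⁻¹ • y ∈ S := by
    rintro (_ | n) _ ⟨y, hy, rfl⟩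
    · simp
    · obtain ⟨w, hw⟩ := hj.exists_map_eq_inv_smul (n + 1) y
      have : (n + 1) • w = y := hj.injective <| by
        rw [hj.map_nsmul, hw, ← Nat.cast_smul_eq_nsmul ℝ, smul_inv_smul₀ (by positivity)]
      exact ⟨w, hP.mem_of_nsmul_mem n w (this ▸ hy), hw⟩
  obtain ⟨F, hF, hFz⟩ := exists_strongDual_nonneg_neg hS hz
  exact ⟨F, fun y hy => hF _ ⟨y, hy, rfl⟩, hFz⟩

theorem definableReal_of_total_orderCone {P : SetIn M X.carrier}
    (htotal : ∀ y, y ∈ P ∨ -y ∈ P) {F : StrongDual ℝ Z} (hF : ∀ y ∈ P, 0 ≤ F (j y))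
    {x : X.carrier} (hx : F (j x) = 1) : DefinableReal M fun y => F (j y) := by
  -- `e q y / (q.2.2 + 1)` is the vector `y - ratVal q • x`.
  let e (q : RatCode) (y : X.carrier) : X.carrier := (q.2.2 + 1) • y + q.2.1 • x - q.1 • x
  have he (q : RatCode) (y : X.carrier) : F (j (e q y)) = (q.2.2 + 1) * (F (j y) - ratVal q) := by
    simp only [e, hj.map_sub, hj.map_add, hj.map_nsmul, _root_.map_sub, _root_.map_add,
      _root_.map_nsmul, hx, ratVal, nsmul_eq_mul]
    push_cast
    field_simp
    ring
  have h : DefinablePred M fun p : X.carrier × RatCode =>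
    ∃ q, ratVal p.2 < ratVal q ∧ e q p.1 ∈ P := by fun_prop
  refine h.congr fun ⟨y, p⟩ => ⟨fun hlt => ?_, fun ⟨q, hpq, hq⟩ => ?_⟩
  · obtain ⟨q, hpq, hqF⟩ := exists_ratVal_btwn hlt
    have hpos : 0 < F (j (e q y)) := by
      rw [he]
      have := sub_pos.2 hqF
      positivity
    refine ⟨q, hpq, (htotal _).resolve_right fun hneg => ?_⟩
    have := hF _ hneg
    rw [hj.map_neg, _root_.map_neg] at this
    linarith
  · have := hF _ hq
    rw [he] at this
    exact hpq.trans_le (sub_nonneg.1 (nonneg_of_mul_nonneg_right this (by positivity)))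

end OrderCone

end IsBanachCompletion

section SeparatingFunctionals

variable {M : Set ZFSet.{u}} [hM : Fact (IsTransitiveModelZFC M)] {X : BanachIn M}

/-- The cone over the ball of radius `‖x‖ / 2` around `x`, in `M`. -/
noncomputable def ballCone (x : X.carrier) : SetIn M X.carrier :=
  .sep (fun y => ∃ n m : ℕ,
    (X.norm (2 • ((n + 1) • y - m • x))).val ≤ (X.norm (m • x)).val) (by fun_prop)

namespace IsBanachCompletion

variable {Z : Type w} [NormedAddCommGroup Z] [NormedSpace ℝ Z] {j : X.carrier → Z}
  (hj : IsBanachCompletion X j)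
include hj

theorem mem_ballCone_iff {x y : X.carrier} : y ∈ ballCone x ↔
    ∃ q : ℚ≥0, 2 * ‖j y - (q : ℝ) • j x‖ ≤ q * ‖j x‖ := by
  have key (n m : ℕ) : (X.norm (2 • ((n + 1) • y - m • x))).val ≤ (X.norm (m • x)).val ↔
      2 * ‖j y - (m / (n + 1) : ℝ) • j x‖ ≤ m / (n + 1) * ‖j x‖ := by
    have hn : (0 : ℝ) < n + 1 := by positivity
    have hsub : j ((n + 1) • y - m • x) = (n + 1 : ℝ) • (j y - (m / (n + 1) : ℝ) • j x) := by
      rw [smul_sub, smul_smul, mul_div_cancel₀ _ hn.ne', hj.map_sub, hj.map_nsmul, hj.map_nsmul,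
        ← Nat.cast_smul_eq_nsmul ℝ, ← Nat.cast_smul_eq_nsmul ℝ, Nat.cast_succ]
    rw [← hj.norm_map, ← hj.norm_map, hj.map_nsmul, hj.map_nsmul, hsub, RCLike.norm_nsmul ℝ,
      RCLike.norm_nsmul ℝ, norm_smul, Real.norm_of_nonneg hn.le, div_mul_eq_mul_div, le_div_iff₀ hn]
    simp only [nsmul_eq_mul, Nat.cast_ofNat]
    rw [mul_left_comm, mul_comm]
  refine ⟨fun ⟨n, m, h⟩ => ⟨m / (n + 1), ?_⟩, fun ⟨q, hq⟩ => ⟨q.den - 1, q.num, ?_⟩⟩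
  · push_cast
    exact (key n m).1 h
  · rw [key, Nat.cast_sub q.den_pos, Nat.cast_one, sub_add_cancel, ← NNRat.cast_def]
    exact hq

theorem mem_ballCone {x y : X.carrier} (h : 2 * ‖j y - j x‖ ≤ ‖j x‖) : y ∈ ballCone x :=
  hj.mem_ballCone_iff.2 ⟨1, by simpa using h⟩

theorem isOrderCone_ballCone {x : X.carrier} (hx : x ≠ 0) : IsOrderCone (ballCone x) where
  zero_mem := hj.mem_ballCone_iff.2 ⟨0, by simp [hj.map_zero]⟩
  add_mem y y' hy hy' := by
    obtain ⟨q, hq⟩ := hj.mem_ballCone_iff.1 hy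
    obtain ⟨q', hq'⟩ := hj.mem_ballCone_iff.1 hy'
    refine hj.mem_ballCone_iff.2 ⟨q + q', ?_⟩
    have := norm_add_le (j y - (q : ℝ) • j x) (j y' - (q' : ℝ) • j x)
    rw [← add_sub_add_comm, ← add_smul] at this
    rw [hj.map_add, NNRat.cast_add]
    linarith
  mem_of_nsmul_mem n y hy := by
    obtain ⟨q, hq⟩ := hj.mem_ballCone_iff.1 hy
    refine hj.mem_ballCone_iff.2 ⟨q / (n + 1), ?_⟩
    have hn : (0 : ℝ) < n + 1 := by positivity
    have hsub : j ((n + 1) • y) - (q : ℝ) • j x =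
        (n + 1 : ℝ) • (j y - (q / (n + 1) : ℝ) • j x) := by
      rw [smul_sub, smul_smul, mul_div_cancel₀ _ hn.ne', hj.map_nsmul,
        ← Nat.cast_smul_eq_nsmul ℝ, Nat.cast_succ]
    rw [hsub, norm_smul, Real.norm_of_nonneg hn.le] at hq
    push_cast
    rw [div_mul_eq_mul_div, le_div_iff₀ hn]
    linarith
  eq_zero y hy hy' := by
    obtain ⟨q, hq⟩ := hj.mem_ballCone_iff.1 hy
    obtain ⟨q', hq'⟩ := hj.mem_ballCone_iff.1 hy'
    have hx' : 0 < ‖j x‖ := hj.norm_apply_pos hx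
    have hnorm := norm_add_le (j y - (q : ℝ) • j x) (j (-y) - (q' : ℝ) • j x)
    rw [← add_sub_add_comm, ← hj.map_add, add_neg_cancel, hj.map_zero, zero_sub, norm_neg,
      ← add_smul, norm_smul, Real.norm_of_nonneg (by positivity)] at hnorm
    have hsum : (q + q' : ℝ) ≤ 0 := by nlinarith
    have hq0 : (q : ℝ) = 0 := by linarith [q.cast_nonneg (α := ℝ), q'.cast_nonneg (α := ℝ)]
    rw [hq0, zero_smul, sub_zero, zero_mul] at hq
    refine hj.injective (hj.map_zero ▸ norm_le_zero_iff.1 (by linarith))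

theorem exists_dualExt_nonneg_on_ballCone {x : X.carrier} (hx : x ≠ 0) :
    ∃ f : X.Dual, hj.dualExt f (j x) = 1 ∧ ∀ y ∈ ballCone x, 0 ≤ hj.dualExt f (j y) := by
  obtain ⟨P, hP, hle, htotal⟩ := (hj.isOrderCone_ballCone hx).exists_total
  have hnx : 0 < ‖j x‖ := hj.norm_apply_pos hx
  have hnotMem : -j x ∉ closure (j '' P.carrier) := by
    rw [Metric.mem_closure_iff]
    push Not
    refine ⟨‖j x‖ / 2, half_pos hnx, ?_⟩
    rintro _ ⟨y, hy, rfl⟩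
    by_contra! hlt
    have hneg : -y ∈ ballCone x := hj.mem_ballCone (by
      rw [hj.map_neg, ← dist_eq_norm, ← dist_neg_neg, neg_neg, dist_comm]
      linarith)
    have hy0 := hP.eq_zero y hy (hle hneg)
    rw [hy0, hj.map_zero, dist_zero_right, norm_neg] at hlt
    linarith
  obtain ⟨G, hG, hGx⟩ := hj.exists_strongDual_nonneg_on_orderCone hP hnotMem
  rw [_root_.map_neg, neg_lt_zero] at hGx
  let F : StrongDual ℝ Z := (G (j x))⁻¹ • G
  have hF : ∀ y ∈ P, 0 ≤ F (j y) := fun y hy => mul_nonneg (inv_nonneg.2 hGx.le) (hG y hy)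
  have hFx : F (j x) = 1 := inv_mul_cancel₀ hGx.ne'
  obtain ⟨f, hf⟩ := hj.exists_dualExt_eq (hj.definableReal_of_total_orderCone htotal hF hFx)
  exact ⟨f, hf ▸ hFx, fun y hy => hf ▸ hF y (hle hy)⟩

theorem exists_dualExt_ne_zero {z : Z} (hz : z ≠ 0) : ∃ f : X.Dual, hj.dualExt f z ≠ 0 := by
  obtain ⟨x, hx⟩ := hj.denseRange.exists_dist_lt z (ε := ‖z‖ / 5) (by positivity)
  rw [dist_eq_norm] at hx
  have hzx := norm_sub_norm_le z (j x)
  have hx0 : x ≠ 0 := by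
    rintro rfl
    rw [hj.map_zero, norm_zero] at hzx
    rw [hj.map_zero, sub_zero] at hx
    linarith [norm_nonneg z]
  obtain ⟨f, hfx, hf⟩ := hj.exists_dualExt_nonneg_on_ballCone hx0
  have hball : ∀ w ∈ Metric.ball (j x) (‖j x‖ / 2), 0 ≤ hj.dualExt f w := by
    intro w hw
    refine closure_minimal ?_ (isClosed_le continuous_const (hj.dualExt f).continuous)
      (hj.denseRange.open_subset_closure_inter Metric.isOpen_ball hw)
    rintro _ ⟨hy, y, rfl⟩
    rw [mem_ball_iff_norm] at hy
    exact hf y (hj.mem_ballCone (by linarith))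
  have hmem : j x + (2 : ℝ) • (z - j x) ∈ Metric.ball (j x) (‖j x‖ / 2) := by
    rw [mem_ball_iff_norm, add_sub_cancel_left, norm_smul, Real.norm_two]
    linarith
  have := hball _ hmem
  rw [_root_.map_add, _root_.map_smul, _root_.map_sub, hfx, smul_eq_mul] at this
  exact ⟨f, fun h => by linarith⟩

end IsBanachCompletion

end SeparatingFunctionals

section Reflexive

variable {Z : Type w} [NormedAddCommGroup Z] [NormedSpace ℝ Z]

theorem opNorm_le_of_forall_apply_le {H : StrongDual ℝ Z} {c : ℝ}
    (hle : ∀ y, ‖y‖ ≤ 1 → H y ≤ c) : ‖H‖ ≤ c := by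
  have hc : 0 ≤ c := by simpa using hle 0 (by simp)
  refine H.opNorm_le_of_unit_norm hc fun y hy => ?_
  have hneg := hle (-y) (by rw [norm_neg, hy])
  rw [map_neg] at hneg
  exact abs_le.2 ⟨by linarith, hle y hy.le⟩

theorem apply_comp_pi {ι : Type*} [Finite ι] (G : StrongDual ℝ (StrongDual ℝ Z))
    (f : StrongDual ℝ (ι → ℝ)) (F : ι → StrongDual ℝ Z) :
    G (f.comp (ContinuousLinearMap.pi F)) = f fun i => G (F i) := by
  have := Fintype.ofFinite ι
  classical
  have hf (a : ι → ℝ) : f a = ∑ i, f (Pi.single i 1) • a i := by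
    conv_lhs => rw [pi_eq_sum_univ' a, map_sum]
    exact Finset.sum_congr rfl fun i _ => (map_smul f (a i) _).trans (mul_comm _ _)
  have hcomp : f.comp (ContinuousLinearMap.pi F) = ∑ i, f (Pi.single i 1) • F i := by
    ext y
    simpa using hf fun i => F i y
  rw [hcomp, hf, map_sum]
  simp only [map_smul]

/-- Helly's lemma. -/
theorem mem_closure_image_closedBall {ι : Type*} [Finite ι]
    {G : StrongDual ℝ (StrongDual ℝ Z)} (hG : ‖G‖ ≤ 1) (F : ι → StrongDual ℝ Z) :
    (fun i => G (F i)) ∈ closure ((fun y i => F i y) '' Metric.closedBall (0 : Z) 1) := by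
  have := Fintype.ofFinite ι
  by_contra hmem
  let T : Z →L[ℝ] ι → ℝ := ContinuousLinearMap.pi F
  have hconvex : Convex ℝ (closure (T '' Metric.closedBall (0 : Z) 1)) :=
    ((convex_closedBall 0 1).linear_image T.toLinearMap).closure
  obtain ⟨f, c, hf, hc⟩ := geometric_hahn_banach_closed_point hconvex isClosed_closure hmem
  have hnorm : ‖f.comp T‖ ≤ c := opNorm_le_of_forall_apply_le fun y hy =>
    (hf _ (subset_closure ⟨y, mem_closedBall_zero_iff.2 hy, rfl⟩)).le
  have hle : G (f.comp T) ≤ ‖f.comp T‖ :=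
    (le_abs_self _).trans (G.le_of_opNorm_le_of_le hG le_rfl |>.trans_eq (one_mul _))
  rw [← apply_comp_pi] at hc
  exact (hle.trans hnorm).not_gt hc

/-- Goldstine's theorem. -/
theorem mem_closure_image_eval {G : StrongDual ℝ (StrongDual ℝ Z)} (hG : ‖G‖ ≤ 1) :
    (fun F => G F) ∈
      closure ((fun (y : Z) (F : StrongDual ℝ Z) => F y) '' Metric.closedBall 0 1) := by
  rw [mem_closure_iff_nhds_basis (nhds_pi (A := fun _ : StrongDual ℝ Z => ℝ) ▸
    hasBasis_pi fun F => Metric.nhds_basis_ball)]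
  rintro ⟨I, r⟩ ⟨hI, hr⟩
  have := hI.to_subtype
  obtain ⟨_, hy, y, hyball, rfl⟩ := mem_closure_iff.1
    (mem_closure_image_closedBall hG fun F : I => (F : StrongDual ℝ Z))
    (Set.univ.pi fun F : I => Metric.ball (G F) (r F))
    (isOpen_set_pi Set.finite_univ fun _ _ => Metric.isOpen_ball)
    fun F _ => Metric.mem_ball_self (hr F F.2)
  exact ⟨_, ⟨y, hyball, rfl⟩, fun F hF => hy ⟨F, hF⟩ trivial⟩

theorem exists_filter_tendsto_apply {G : StrongDual ℝ (StrongDual ℝ Z)} (hG : ‖G‖ ≤ 1) :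
    ∃ l : Filter Z, l.NeBot ∧ (∀ᶠ y in l, ‖y‖ ≤ 1) ∧
      ∀ F : StrongDual ℝ Z, Tendsto F l (𝓝 (G F)) := by
  let T : Z → StrongDual ℝ Z → ℝ := fun y F => F y
  refine ⟨comap T (𝓝 fun F => G F) ⊓ 𝓟 (Metric.closedBall 0 1), ?_, ?_, fun F => ?_⟩
  · refine inf_principal_neBot_iff.2 fun s hs => ?_
    obtain ⟨t, ht, hts⟩ := mem_comap.1 hs
    obtain ⟨_, hy, y, hyball, rfl⟩ := mem_closure_iff_nhds.1 (mem_closure_image_eval hG) t ht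
    exact ⟨y, hts hy, hyball⟩
  · exact mem_of_superset (mem_inf_of_right (mem_principal_self _)) fun _ =>
      mem_closedBall_zero_iff.1
  · exact tendsto_pi_nhds.1 (tendsto_comap.mono_left inf_le_left : Tendsto T _ _) F

theorem exists_norm_le_one_lt_apply {E : Type*} [NormedAddCommGroup E] [NormedSpace ℝ E]
    {G : StrongDual ℝ E} {r : ℝ} (hr : r < ‖G‖) : ∃ x, ‖x‖ ≤ 1 ∧ r < G x := by
  by_contra! h
  exact (opNorm_le_of_forall_apply_le h).not_gt hr

theorem cauchy_of_tendsto_apply [UniformConvexSpace Z] {G : StrongDual ℝ (StrongDual ℝ Z)}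
    (hG : ‖G‖ = 1) {l : Filter Z} [l.NeBot] (hball : ∀ᶠ y in l, ‖y‖ ≤ 1)
    (hl : ∀ F : StrongDual ℝ Z, Tendsto F l (𝓝 (G F))) : Cauchy l := by
  refine Metric.cauchy_iff.2 ⟨inferInstance, fun ε hε => ?_⟩
  obtain ⟨δ, hδ, hconvex⟩ := exists_forall_closed_ball_dist_add_le_two_sub Z hε
  -- On the unit ball, if `F x` and `F y` are close to `1`, then `‖x + y‖` is close to `2`.
  obtain ⟨F, hF, hGF⟩ : ∃ F, ‖F‖ ≤ 1 ∧ 1 - δ / 2 < G F :=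
    exists_norm_le_one_lt_apply (by linarith)
  refine ⟨_, hball.and ((hl F).eventually (lt_mem_nhds hGF)), ?_⟩
  rintro x ⟨hx, hFx⟩ y ⟨hy, hFy⟩
  rw [dist_eq_norm]
  by_contra! hxy
  have hle : F (x + y) ≤ ‖x + y‖ :=
    (le_abs_self _).trans (F.le_of_opNorm_le_of_le hF le_rfl |>.trans_eq (one_mul _))
  rw [map_add] at hle
  linarith [hconvex hx hy hxy]

set_option maxSynthPendingDepth 3 in
/-- The Milman–Pettis theorem. -/
theorem exists_forall_apply_eq [CompleteSpace Z] [UniformConvexSpace Z]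
    (G : StrongDual ℝ (StrongDual ℝ Z)) : ∃ y : Z, ∀ F : StrongDual ℝ Z, F y = G F := by
  suffices hunit : ∀ G : StrongDual ℝ (StrongDual ℝ Z), ‖G‖ = 1 → ∃ y : Z, ∀ F, F y = G F by
    rcases eq_or_ne G 0 with rfl | hG
    · exact ⟨0, fun F => by simp⟩
    · obtain ⟨y, hy⟩ := hunit (‖G‖⁻¹ • G) (norm_smul_inv_norm (𝕜 := ℝ) hG)
      exact ⟨‖G‖ • y, fun F => by simp [hy, norm_ne_zero_iff.2 hG]⟩
  intro G hG
  obtain ⟨l, _, hball, hl⟩ := exists_filter_tendsto_apply hG.le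
  obtain ⟨y, hy⟩ := CompleteSpace.complete (cauchy_of_tendsto_apply hG hball hl)
  exact ⟨y, fun F => tendsto_nhds_unique (F.continuous.continuousAt.mono_left hy) (hl F)⟩

end Reflexive

section UniformlyConvex

theorem exists_strongDual_ne_zero_of_isClosed {E : Type*} [NormedAddCommGroup E]
    [NormedSpace ℝ E] {C : Submodule ℝ E} (hC : IsClosed (C : Set E)) (hne : C ≠ ⊤) :
    ∃ G : StrongDual ℝ E, G ≠ 0 ∧ ∀ F ∈ C, G F = 0 := by
  obtain ⟨F₀, -, hF₀⟩ := SetLike.exists_of_lt hne.lt_top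
  obtain ⟨G, c, hG, hc⟩ := geometric_hahn_banach_closed_point C.convex hC hF₀
  have hc0 : 0 < c := by simpa using hG 0 C.zero_mem
  refine ⟨G, fun h => ?_, fun F hF => by_contra fun h => ?_⟩
  · simp only [h, zero_apply] at hc
    exact hc.not_gt hc0
  · have hlt := hG _ (C.smul_mem (c / G F) hF)
    rw [map_smul, smul_eq_mul, div_mul_cancel₀ c h] at hlt
    exact hlt.false

theorem norm_inv_norm_smul_sub_self {E : Type*} [NormedAddCommGroup E] [NormedSpace ℝ E] {x : E}
    (hx : x ≠ 0) : ‖‖x‖⁻¹ • x - x‖ = |1 - ‖x‖| := by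
  have hnorm : ‖x‖ ≠ 0 := norm_ne_zero_iff.2 hx
  have hsub : ‖x‖⁻¹ • x - x = (‖x‖⁻¹ * (1 - ‖x‖)) • x := by
    rw [mul_sub, mul_one, inv_mul_cancel₀ hnorm, sub_smul, one_smul]
  rw [hsub, norm_smul, Real.norm_eq_abs, abs_mul, abs_inv, abs_norm]
  field_simp

variable {M : Set ZFSet.{u}} [hM : Fact (IsTransitiveModelZFC M)] {X : BanachIn M}
  {Z : Type w} [NormedAddCommGroup Z] [NormedSpace ℝ Z] {j : X.carrier → Z}

namespace IsBanachCompletion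

variable (hj : IsBanachCompletion X j)
include hj

theorem exists_norm_eq_one {z : Z} (hz : ‖z‖ = 1) {η : ℝ} (hη : 0 < η) :
    ∃ x, (X.norm x).val = 1 ∧ ‖j x - z‖ < η := by
  obtain ⟨x, hx⟩ := hj.denseRange.exists_dist_lt z (ε := min (η / 2) 1) (by positivity)
  rw [lt_min_iff, dist_comm, dist_eq_norm] at hx
  have hnear : |1 - ‖j x‖| ≤ ‖j x - z‖ := by
    rw [← hz, abs_sub_comm]
    exact abs_norm_sub_norm_le (j x) z
  have hpos : 0 < ‖j x‖ := by linarith [abs_le.1 hnear]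
  obtain ⟨t, ht⟩ := exists_mreal_inv (X.norm x) (hj.norm_map x ▸ hpos)
  have hunit : j (X.smul t x) = ‖j x‖⁻¹ • j x := by rw [hj.map_smul, ht, hj.norm_map]
  refine ⟨X.smul t x, ?_, ?_⟩
  · rw [← hj.norm_map, hunit, norm_smul, norm_inv, norm_norm, inv_mul_cancel₀ hpos.ne']
  · have hmove := norm_inv_norm_smul_sub_self (norm_pos_iff.1 hpos)
    have htri := norm_sub_le_norm_sub_add_norm_sub (j (X.smul t x)) (j x) z
    rw [hunit] at htri ⊢
    linarith

theorem uniformConvexSpace (hX : X.UniformlyConvex) : UniformConvexSpace Z where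
  uniform_convex ε hε := by
    obtain ⟨δ, hδ, hconvex⟩ := hX (ε / 2) (half_pos hε)
    refine ⟨δ, hδ, fun z hz z' hz' hzz' => le_of_forall_pos_le_add fun η hη => ?_⟩
    have hη' : 0 < min (η / 2) (ε / 4) := by positivity
    obtain ⟨x, hx, hxz⟩ := hj.exists_norm_eq_one hz hη'
    obtain ⟨x', hx', hxz'⟩ := hj.exists_norm_eq_one hz' hη'
    rw [lt_min_iff] at hxz hxz'
    have hxx' := hconvex x x' hx hx'
    rw [← hj.norm_map, ← hj.norm_map, hj.map_sub, hj.map_add] at hxx'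
    have hsub : ‖z - z'‖ ≤ ‖j x - j x'‖ + ‖j x - z‖ + ‖j x' - z'‖ := by
      calc ‖z - z'‖ = ‖(j x - j x') - (j x - z) + (j x' - z')‖ := by congr 1; abel
        _ ≤ _ := (norm_add_le _ _).trans (add_le_add_left (norm_sub_le _ _) _)
    have hadd : ‖z + z'‖ ≤ ‖j x + j x'‖ + ‖j x - z‖ + ‖j x' - z'‖ := by
      calc ‖z + z'‖ = ‖(j x + j x') - (j x - z) - (j x' - z')‖ := by congr 1; abel
        _ ≤ _ := (norm_sub_le _ _).trans (add_le_add_left (norm_sub_le _ _) _)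
    linarith [hxx' (by linarith)]

theorem dualClosure_eq_top [CompleteSpace Z] (hX : X.UniformlyConvex) :
    hj.dualClosure = ⊤ := by
  have := hj.uniformConvexSpace hX
  by_contra hne
  obtain ⟨G, hG, hGC⟩ := exists_strongDual_ne_zero_of_isClosed hj.isClosed_dualClosure hne
  obtain ⟨y, hy⟩ := exists_forall_apply_eq G
  have hy0 : y ≠ 0 := by
    rintro rfl
    exact hG (ContinuousLinearMap.ext fun F => by simp [← hy])
  obtain ⟨f, hf⟩ := hj.exists_dualExt_ne_zero hy0
  exact hf ((hy _).trans (hGC _ (subset_closure ⟨f, rfl⟩)))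

end IsBanachCompletion

end UniformlyConvex

section Transport

variable {Z : Type w} [NormedAddCommGroup Z] [NormedSpace ℝ Z]

theorem exists_normedSpace_of_equiv {E : Type v} (e : E ≃ Z) :
    ∃ (_ : NormedAddCommGroup E) (_ : NormedSpace ℝ E) (L : E ≃ₗᵢ[ℝ] Z), ⇑L = e := by
  let _ := e.normedAddCommGroup
  let _ := e.normedSpace ℝ
  exact ⟨inferInstance, inferInstance, ⟨e.linearEquiv ℝ, fun _ => rfl⟩, rfl⟩

theorem toTopologicalSpace_eq_induced {E : Type v} [NormedAddCommGroup E] [NormedSpace ℝ E]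
    (L : E ≃ₗᵢ[ℝ] Z) :
    (UniformSpace.toTopologicalSpace : TopologicalSpace E) = .induced L inferInstance :=
  L.toHomeomorph.isInducing.eq_induced

theorem exists_normedSpace_of_homeomorph {E : Type v} [top : TopologicalSpace E] (e : E ≃ₜ Z) :
    ∃ (_ : NormedAddCommGroup E) (_ : NormedSpace ℝ E) (L : E ≃ₗᵢ[ℝ] Z),
      top = UniformSpace.toTopologicalSpace ∧ ⇑L = e := by
  have htop := e.isInducing.eq_induced
  obtain ⟨_, _, L, hL⟩ := exists_normedSpace_of_equiv e.toEquiv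
  refine ⟨_, _, L, ?_, hL⟩
  rw [htop, toTopologicalSpace_eq_induced L, hL]
  rfl

theorem completeSpace_of_linearIsometryEquiv [CompleteSpace Z] {E : Type v}
    [NormedAddCommGroup E] [NormedSpace ℝ E] (L : E ≃ₗᵢ[ℝ] Z) : CompleteSpace E :=
  (L.isometry.isUniformInducing.completeSpace_congr L.surjective).2 inferInstance

theorem IsBanachCompletion.comp_linearIsometryEquiv {M : Set ZFSet.{u}} {X : BanachIn M}
    {j : X.carrier → Z} (hj : IsBanachCompletion X j) {E : Type v} [NormedAddCommGroup E]
    [NormedSpace ℝ E] (L : Z ≃ₗᵢ[ℝ] E) : IsBanachCompletion X fun x => L (j x) where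
  map_add x y := by rw [hj.map_add, _root_.map_add]
  map_smul r x := by rw [hj.map_smul, _root_.map_smul]
  norm_map x := by rw [L.norm_map, hj.norm_map]
  denseRange := L.surjective.denseRange.comp hj.denseRange L.continuous

end Transport

section Main

variable {M : Set ZFSet.{u}} [hM : Fact (IsTransitiveModelZFC M)] {X : BanachIn M}

variable (X) in
theorem exists_isBanachCompletion_small :
    ∃ (Z : Type u) (_ : NormedAddCommGroup Z) (_ : NormedSpace ℝ Z) (j : X.carrier → Z),
      CompleteSpace Z ∧ IsBanachCompletion X j := by
  obtain ⟨Z, _, _, j, _, hsmall, hj⟩ := exists_isBanachCompletion X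
  obtain ⟨T, ⟨e⟩⟩ := hsmall.equiv_small
  obtain ⟨_, _, L, -⟩ := exists_normedSpace_of_equiv e.symm
  exact ⟨T, inferInstance, inferInstance, _, completeSpace_of_linearIsometryEquiv L,
    hj.comp_linearIsometryEquiv L.symm⟩

theorem exists_isBanachCompletion_of_interprets {Xhat : Type u} {top : TopologicalSpace Xhat}
    {π : X.carrier → Xhat} (hπ : Interprets M X.space top π) :
    ∃ (_ : NormedAddCommGroup Xhat) (_ : NormedSpace ℝ Xhat),
      top = UniformSpace.toTopologicalSpace ∧ CompleteSpace Xhat ∧ IsBanachCompletion X π := by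
  obtain ⟨Z, _, _, j, _, hj⟩ := exists_isBanachCompletion_small X
  obtain ⟨e, he⟩ := exists_homeomorph_of_interprets hπ hj.interprets
  obtain ⟨_, _, L, htop, hL⟩ := exists_normedSpace_of_homeomorph e
  have hπj : π = fun x => L.symm (j x) := funext fun x =>
    L.eq_symm_apply.2 ((congrFun hL _).trans (he x))
  exact ⟨_, _, htop, completeSpace_of_linearIsometryEquiv L,
    hπj ▸ hj.comp_linearIsometryEquiv L.symm⟩

namespace IsBanachCompletion

variable {Z : Type w} [NormedAddCommGroup Z] [NormedSpace ℝ Z]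
  {j : X.carrier → Z} (hj : IsBanachCompletion X j)
include hj

theorem exists_interpretsMap_dualNorm : ∃ dualNorm : X.Dual → MReal M,
    (∀ f, (dualNorm f).val = X.supNorm (fun x => (f.toFun x).val)) ∧
    InterpretsMap (S := X.dualSpace) (T := realSpace M) M hj.dualEmb MReal.val dualNorm
      (fun F : hj.dualClosure => ‖(F : StrongDual ℝ Z)‖) := by
  choose dualNorm hnorm using hj.exists_dualNorm
  refine ⟨dualNorm, fun f => ?_, hj.interprets_dual, interprets_realSpace, by fun_prop,
    fun f => (hnorm f).symm⟩
  rw [hnorm, ← hj.supNorm_eq]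
  simp only [hj.dualExt_apply]

variable [CompleteSpace Z]

theorem interpretsMap_add : InterpretsMap (S := X.space.prod M X.space) (T := X.space) M
    (Prod.map j j) j (fun p : X.carrier × X.carrier => p.1 + p.2)
    (fun p : Z × Z => p.1 + p.2) :=
  ⟨interprets_prod hj.isMetricIn hj.isMetricIn rfl hj.opens_space rfl hj.opens_space,
    hj.interprets, by fun_prop, fun p => (hj.map_add p.1 p.2).symm⟩

theorem interpretsMap_smul : InterpretsMap (S := (realSpace M).prod M X.space) (T := X.space) M
    (Prod.map MReal.val j) j (fun p => X.smul p.1 p.2) (fun p : ℝ × Z => p.1 • p.2) :=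
  ⟨interprets_prod isMetricIn_val hj.isMetricIn code_realSpace opens_realSpace rfl
      hj.opens_space,
    hj.interprets, by fun_prop, fun p => (hj.map_smul p.1 p.2).symm⟩

theorem interpretsMap_norm : InterpretsMap (S := X.space) (T := realSpace M) M
    j MReal.val X.norm (fun x : Z => ‖x‖) :=
  ⟨hj.interprets, interprets_realSpace, continuous_norm, hj.norm_map⟩

theorem interpretsMap_dualExt (f : X.Dual) :
    InterpretsMap (S := X.space) (T := realSpace M) M j MReal.val f.toFun (hj.dualExt f) :=
  ⟨hj.interprets, interprets_realSpace, (hj.dualExt f).continuous, hj.dualExt_apply f⟩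

theorem interpretsMap_eval :
    InterpretsMap (S := X.space.prod M X.dualSpace) (T := realSpace M) M
      (Prod.map j hj.dualEmb) MReal.val (fun p => p.2.toFun p.1)
      (fun p : Z × hj.dualClosure => (p.2 : StrongDual ℝ Z) p.1) := by
  have := hj.isClosed_dualClosure.completeSpace_coe
  exact ⟨interprets_prod hj.isMetricIn hj.isMetricIn_dualEmb rfl hj.opens_space
      (funext fun f => (code_dual f).symm) hj.opens_dualSpace,
    interprets_realSpace, by fun_prop, fun p => hj.dualExt_apply p.2 p.1⟩

end IsBanachCompletion

end Main

end ModelInterpretation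

theorem mainTheorem9 {M : Set ZFSet.{u}} (hM : IsTransitiveModelZFC M) (X : BanachIn M)
    (Xhat : VSpace.{u}) (π : X.carrier → Xhat.Pt)
    (hπ : Interprets M X.space Xhat.top π) :
    ∃ (_ : NormedAddCommGroup Xhat.Pt) (_ : NormedSpace ℝ Xhat.Pt),
      -- the interpretations of the operations and of the norm of `X` make `Xhat` a Banach space
      Xhat.top = (inferInstance : TopologicalSpace Xhat.Pt) ∧
      CompleteSpace Xhat.Pt ∧
      InterpretsMap (S := X.space.prod M X.space) (T := X.space) M
        (Prod.map π π) π (fun p : X.carrier × X.carrier => p.1 + p.2)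
        (fun p : Xhat.Pt × Xhat.Pt => p.1 + p.2) ∧
      InterpretsMap (S := (realSpace M).prod M X.space) (T := X.space) M
        (Prod.map MReal.val π) π (fun p => X.smul p.1 p.2)
        (fun p : ℝ × Xhat.Pt => p.1 • p.2) ∧
      InterpretsMap (S := X.space) (T := realSpace M) M
        π MReal.val X.norm (fun x : Xhat.Pt => ‖x‖) ∧
      -- the interpretation of the dual
      ∃ (C : Submodule ℝ (StrongDual ℝ Xhat.Pt)) (ι : X.Dual → C),
        (∀ f : X.Dual, InterpretsMap (S := X.space) (T := realSpace M) M
          π MReal.val f.toFun (ι f : StrongDual ℝ Xhat.Pt)) ∧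
        IsClosed (C : Set (StrongDual ℝ Xhat.Pt)) ∧
        Interprets M X.dualSpace inferInstance ι ∧
        (∃ dualNorm : X.Dual → MReal M,
          (∀ f, (dualNorm f).val = X.supNorm (fun x => (f.toFun x).val)) ∧
          InterpretsMap (S := X.dualSpace) (T := realSpace M) M
            ι MReal.val dualNorm (fun f : C => ‖(f : StrongDual ℝ Xhat.Pt)‖)) ∧
        InterpretsMap (S := X.space.prod M X.dualSpace) (T := realSpace M) M
          (Prod.map π ι) MReal.val (fun p => p.2.toFun p.1)
          (fun p : Xhat.Pt × C => (p.2 : StrongDual ℝ Xhat.Pt) p.1) ∧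
        (X.UniformlyConvex → C = ⊤) := by
  have : Fact (IsTransitiveModelZFC M) := ⟨hM⟩
  obtain ⟨n, ns, htop, hcomplete, hj⟩ :=
    ModelInterpretation.exists_isBanachCompletion_of_interprets hπ
  exact ⟨n, ns, htop, hcomplete, hj.interpretsMap_add, hj.interpretsMap_smul,
    hj.interpretsMap_norm, hj.dualClosure, hj.dualEmb, hj.interpretsMap_dualExt,
    hj.isClosed_dualClosure, hj.interprets_dual, hj.exists_interpretsMap_dualNorm,
    hj.interpretsMap_eval, hj.dualClosure_eq_top⟩
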